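/- Let $m\ge 1$ and $\mathbb R^{n}=\mathbb R^{n_1}\times\dots\times\mathbb R^{n_m}$ with the Euclidean inner product, and let $[m]=\{1,\dots,m\}$. **Problem.** For $j\in[m]$ let $X^j=X_0^j\cap\bigcap_{i\in\mathcal I_j}X^j_i$, where $X_0^j$ and $X^j_i=\{x\in\mathbb R^{n_j}:g_i(j|x)\le 0\}$ are closed and convex and $g_i(j|\cdot):\mathbb R^{n_j}\to\mathbb R\cup\{\infty\}$ is convex. Write $g^+=\max\{g,0\}$. Assume that $\partial g_i^+(j|x)\neq\emptyset$ for $x\in X_0^j\setminus X_i^j$, and that for each $j$ the vectors in $\partial g^+_i(j|x)$, $x\in X^j_0$, $i\in\mathcal I_j$, are uniformly bounded. Let $X=X^1\times\dots\times X^m$. Let $v=(v_1,\dots,v_m)$ be a random variable and $F(v,x)=(F_1(v_1,x),\dots,F_m(v_m,x))\in\mathbb R^{n}$ a random operator with $\mathbb E\|F(v,x)\|^2<\infty$ for every $x\in\mathbb R^n$, such that almost surely $\|F(v,y)-F(v,x)\|\le L(v)\|y-x\|$ for all $x,y$, where $\mathbb E[L(v)^2]<\infty$. Assume that $T(x)=\mathbb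 E[F(v,x)]$ is monotone on $\mathbb R^n$ and that the solution set $X^*=\{z\in X:\langle T(z),x-z\rangle\ge 0\ \forall x\in X\}$ is nonempty. Let $\mathsf G(x)=\sup_{y\in X}\langle T(y),x-y\rangle$ be the dual gap function and $\Pi$ the orthogonal projection onto $X$. **Method.** Let $x^0\in\mathbb R^n$ be given, and for $k\ge 0$ and $j\in[m]$ let $$y^k_j=\Pi_{X_0^j}\big[x^k_j-\alpha_{k,j}(F_j(v^k_j,x^k)+\epsilon_{k,j}x^k_j)\big],\qquad x^{k+1}_j=\Pi_{X_0^j}\Big[y^k_j-\beta_{k,j}\frac{g^+_{\omega_{k,j}}(j|y^k_j)}{\|d^k_j\|^2}d^k_j\Big],$$ where $d^k_j\ne 0$, and $d_j^k\in\partial g^+_{\omega_{k,j}}(j|y^k_j)$ whenever $g_{\omega_{k,j}}(j|y^k_j)>0$. Let $\mathcal F_k=\sigma(\omega^0,\dots,\omega^{k-1},v^0,\dots,v^{k-1})$. Each sample $v^k$ is distributed as $v$ and independent of $\mathcal F_k$ (so the samples are i.i.d.), $d^k$ is $\mathcal F_{k+1}$-measurable, and for each $j$ there is $c^j>0$ such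 that, for all $k$ and all $x\in X_0^j$, almost surely $$\mathrm{dist}(x,X^j)^2\le c^j\,\mathbb E\big[g^+_{\omega_{k,j}}(j|x)^2\,\big|\,\mathcal F_k\big].$$ **Parameters.** Let $\delta\in(0,\tfrac12)$ and, for $j\in[m]$, let $C_j,D_j,a_j,e_j>0$ and $\beta_j\in(0,2)$. For all $k\ge0$ take $$\alpha_{k,j}=\frac{a_j}{(k+C_j)^{1/2+\delta}},\qquad \epsilon_{k,j}=\frac{e_j}{(k+D_j)^{1/2-\delta}},\qquad \beta_{k,j}=\beta_j.$$ **Conclusions.** For $u\in\{\alpha,\beta,\epsilon\}$ let $u_{k,\min}=\min_ju_{k,j}$ and $u_{k,\max}=\max_ju_{k,j}$, let $\mathsf B_k=\beta_{k,\min}(2-\beta_{k,\max})$, and define $$\widetilde x^k=\frac{\sum_{i=0}^k\mathsf B_ix^i}{\sum_{i=0}^k\mathsf B_i},\qquad \widehat x^k=\frac{\sum_{i=0}^k\alpha_{i,\max}\Pi(x^i)}{\sum_{i=0}^k\alpha_{i,\max}}.$$ 1. Almost surely $\{x^k\}$ is bounded and all its cluster points belong to $X^*$. 2. If $\limsup_k\epsilon_{k,\max}/\epsilon_{k,\min}\le1$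 (that is, if all $e_j$ are equal), then almost surely $\{x^k\}$ converges to the least-norm element of $X^*$. 3. There is a constant $K$ such that $\mathbb E[\mathrm{dist}(\widetilde x^k,X)^2]\le K/k$ for all $k\ge1$. 4. If $X$ is compact, there is a constant $K$ such that $\mathbb E[\mathsf G(\widehat x^k)]\le K\,k^{\delta}\ln k/\sqrt k$ for all $k\ge2$. -/

import Mathlib

open MeasureTheory ProbabilityTheory Filter Topology

namespace IncrementalProjection

/-- The `j`-th factor of the Cartesian product, a Euclidean space of dimension `n j`. -/
abbrev Block {m : ℕ} (n : Fin m → ℕ) (j : Fin m) : Type := EuclideanSpace ℝ (Fin (n j))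

/-- The whole space `ℝ^(n 0) × ⋯ × ℝ^(n (m-1))` with the Euclidean norm
(inner product `∑ j, ⟪x j, y j⟫`). -/
abbrev Whole {m : ℕ} (n : Fin m → ℕ) : Type := PiLp 2 (Block n)

section Convex

variable {E : Type*} [NormedAddCommGroup E] [InnerProductSpace ℝ E]

/-- Orthogonal projection: a nearest point of `C` to `x`. For a nonempty closed convex set `C` in a
Euclidean space it exists and is unique. -/
noncomputable def proj (C : Set E) (x : E) : E :=
  Classical.epsilon fun p => p ∈ C ∧ ∀ q ∈ C, ‖x - p‖ ≤ ‖x - q‖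

/-- Convexity of a function with values in `ℝ ∪ {+∞}`, through its epigraph. -/
def IsConvexFun (f : E → EReal) : Prop :=
  (∀ x, f x ≠ ⊥) ∧ Convex ℝ {p : E × ℝ | f p.1 ≤ (p.2 : EReal)}

/-- Subdifferential of an extended-valued function at a point (empty outside the domain). -/
def subdiff (f : E → EReal) (x : E) : Set E :=
  {d | f x ≠ ⊤ ∧ ∀ z, f x + ((inner ℝ d (z - x) : ℝ) : EReal) ≤ f z}

/-- Positive part of an extended-valued function. -/
noncomputable def positivePart (f : E → EReal) (x : E) : EReal := max (f x) 0

/-- Solution set of the variational inequality `VI(T, X)`. -/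
def solutionSet (T : E → E) (X : Set E) : Set E :=
  {z | z ∈ X ∧ ∀ x ∈ X, 0 ≤ inner ℝ (T z) (x - z)}

/-- Dual gap function `G(x) = sup_{y ∈ X} ⟪T y, x - y⟫`, with values in `ℝ ∪ {±∞}`. -/
noncomputable def dualGap (T : E → E) (X : Set E) (x : E) : EReal :=
  ⨆ y ∈ X, ((inner ℝ (T y) (x - y) : ℝ) : EReal)

end Convex

/-- Data of a Cartesian stochastic variational inequality with `m` agents: the components
`F j (v j, ·)` of the random operator, the hard constraints `X₀ j`, and the functions `g j i`
representing the soft constraints. -/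
structure Problem (m : ℕ) (n : Fin m → ℕ) (Ξ I : Fin m → Type*) where
  F : ∀ j, Ξ j → Whole n → Block n j
  X₀ : ∀ j, Set (Block n j)
  g : ∀ j, I j → Block n j → EReal

namespace Problem

variable {m : ℕ} {n : Fin m → ℕ} {Ξ I : Fin m → Type*} (P : Problem m n Ξ I)

/-- Soft constraint `{x : g j i x ≤ 0}`. -/
def soft (j : Fin m) (i : I j) : Set (Block n j) := {x | P.g j i x ≤ 0}

/-- The feasible set `X₀ j ∩ ⋂ i, soft j i` of agent `j`. -/
def agentSet (j : Fin m) : Set (Block n j) := P.X₀ j ∩ ⋂ i, P.soft j i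

/-- The feasible set `X`, the Cartesian product of the agents' feasible sets. -/
def feasible : Set (Whole n) := {x | ∀ j, x j ∈ P.agentSet j}

/-- The random operator `F(v, x) = (F_1(v_1, x), …, F_m(v_m, x))`. -/
def op (ξ : ∀ j, Ξ j) (x : Whole n) : Whole n := WithLp.toLp 2 fun j => P.F j (ξ j) x

/-- The mean operator `T x = E[F(v, x)]`. -/
noncomputable def mean {Ω : Type*} [MeasurableSpace Ω] (μ : Measure Ω) (v : Ω → ∀ j, Ξ j)
    (x : Whole n) : Whole n := ∫ o, P.op (v o) x ∂μ

/-- The real number `max (g j i x) 0` (finite at every point where it is used below). -/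
noncomputable def gPos (j : Fin m) (i : I j) (x : Block n j) : ℝ := (positivePart (P.g j i) x).toReal

/-- Standing assumptions on the constraints: the hard and soft sets are closed and convex, the
soft sets are given by convex functions, and over the hard set the subgradients of the positive
parts exist at the points violating the constraint and are uniformly bounded. -/
structure ConstraintAssumption [∀ j, MeasurableSpace (I j)] : Prop where
  isClosed_hard : ∀ j, IsClosed (P.X₀ j)
  convex_hard : ∀ j, Convex ℝ (P.X₀ j)
  isClosed_soft : ∀ j i, IsClosed (P.soft j i)
  convex_g : ∀ j i, IsConvexFun (P.g j i)
  measurable_g : ∀ j, Measurable fun p : I j × Block n j => P.g j p.1 p.2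
  exists_subgradient : ∀ j i, ∀ x ∈ P.X₀ j, x ∉ P.soft j i → (subdiff (positivePart (P.g j i)) x).Nonempty
  bounded_subgradient : ∀ j, ∃ Cg : ℝ, 0 < Cg ∧
    ∀ i, ∀ x ∈ P.X₀ j, ∀ d ∈ subdiff (positivePart (P.g j i)) x, ‖d‖ ≤ Cg

section Probability

variable {Ω : Type*} [MeasurableSpace Ω] (μ : Measure Ω)
  [∀ j, MeasurableSpace (Ξ j)] [∀ j, MeasurableSpace (I j)]

/-- Assumptions on the operator: `F` is measurable, `F(v, x)` is square integrable for each `x`,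
`F(v, ·)` is a.s. Lipschitz with a square-integrable modulus, the mean operator is monotone, and
the variational inequality `VI(T, X)` has a solution. -/
structure OperatorAssumption (v : Ω → ∀ j, Ξ j) : Prop where
  measurable_v : Measurable v
  measurable_F : ∀ j, Measurable fun p : Ξ j × Whole n => P.F j p.1 p.2
  memLp_F : ∀ x, MemLp (fun o => P.op (v o) x) 2 μ
  lipschitz : ∃ L : (∀ j, Ξ j) → ℝ, Measurable L ∧ (∀ ξ, 0 ≤ L ξ) ∧
    MemLp (fun o => L (v o)) 2 μ ∧
    ∀ᵐ ξ ∂(μ.map v), ∀ x y, ‖P.op ξ y - P.op ξ x‖ ≤ L ξ * ‖y - x‖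
  monotone : ∀ x y, 0 ≤ inner ℝ (P.mean μ v y - P.mean μ v x) (y - x)
  consistent : (solutionSet (P.mean μ v) P.feasible).Nonempty

/-- The history `σ(ω^0, …, ω^{k-1}, v^0, …, v^{k-1})`, where `c i = ω^i` are the random controls
and `s i = v^i` the operator samples. -/
@[reducible] def history (c : ℕ → Ω → ∀ j, I j) (s : ℕ → Ω → ∀ j, Ξ j) (k : ℕ) : MeasurableSpace Ω :=
  ⨆ i : Fin k, MeasurableSpace.comap (c i) inferInstance ⊔
    MeasurableSpace.comap (s i) inferInstance

/-- Assumptions on the sampling: the operator samples are distributed as `v` and each is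
independent of the history (in particular they are i.i.d.), and the random controls satisfy the
constraint regularity condition `dist(x, X^j)² ≤ c_j E[(g⁺_{ω_{k,j}}(x))² | history]` on the hard
set. -/
structure SamplingAssumption (v : Ω → ∀ j, Ξ j) (c : ℕ → Ω → ∀ j, I j)
    (s : ℕ → Ω → ∀ j, Ξ j) : Prop where
  measurable_control : ∀ k, Measurable (c k)
  measurable_sample : ∀ k, Measurable (s k)
  identDistrib : ∀ k, IdentDistrib (s k) v μ μ
  indep : ∀ k, Indep (MeasurableSpace.comap (s k) inferInstance) (history c s k) μ
  regularity : ∀ j, ∃ κ : ℝ, 0 < κ ∧ ∀ k, ∀ x ∈ P.X₀ j, ∀ᵐ o ∂μ,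
    Metric.infDist x (P.agentSet j) ^ 2 ≤
      κ * (μ[fun o' => P.gPos j (c k o' j) x ^ 2 | history c s k]) o

end Probability

/-- `x` is a sequence of iterates of the regularized incremental projection method (distributed
case) with initial point `x0`, stepsizes `α`, `β`, regularization parameters `ε`, random controls
`c`, operator samples `s`, auxiliary iterates `y` and directions `d`. The directions are chosen on
the basis of the controls and samples seen so far. -/
structure IsRun {Ω : Type*} [∀ j, MeasurableSpace (Ξ j)]
    [∀ j, MeasurableSpace (I j)] (α β ε : ℕ → Fin m → ℝ) (x0 : Whole n)
    (c : ℕ → Ω → ∀ j, I j) (s : ℕ → Ω → ∀ j, Ξ j)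
    (x y d : ℕ → Ω → Whole n) : Prop where
  init : ∀ o, x 0 o = x0
  operator_step : ∀ k o j, y k o j =
    proj (P.X₀ j) (x k o j - α k j • (P.F j (s k o j) (x k o) + ε k j • x k o j))
  direction_ne_zero : ∀ k o j, d k o j ≠ 0
  direction_mem : ∀ k o j, 0 < P.g j (c k o j) (y k o j) →
    d k o j ∈ subdiff (positivePart (P.g j (c k o j))) (y k o j)
  direction_adapted : ∀ k j, Measurable[history c s (k + 1)] fun o => d k o j
  feasibility_step : ∀ k o j, x (k + 1) o j =
    proj (P.X₀ j) (y k o j -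
      (β k j * (P.gPos j (c k o j) (y k o j) / ‖d k o j‖ ^ 2)) • d k o j)

/-- The weighted ergodic average `x̃^k`, with weights `β_{i,min} (2 - β_{i,max})`. -/
noncomputable def ergodic (β : ℕ → Fin m → ℝ) (x : ℕ → Whole n) (k : ℕ) : Whole n :=
  (∑ i ∈ Finset.range (k + 1), (⨅ j, β i j) * (2 - ⨆ j, β i j))⁻¹ •
    ∑ i ∈ Finset.range (k + 1), ((⨅ j, β i j) * (2 - ⨆ j, β i j)) • x i

/-- The weighted ergodic average `x̂^k` of the projections of the iterates onto the feasible set,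
with weights `α_{i,max}`. -/
noncomputable def feasibleErgodic (α : ℕ → Fin m → ℝ) (x : ℕ → Whole n) (k : ℕ) : Whole n :=
  (∑ i ∈ Finset.range (k + 1), ⨆ j, α i j)⁻¹ •
    ∑ i ∈ Finset.range (k + 1), (⨆ j, α i j) • proj P.feasible (x i)

end Problem

end IncrementalProjection

/-! Put p = 1/2 + δ, so 1/2 < p < 1, and θ_k = (k+1)^(-p). Distances are measured in the norm that
gives block j the weight 1/a_j (`weightedSq`). In this norm the effective stepsize of every agent is
α_{k,j}/a_j = θ_k + O(θ_k²), and the effective regularization is α_{k,j} ε_{k,j}/a_j = e_j/(k+1) +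
O(θ_k²) (`exists_parameter_bound`). Since 2p > 1, the θ_k² are summable, so disagreement between
agents and second moments of the samples are summable errors, while the contraction due to the
regularization, of order 1/(k+1), is not summable.

The iterates are compared with the Tikhonov trajectory z_k, where z_k solves the variational
inequality over X for T + (k+1)^(-(1-p)) diag(e). By monotonicity ⟨diag(e) z_k, z_k⟩ is
nondecreasing and bounded, which makes z_k converge to the solution of least e-weighted norm
(`exists_tendsto_tikhonov`) and makes (k+1)‖z_{k+1} - z_k‖² summable
(`summable_tikhonov_increments`).

For one iteration, the operator step is expanded by nonexpansiveness of the projection, and the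
Polyak step gains a multiple of the squared constraint violation. Moved from y^k to x^k and
integrated over an event of the history, this gain dominates dist(x^k, X)² by the regularity
condition (`exists_regularity`). The VI for z_k can only be tested at points of X, and the resulting
loss of order θ_k dist(x^k, X) is absorbed by that gain (`exists_drift_bound`). Changing the
reference point from z_k to z_{k+1} costs a multiple of (k+1)‖z_{k+1} - z_k‖². Altogether
(`exists_tracking_recursion`), with V_k the squared weighted distance from x^k to z_k, E[V_{k+1}; A]
≤ (1 - q/(k+1)) E[V_k; A] + t_k P(A) - r E[dist(x^k, X)²; A], with ∑ t_k < ∞. Supermartingale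
convergence together with E V_k → 0 gives V_k → 0 almost surely (`recursion_ae`), hence
`exists_limit`: for arbitrary e_j the iterates converge almost surely to one deterministic solution,
second moments are bounded, and ∑ E dist(x^k, X)² is finite.

Conclusion 1 follows at once. For conclusion 2 the limsup condition forces the e_j to coincide, so
the e-weighted norm is a multiple of the Euclidean one. Conclusion 3 is convexity of dist². For
conclusion 4 the one-step inequality is summed with a fixed z ∈ X as reference point, the
regularization now being an error of order 1/(k+1), whence the logarithm. The supremum over z is
inside the expectation, so the noise paired with z is bounded through the norm of the accumulated
noise, whose second moment is bounded by orthogonality of the increments (`exists_noise_bound`). -/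

set_option linter.unusedSectionVars false

namespace IncrementalProjection

/-! ### Projections onto closed convex sets and the Polyak step. -/

section Geometry

variable {E : Type*} [NormedAddCommGroup E] [InnerProductSpace ℝ E] [CompleteSpace E]
  {C : Set E}

theorem proj_spec (hne : C.Nonempty) (hc : IsClosed C) (hv : Convex ℝ C) (x : E) :
    proj C x ∈ C ∧ ∀ q ∈ C, ‖x - proj C x‖ ≤ ‖x - q‖ := by
  obtain ⟨p, hp, h⟩ := exists_norm_eq_iInf_of_complete_convex hne hc.isComplete hv x
  have : ∃ p, p ∈ C ∧ ∀ q ∈ C, ‖x - p‖ ≤ ‖x - q‖ := by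
    refine ⟨p, hp, fun q hq => ?_⟩
    rw [h]
    exact ciInf_le ⟨0, Set.forall_mem_range.2 fun _ => norm_nonneg _⟩ (⟨q, hq⟩ : C)
  exact Classical.epsilon_spec this

theorem proj_mem (hne : C.Nonempty) (hc : IsClosed C) (hv : Convex ℝ C) (x : E) :
    proj C x ∈ C := (proj_spec hne hc hv x).1

theorem inner_sub_proj_le (hne : C.Nonempty) (hc : IsClosed C) (hv : Convex ℝ C) (x : E)
    {q : E} (hq : q ∈ C) : inner ℝ (x - proj C x) (q - proj C x) ≤ 0 := by
  obtain ⟨hm, hle⟩ := proj_spec hne hc hv x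
  have : Nonempty C := ⟨⟨_, hm⟩⟩
  refine (norm_eq_iInf_iff_real_inner_le_zero hv hm).1 (le_antisymm ?_ ?_) q hq
  · exact le_ciInf fun w => hle w w.2
  · exact ciInf_le ⟨0, Set.forall_mem_range.2 fun _ => norm_nonneg _⟩ (⟨_, hm⟩ : C)

theorem norm_proj_sub_sq_le (hne : C.Nonempty) (hc : IsClosed C) (hv : Convex ℝ C) (x : E)
    {z : E} (hz : z ∈ C) : ‖proj C x - z‖ ^ 2 ≤ ‖x - z‖ ^ 2 := by
  have h := inner_sub_proj_le hne hc hv x hz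
  have e : x - z = (x - proj C x) - (z - proj C x) := by abel
  rw [e, @norm_sub_sq_real _ _ _ (x - proj C x), norm_sub_rev (proj C x) z]
  nlinarith [sq_nonneg ‖x - proj C x‖]

theorem norm_proj_sub_proj_le (hne : C.Nonempty) (hc : IsClosed C) (hv : Convex ℝ C) (x y : E) :
    ‖proj C x - proj C y‖ ≤ ‖x - y‖ := by
  have h1 := inner_sub_proj_le hne hc hv x (proj_mem hne hc hv y)
  have h2 := inner_sub_proj_le hne hc hv y (proj_mem hne hc hv x)
  set p := proj C x
  set q := proj C y
  -- Firm nonexpansiveness, the sum of the two obtuse-angle inequalities; Cauchy–Schwarz then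
  -- finishes.
  have h3 : ‖p - q‖ ^ 2 ≤ inner ℝ (x - y) (p - q) := by
    have e : inner ℝ (x - y) (p - q) - ‖p - q‖ ^ 2
        = - inner ℝ (x - p) (q - p) - inner ℝ (y - q) (p - q) := by
      rw [← real_inner_self_eq_norm_sq]
      simp only [inner_sub_left, inner_sub_right, real_inner_comm]
      ring
    linarith
  have h4 := real_inner_le_norm (x - y) (p - q)
  by_contra hlt
  push Not at hlt
  have : 0 < ‖p - q‖ := (norm_nonneg _).trans_lt hlt
  nlinarith

theorem proj_eq_self (hne : C.Nonempty) (hc : IsClosed C) (hv : Convex ℝ C) {x : E} (hx : x ∈ C) :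
    proj C x = x := by
  have := (proj_spec hne hc hv x).2 x hx
  simp only [sub_self, norm_zero, norm_le_zero_iff] at this
  exact (sub_eq_zero.1 this).symm

theorem continuous_proj (hne : C.Nonempty) (hc : IsClosed C) (hv : Convex ℝ C) :
    Continuous (proj C) :=
  (LipschitzWith.of_dist_le_mul (K := 1) fun x y => by
    simpa [dist_eq_norm] using norm_proj_sub_proj_le hne hc hv x y).continuous

theorem infDist_eq_norm_sub_proj (hne : C.Nonempty) (hc : IsClosed C) (hv : Convex ℝ C) (x : E) :
    Metric.infDist x C = ‖x - proj C x‖ := by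
  obtain ⟨hm, hle⟩ := proj_spec hne hc hv x
  refine le_antisymm ?_ ?_
  · rw [← dist_eq_norm]; exact Metric.infDist_le_dist_of_mem hm
  · exact (Metric.le_infDist hne).2 fun q hq => by rw [dist_eq_norm]; exact hle q hq

theorem norm_proj_sub_self_le (hne : C.Nonempty) (hc : IsClosed C) (hv : Convex ℝ C) {x : E}
    (hx : x ∈ C) (h : E) : ‖proj C (x - h) - x‖ ≤ ‖h‖ := by
  have := norm_proj_sub_proj_le hne hc hv (x - h) x
  rwa [proj_eq_self hne hc hv hx, sub_sub_cancel_left, norm_neg] at this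

/-- Convexity of the squared distance to a convex set. -/
theorem infDist_sum_sq_le (hne : C.Nonempty) (hc : IsClosed C) (hv : Convex ℝ C)
    {ι : Type*} (t : Finset ι) (w : ι → ℝ) (hw : ∀ i ∈ t, 0 ≤ w i) (hw1 : ∑ i ∈ t, w i = 1)
    (x : ι → E) :
    Metric.infDist (∑ i ∈ t, w i • x i) C ^ 2 ≤ ∑ i ∈ t, w i * Metric.infDist (x i) C ^ 2 := by
  have hm : ∑ i ∈ t, w i • proj C (x i) ∈ C :=
    hv.sum_mem hw hw1 fun i _ => proj_mem hne hc hv _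
  -- The average of the projections belongs to `C` and serves as a competitor.
  have h1 : Metric.infDist (∑ i ∈ t, w i • x i) C ≤ ∑ i ∈ t, w i * Metric.infDist (x i) C := by
    refine (Metric.infDist_le_dist_of_mem hm).trans ?_
    rw [dist_eq_norm, ← Finset.sum_sub_distrib]
    refine (norm_sum_le _ _).trans (Finset.sum_le_sum fun i hi => ?_)
    rw [← smul_sub, norm_smul, Real.norm_of_nonneg (hw i hi), infDist_eq_norm_sub_proj hne hc hv]
  refine (pow_le_pow_left₀ Metric.infDist_nonneg h1 2).trans ?_
  exact Real.pow_arith_mean_le_arith_mean_pow t w _ hw hw1 (fun _ _ => Metric.infDist_nonneg) 2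

/-- A Polyak subgradient step followed by a projection decreases the distance to the points
satisfying the constraint. -/
theorem polyak_step (hne : C.Nonempty) (hc : IsClosed C) (hv : Convex ℝ C) {y z d : E}
    (hz : z ∈ C) {β r M : ℝ} (hβ0 : 0 ≤ β) (hβ2 : β ≤ 2) (hr : 0 ≤ r) (hd : d ≠ 0)
    (hdM : 0 < r → ‖d‖ ≤ M) (hsub : 0 < r → r ≤ inner ℝ d (y - z)) (hy : y ∈ C) :
    ‖proj C (y - (β * (r / ‖d‖ ^ 2)) • d) - z‖ ^ 2 + β * (2 - β) / M ^ 2 * r ^ 2 ≤ ‖y - z‖ ^ 2 := by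
  -- With `r = 0` the step is trivial and `proj` fixes `y`; nothing is known about `d` in that case.
  rcases hr.eq_or_lt with rfl | hr
  · simp [proj_eq_self hne hc hv hy]
  have hn : 0 < ‖d‖ := norm_pos_iff.2 hd
  have h1 := norm_proj_sub_sq_le hne hc hv (y - (β * (r / ‖d‖ ^ 2)) • d) hz
  have e : y - (β * (r / ‖d‖ ^ 2)) • d - z = (y - z) - (β * (r / ‖d‖ ^ 2)) • d := by abel
  rw [e, @norm_sub_sq_real _ _ _ (y - z), norm_smul, inner_smul_right, real_inner_comm,
    Real.norm_of_nonneg (by positivity)] at h1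
  -- The cross term gains at least 2β r²/‖d‖² and the square of the step costs β² r²/‖d‖², which
  -- leaves β(2 - β) r²/‖d‖².
  have h2 : β * (r / ‖d‖ ^ 2) * r ≤ β * (r / ‖d‖ ^ 2) * inner ℝ d (y - z) :=
    mul_le_mul_of_nonneg_left (hsub hr) (by positivity)
  have h3 : (β * (r / ‖d‖ ^ 2) * ‖d‖) ^ 2 = β * (β * (r / ‖d‖ ^ 2) * r) := by
    field_simp
  have h4 : β * (2 - β) / M ^ 2 * r ^ 2 ≤ (2 - β) * (β * (r / ‖d‖ ^ 2) * r) := by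
    have : 1 / M ^ 2 ≤ 1 / ‖d‖ ^ 2 :=
      one_div_le_one_div_of_le (by positivity) (pow_le_pow_left₀ hn.le (hdM hr) 2)
    have h5 : 0 ≤ β * (2 - β) * r ^ 2 := mul_nonneg (mul_nonneg hβ0 (by linarith)) (by positivity)
    calc _ = (β * (2 - β) * r ^ 2) * (1 / M ^ 2) := by ring
      _ ≤ (β * (2 - β) * r ^ 2) * (1 / ‖d‖ ^ 2) := mul_le_mul_of_nonneg_left this h5
      _ = _ := by ring
  nlinarith

end Geometry

/-! ### Tikhonov regularization of a monotone variational inequality. -/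

section Tikhonov

variable {H : Type*} [NormedAddCommGroup H] [InnerProductSpace ℝ H]

/-- Variational inequalities with a strongly monotone Lipschitz operator are solvable. -/
theorem exists_strongly_monotone_vi [CompleteSpace H] {X : Set H} (hne : X.Nonempty) (hc : IsClosed X)
    (hv : Convex ℝ X) (S : H → H) {K σ : ℝ} (hK : 0 < K) (hσ : 0 < σ)
    (hL : ∀ x y, ‖S x - S y‖ ≤ K * ‖x - y‖)
    (hS : ∀ x y, σ * ‖x - y‖ ^ 2 ≤ inner ℝ (S x - S y) (x - y)) :
    ∃ z ∈ X, ∀ w ∈ X, 0 ≤ inner ℝ (S z) (w - z) := by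
  -- Enlarging the Lipschitz constant is harmless and makes `q` below nonnegative.
  wlog hσK : σ ≤ K generalizing K
  · exact this (K := max K σ) (lt_max_of_lt_left hK)
      (fun x y => (hL x y).trans (mul_le_mul_of_nonneg_right (le_max_left _ _) (norm_nonneg _)))
      (le_max_right _ _)
  -- This `g` minimizes 1 - 2gσ + g²K², the bound for the squared contraction factor of x ↦ proj X
  -- (x - g S x); `q` is the minimum. The fixed point of this map solves the variational inequality.
  set g : ℝ := σ / K ^ 2 with hg
  have hg0 : 0 < g := by positivity
  set q : ℝ := 1 - σ ^ 2 / K ^ 2 with hq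
  have hq0 : 0 ≤ q := by
    rw [hq, sub_nonneg, div_le_one (by positivity)]
    exact pow_le_pow_left₀ hσ.le hσK 2
  have hq1 : q < 1 := by rw [hq]; have : 0 < σ ^ 2 / K ^ 2 := by positivity
                         linarith
  have hcontr : ∀ x y, ‖proj X (x - g • S x) - proj X (y - g • S y)‖ ≤ √q * ‖x - y‖ := by
    intro x y
    refine (norm_proj_sub_proj_le hne hc hv _ _).trans ?_
    have e : x - g • S x - (y - g • S y) = (x - y) - g • (S x - S y) := by
      rw [smul_sub]; abel
    rw [e]
    refine le_of_sq_le_sq ?_ (by positivity)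
    rw [mul_pow, Real.sq_sqrt hq0, @norm_sub_sq_real, norm_smul, inner_smul_right,
      real_inner_comm, Real.norm_of_nonneg hg0.le]
    have h1 := hS x y
    have h2 : ‖S x - S y‖ ^ 2 ≤ K ^ 2 * ‖x - y‖ ^ 2 := by
      rw [← mul_pow]; exact pow_le_pow_left₀ (norm_nonneg _) (hL x y) 2
    have h3 : g ^ 2 * ‖S x - S y‖ ^ 2 ≤ g ^ 2 * (K ^ 2 * ‖x - y‖ ^ 2) :=
      mul_le_mul_of_nonneg_left h2 (by positivity)
    have h4 : g * (σ * ‖x - y‖ ^ 2) ≤ g * inner ℝ (S x - S y) (x - y) :=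
      mul_le_mul_of_nonneg_left h1 hg0.le
    have h5 : g * σ = σ ^ 2 / K ^ 2 := by rw [hg]; ring
    have h6 : g ^ 2 * K ^ 2 = σ ^ 2 / K ^ 2 := by rw [hg]; field_simp
    have h7 : q = 1 - 2 * (g * σ) + g ^ 2 * K ^ 2 := by rw [h5, h6, hq]; ring
    rw [h7]
    nlinarith
  have hCW : ContractingWith (NNReal.sqrt q.toNNReal) fun x => proj X (x - g • S x) := by
    refine ⟨?_, LipschitzWith.of_dist_le_mul fun x y => by
      simpa [dist_eq_norm, Real.coe_sqrt, Real.coe_toNNReal q hq0] using hcontr x y⟩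
    rw [← NNReal.coe_lt_coe, Real.coe_sqrt, Real.coe_toNNReal q hq0, NNReal.coe_one,
      Real.sqrt_lt' one_pos]
    simpa using hq1
  obtain ⟨z, hz, -⟩ := hCW.exists_fixedPoint 0 (edist_ne_top _ _)
  have hz' : proj X (z - g • S z) = z := hz
  refine ⟨z, hz' ▸ proj_mem hne hc hv _, fun w hw => ?_⟩
  have := inner_sub_proj_le hne hc hv (z - g • S z) hw
  rw [hz', sub_sub_cancel_left, inner_neg_left, inner_smul_left] at this
  simp only [conj_trivial] at this
  by_contra hlt
  push Not at hlt
  nlinarith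

variable {T : H → H} {X : Set H} {D : H →L[ℝ] H} {σ : ℝ}
  (hmono : ∀ x y, 0 ≤ inner ℝ (T x - T y) (x - y))
  (hsymm : ∀ x y, inner ℝ (D x) y = inner ℝ x (D y))
  (hσ : 0 < σ) (hcoer : ∀ x, σ * ‖x‖ ^ 2 ≤ inner ℝ (D x) x)

include hsymm in
theorem quad_sub (x y : H) : inner ℝ (D (x - y)) (x - y)
    = inner ℝ (D x) x - 2 * inner ℝ (D x) y + inner ℝ (D y) y := by
  have := hsymm x y
  have := real_inner_comm (D y) x
  simp only [map_sub, inner_sub_left, inner_sub_right]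
  linarith

include hmono in
/-- Comparison of two regularized solutions. -/
theorem tikhonov_inner_nonpos {η η' : ℝ} {z z' : H} (hz : z ∈ X) (hz' : z' ∈ X)
    (h : ∀ w ∈ X, 0 ≤ inner ℝ (T z + η • D z) (w - z))
    (h' : ∀ w ∈ X, 0 ≤ inner ℝ (T z' + η' • D z') (w - z')) :
    η * inner ℝ (D z) (z - z') - η' * inner ℝ (D z') (z - z') ≤ 0 := by
  -- Each inequality is tested at the solution of the other; in the sum monotonicity eliminates `T`.
  have h1 := h z' hz'
  have h2 := h' z hz
  have h3 := hmono z z'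
  simp only [inner_sub_left, inner_sub_right, inner_add_left, real_inner_smul_left] at *
  linarith

include hmono hsymm hσ hcoer in
-- Put N(z) = ⟨D z, z⟩ and Q = N(z - z'). Polarization turns `tikhonov_inner_nonpos` into (η + η') Q
-- ≤ (η' - η)(N(z) - N(z')), and η + η' ≥ 2η. The factor η' - η is what yields summable increments
-- along the trajectory.
theorem tikhonov_quad_sub_le {η η' : ℝ} (hle : η ≤ η') {z z' : H} (hz : z ∈ X)
    (hz' : z' ∈ X) (h : ∀ w ∈ X, 0 ≤ inner ℝ (T z + η • D z) (w - z))
    (h' : ∀ w ∈ X, 0 ≤ inner ℝ (T z' + η' • D z') (w - z')) :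
    2 * η * inner ℝ (D (z - z')) (z - z')
      ≤ (η' - η) * (inner ℝ (D z) z - inner ℝ (D z') z') := by
  have h1 := tikhonov_inner_nonpos hmono hz hz' h h'
  have h2 := quad_sub hsymm z z'
  have h3 : 0 ≤ inner ℝ (D (z - z')) (z - z') := le_trans (by positivity) (hcoer _)
  have h4 := hsymm z z'
  have h5 := real_inner_comm (D z') z
  simp only [inner_sub_right] at h1
  simp only [map_sub, inner_sub_left, inner_sub_right] at *
  nlinarith

include hmono hsymm hσ hcoer in
-- The claim is equivalent to 0 ≤ ⟨D z', z - z'⟩. With Q as before, the comparison of the two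
-- solutions reads η Q ≤ (η' - η) ⟨D z', z - z'⟩, which settles η < η'; for η = η' it gives Q = 0,
-- hence z = z'.
theorem tikhonov_quad_sub_le_sub {η η' : ℝ} (hη : 0 < η) (hle : η ≤ η') {z z' : H} (hz : z ∈ X)
    (hz' : z' ∈ X) (h : ∀ w ∈ X, 0 ≤ inner ℝ (T z + η • D z) (w - z))
    (h' : ∀ w ∈ X, 0 ≤ inner ℝ (T z' + η' • D z') (w - z')) :
    inner ℝ (D (z - z')) (z - z') ≤ inner ℝ (D z) z - inner ℝ (D z') z' := by
  have h0 := tikhonov_inner_nonpos hmono hz hz' h h'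
  have h2 := quad_sub hsymm z z'
  have h3 : 0 ≤ inner ℝ (D (z - z')) (z - z') := le_trans (by positivity) (hcoer _)
  have h4 := hsymm z z'
  have h5 := real_inner_comm (D z') z
  simp only [map_sub, inner_sub_left, inner_sub_right] at *
  rcases hle.eq_or_lt with rfl | hlt
  · have : inner ℝ (D z) z - inner ℝ (D z) z' - (inner ℝ (D z') z - inner ℝ (D z') z') ≤ 0 := by
      by_contra hc
      push Not at hc
      nlinarith
    have hzz : z - z' = 0 := by
      have h6 := hcoer (z - z')
      simp only [map_sub, inner_sub_left, inner_sub_right] at h6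
      have : ‖z - z'‖ ^ 2 ≤ 0 := by
        by_contra hc
        push Not at hc
        nlinarith [mul_pos hσ hc]
      exact norm_eq_zero.1 (pow_eq_zero_iff (two_ne_zero)|>.1 (le_antisymm this (sq_nonneg _)))
    rw [sub_eq_zero] at hzz
    subst hzz
    linarith
  · have : 0 ≤ inner ℝ (D z') z - inner ℝ (D z') z' := by
      by_contra hc
      push Not at hc
      nlinarith
    linarith

include hmono hsymm hσ hcoer in
-- A solution of the original problem is a regularized solution with parameter 0. The comparison
-- then says ⟨D z, z - q⟩ ≤ 0, so `q` cannot have a smaller D-norm than `z`.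
theorem tikhonov_quad_le {η : ℝ} (hη : 0 < η) {z q : H} (hz : z ∈ X)
    (hq : q ∈ solutionSet T X) (h : ∀ w ∈ X, 0 ≤ inner ℝ (T z + η • D z) (w - z)) :
    inner ℝ (D z) z ≤ inner ℝ (D q) q := by
  have h' : ∀ w ∈ X, 0 ≤ inner ℝ (T q + (0 : ℝ) • D q) (w - q) := by simpa using hq.2
  have h0 := tikhonov_inner_nonpos hmono hz hq.1 h h'
  have h2 := quad_sub hsymm z q
  have h3 : 0 ≤ inner ℝ (D (z - q)) (z - q) := le_trans (by positivity) (hcoer _)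
  simp only [inner_sub_right (D z)] at h0
  have : inner ℝ (D z) z - inner ℝ (D z) q ≤ 0 := by
    by_contra hc
    push Not at hc
    nlinarith
  linarith

include hmono hsymm hσ hcoer in
/-- The regularized solutions converge to a solution of least `D`-norm. -/
theorem exists_tendsto_tikhonov [CompleteSpace H] (hT : Continuous T) (hc : IsClosed X) {η : ℕ → ℝ}
    (hη : ∀ k, 0 < η k) (hanti : Antitone η) (hη0 : Tendsto η atTop (𝓝 0)) {z : ℕ → H}
    (hz : ∀ k, z k ∈ X) (h : ∀ k, ∀ w ∈ X, 0 ≤ inner ℝ (T (z k) + η k • D (z k)) (w - z k))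
    (hne : (solutionSet T X).Nonempty) :
    ∃ p ∈ solutionSet T X, Tendsto z atTop (𝓝 p) ∧
      ∀ q ∈ solutionSet T X, inner ℝ (D p) p ≤ inner ℝ (D q) q := by
  obtain ⟨q₀, hq₀⟩ := hne
  set N : ℕ → ℝ := fun k => inner ℝ (D (z k)) (z k) with hN
  -- The squared distances are controlled by the increments of `N`, which is monotone and bounded;
  -- so the trajectory is Cauchy without any compactness.
  have hdiff : ∀ k l, k ≤ l → σ * ‖z l - z k‖ ^ 2 ≤ N l - N k := fun k l hkl =>
    (hcoer _).trans (tikhonov_quad_sub_le_sub hmono hsymm hσ hcoer (hη l) (hanti hkl)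
      (hz l) (hz k) (h l) (h k))
  have hNm : Monotone N := fun k l hkl => by
    have := hdiff k l hkl
    have : 0 ≤ σ * ‖z l - z k‖ ^ 2 := by positivity
    linarith
  have hNb : BddAbove (Set.range N) := ⟨inner ℝ (D q₀) q₀, by
    rintro _ ⟨k, rfl⟩
    exact tikhonov_quad_le hmono hsymm hσ hcoer (hη k) (hz k) hq₀ (h k)⟩
  have hNt : Tendsto N atTop (𝓝 (⨆ k, N k)) := tendsto_atTop_ciSup hNm hNb
  have hcauchy : CauchySeq z := by
    rw [Metric.cauchySeq_iff']
    intro ε hε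
    have : ∀ᶠ k in atTop, (⨆ k, N k) - σ * ε ^ 2 < N k :=
      hNt.eventually (lt_mem_nhds (by linarith [mul_pos hσ (pow_pos hε 2)]))
    obtain ⟨k, hk⟩ := this.exists
    refine ⟨k, fun l hl => ?_⟩
    rw [dist_eq_norm]
    have h1 := hdiff k l hl
    have h2 : N l ≤ ⨆ k, N k := le_ciSup hNb l
    have h3 : ‖z l - z k‖ ^ 2 < ε ^ 2 := by
      by_contra hc
      push Not at hc
      nlinarith
    exact lt_of_pow_lt_pow_left₀ 2 hε.le h3
  obtain ⟨p, hp⟩ := cauchySeq_tendsto_of_complete hcauchy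
  have hpX : p ∈ X := hc.mem_of_tendsto hp (Eventually.of_forall hz)
  refine ⟨p, ⟨hpX, fun w hw => ?_⟩, hp, fun q hq => ?_⟩
  · have hlim : Tendsto (fun k => inner ℝ (T (z k) + η k • D (z k)) (w - z k)) atTop
        (𝓝 (inner ℝ (T p + (0 : ℝ) • D p) (w - p))) := by
      refine Tendsto.inner ?_ (tendsto_const_nhds.sub hp)
      exact ((hT.tendsto p).comp hp).add (hη0.smul ((D.continuous.tendsto p).comp hp))
    have := ge_of_tendsto hlim (Eventually.of_forall fun k => h k w hw)
    simpa using this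
  · have hlim : Tendsto N atTop (𝓝 (inner ℝ (D p) p)) :=
      Tendsto.inner ((D.continuous.tendsto p).comp hp) hp
    exact le_of_tendsto hlim (Eventually.of_forall fun k =>
      tikhonov_quad_le hmono hsymm hσ hcoer (hη k) (hz k) hq (h k))

include hmono hsymm hσ hcoer in
/-- The increments of the regularized solutions are summable with weights `k + 1`. -/
theorem summable_tikhonov_increments {η : ℕ → ℝ} (hη : ∀ k, 0 < η k) (hanti : Antitone η)
    (hratio : ∀ k : ℕ, (k + 1 : ℝ) * (η k - η (k + 1)) ≤ η (k + 1)) {z : ℕ → H}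
    (hz : ∀ k, z k ∈ X) (h : ∀ k, ∀ w ∈ X, 0 ≤ inner ℝ (T (z k) + η k • D (z k)) (w - z k))
    (hne : (solutionSet T X).Nonempty) :
    Summable fun k : ℕ => (k + 1 : ℝ) * ‖z (k + 1) - z k‖ ^ 2 := by
  obtain ⟨q₀, hq₀⟩ := hne
  set N : ℕ → ℝ := fun k => inner ℝ (D (z k)) (z k) with hN
  have hN0 : ∀ k, 0 ≤ N k := fun k => le_trans (by positivity) (hcoer _)
  -- The comparison bounds the squared increment by a multiple of (η_k - η_{k+1})/η_{k+1} times the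
  -- increment of `N`. By `hratio` this quotient is at most 1/(k+1), which pays for the weight and
  -- leaves a telescoping sum.
  have hstep : ∀ k : ℕ, (k + 1 : ℝ) * ‖z (k + 1) - z k‖ ^ 2 ≤ (2 * σ)⁻¹ * (N (k + 1) - N k) := by
    intro k
    have hle := hanti (Nat.le_succ k)
    have h1 := tikhonov_quad_sub_le hmono hsymm hσ hcoer hle
      (hz (k + 1)) (hz k) (h (k + 1)) (h k)
    have h2 := hcoer (z (k + 1) - z k)
    have h3 : 0 ≤ N (k + 1) - N k := by
      have h0 := tikhonov_quad_sub_le_sub hmono hsymm hσ hcoer (hη (k + 1)) hle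
        (hz (k + 1)) (hz k) (h (k + 1)) (h k)
      have : 0 ≤ σ * ‖z (k + 1) - z k‖ ^ 2 := by positivity
      simp only [hN]; linarith
    have h4 : η (k + 1) * (2 * σ * ((k + 1 : ℝ) * ‖z (k + 1) - z k‖ ^ 2))
        ≤ η (k + 1) * (N (k + 1) - N k) := by
      calc _ = (k + 1 : ℝ) * (2 * η (k + 1) * (σ * ‖z (k + 1) - z k‖ ^ 2)) := by ring
        _ ≤ (k + 1 : ℝ) * (2 * η (k + 1) * inner ℝ (D (z (k + 1) - z k)) (z (k + 1) - z k)) := by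
          have := hη (k + 1)
          gcongr
        _ ≤ (k + 1 : ℝ) * ((η k - η (k + 1)) * (N (k + 1) - N k)) := by
          gcongr
        _ = ((k + 1 : ℝ) * (η k - η (k + 1))) * (N (k + 1) - N k) := by ring
        _ ≤ _ := mul_le_mul_of_nonneg_right (hratio k) h3
    have h5 := le_of_mul_le_mul_left h4 (hη (k + 1))
    rw [inv_mul_eq_div, le_div_iff₀ (by positivity)]
    linarith
  refine summable_of_sum_range_le (c := (2 * σ)⁻¹ * inner ℝ (D q₀) q₀)
    (fun k => by positivity) fun n => ?_
  calc _ ≤ ∑ k ∈ Finset.range n, (2 * σ)⁻¹ * (N (k + 1) - N k) :=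
        Finset.sum_le_sum fun k _ => hstep k
    _ = (2 * σ)⁻¹ * (N n - N 0) := by rw [← Finset.mul_sum, Finset.sum_range_sub]
    _ ≤ _ := by
      have := tikhonov_quad_le hmono hsymm hσ hcoer (hη n) (hz n) hq₀ (h n)
      gcongr
      have := hN0 0
      simp only [hN] at *
      linarith

end Tikhonov

/-! ### Power sequences and the asymptotics of the parameters. -/

section Decay

/-- The sequence `(k + 1) ^ (-p)`. -/
noncomputable def decay (p : ℝ) (k : ℕ) : ℝ := ((k : ℝ) + 1) ^ (-p)

theorem decay_pos (p : ℝ) (k : ℕ) : 0 < decay p k := Real.rpow_pos_of_pos (by positivity) _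

theorem decay_mul (p q : ℝ) (k : ℕ) : decay p k * decay q k = decay (p + q) k := by
  rw [decay, decay, decay, ← Real.rpow_add (by positivity)]
  congr 1; ring

theorem decay_sq (p : ℝ) (k : ℕ) : decay p k ^ 2 = decay (2 * p) k := by
  rw [sq, decay_mul]; congr 1; ring

theorem decay_one (k : ℕ) : decay 1 k = ((k : ℝ) + 1)⁻¹ := by
  rw [decay, Real.rpow_neg_one]

theorem decay_le_decay {p q : ℝ} (h : p ≤ q) (k : ℕ) : decay q k ≤ decay p k :=
  Real.rpow_le_rpow_of_exponent_le (by linarith [Nat.cast_nonneg (α := ℝ) k]) (by linarith)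

theorem decay_le_one {p : ℝ} (h : 0 ≤ p) (k : ℕ) : decay p k ≤ 1 := by
  have := decay_le_decay h k
  simpa [decay] using this

theorem antitone_decay {p : ℝ} (h : 0 ≤ p) : Antitone (decay p) := fun k l hkl =>
  Real.rpow_le_rpow_of_nonpos (by positivity)
    (by have : (k : ℝ) ≤ l := by exact_mod_cast hkl
        linarith) (by linarith)

theorem tendsto_decay {p : ℝ} (h : 0 < p) : Tendsto (decay p) atTop (𝓝 0) :=
  (tendsto_rpow_neg_atTop h).comp
    (tendsto_atTop_add_const_right _ _ tendsto_natCast_atTop_atTop)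

theorem summable_decay {p : ℝ} (h : 1 < p) : Summable (decay p) := by
  have := (summable_nat_add_iff 1).2 (Real.summable_nat_rpow (p := -p) |>.2 (by linarith))
  refine this.congr fun k => ?_
  simp [decay]

/-- This is monotonicity of t ↦ t^(1-p) between k + 1 and k + 2. It provides the ratio condition of
`summable_tikhonov_increments`. -/
theorem decay_ratio {p : ℝ} (h1 : p ≤ 1) (k : ℕ) :
    (k + 1 : ℝ) * (decay p k - decay p (k + 1)) ≤ decay p (k + 1) := by
  have hk : (0 : ℝ) < k + 1 := by positivity
  have hk2 : (0 : ℝ) < k + 2 := by positivity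
  have e : decay p (k + 1) = ((k : ℝ) + 2) ^ (-p) := by
    rw [decay]; push_cast; congr 1; ring
  have h : (k + 1 : ℝ) * decay p k ≤ (k + 2 : ℝ) * decay p (k + 1) := by
    rw [e, decay]
    have h3 : ∀ t : ℝ, 0 < t → t * t ^ (-p) = t ^ (1 - p) := fun t ht => by
      rw [sub_eq_add_neg, Real.rpow_add ht, Real.rpow_one]
    rw [h3 _ hk, h3 _ hk2]
    exact Real.rpow_le_rpow hk.le (by linarith) (by linarith)
  linarith

/-- As 0 ≤ p ≤ 1, the number q^(-p) lies between 1 and q⁻¹, and |q⁻¹ - 1| = q⁻¹ |q - 1|. -/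
theorem abs_rpow_neg_sub_one_le {p q m : ℝ} (hp0 : 0 ≤ p) (hp1 : p ≤ 1) (hm : 0 < m) (hm1 : m ≤ 1)
    (hq : m ≤ q) : |q ^ (-p) - 1| ≤ m⁻¹ * |q - 1| := by
  have hq0 : 0 < q := hm.trans_le hq
  have hinv : 1 ≤ m⁻¹ := (one_le_inv₀ hm).2 hm1
  rcases le_total 1 q with h | h
  · have h1 : q ^ (-p) ≤ 1 := Real.rpow_le_one_of_one_le_of_nonpos h (by linarith)
    have h2 : q⁻¹ ≤ q ^ (-p) := by
      rw [← Real.rpow_neg_one]; exact Real.rpow_le_rpow_of_exponent_le h (by linarith)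
    rw [abs_of_nonpos (by linarith), abs_of_nonneg (by linarith)]
    have h3 : 1 - q⁻¹ ≤ q - 1 := by
      have : q * q⁻¹ = 1 := mul_inv_cancel₀ hq0.ne'
      nlinarith [inv_pos.2 hq0]
    nlinarith
  · have h1 : 1 ≤ q ^ (-p) := Real.one_le_rpow_of_pos_of_le_one_of_nonpos hq0 h (by linarith)
    have h2 : q ^ (-p) ≤ q⁻¹ := by
      rw [← Real.rpow_neg_one]
      exact Real.rpow_le_rpow_of_exponent_ge hq0 h (by linarith)
    rw [abs_of_nonneg (by linarith), abs_of_nonpos (by linarith)]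
    have h3 : q⁻¹ - 1 = q⁻¹ * (1 - q) := by
      rw [mul_sub, inv_mul_cancel₀ hq0.ne']; ring
    have h4 : q⁻¹ ≤ m⁻¹ := inv_anti₀ hm hq
    nlinarith

/-- The ratio (k + c)/(k + 1) differs from 1 by (c - 1)/(k + 1) and is at least min c 1, so changing
the shift causes a relative error of order 1/(k + 1). -/
theorem exists_abs_shift_sub_decay_le {p c : ℝ} (hp0 : 0 ≤ p) (hp1 : p ≤ 1) (hc : 0 < c) :
    ∃ M, 0 ≤ M ∧ ∀ k : ℕ, |((k : ℝ) + c) ^ (-p) - decay p k| ≤ M * (decay p k * decay 1 k) := by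
  refine ⟨(min c 1)⁻¹ * |c - 1|, by positivity, fun k => ?_⟩
  have hk : (0 : ℝ) < k + 1 := by positivity
  have e : ((k : ℝ) + c) ^ (-p) = decay p k * (((k : ℝ) + c) / (k + 1)) ^ (-p) := by
    rw [decay, Real.div_rpow (by positivity) hk.le]
    field_simp
  have h := abs_rpow_neg_sub_one_le hp0 hp1 (lt_min hc one_pos) (min_le_right c 1)
    (q := ((k : ℝ) + c) / (k + 1)) (by
      rw [le_div_iff₀ hk]
      have h1 := min_le_left c 1
      have h2 := min_le_right c 1
      nlinarith [Nat.cast_nonneg (α := ℝ) k])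
  have e2 : ((k : ℝ) + c) / (k + 1) - 1 = (c - 1) * decay 1 k := by
    rw [decay_one]; field_simp; ring
  rw [e2, abs_mul, abs_of_pos (decay_pos 1 k)] at h
  rw [e, ← mul_sub_one, abs_mul, abs_of_pos (decay_pos p k)]
  calc _ ≤ decay p k * ((min c 1)⁻¹ * (|c - 1| * decay 1 k)) :=
        mul_le_mul_of_nonneg_left h (decay_pos p k).le
    _ = _ := by ring

/-- The partial sums of `(k + 1) ^ (-p)` grow at least like `k ^ (1 - p)`. -/
theorem rpow_le_sum_decay {p : ℝ} (hp : 0 ≤ p) (k : ℕ) :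
    ((k : ℝ) + 1) ^ (1 - p) ≤ ∑ i ∈ Finset.range (k + 1), decay p i := by
  have h : ∀ i ∈ Finset.range (k + 1), decay p k ≤ decay p i := fun i hi =>
    antitone_decay hp (by simpa [Nat.lt_succ_iff] using hi)
  have := Finset.card_nsmul_le_sum _ _ _ h
  rw [Finset.card_range, nsmul_eq_mul] at this
  refine le_trans (le_of_eq ?_) this
  rw [sub_eq_add_neg, Real.rpow_add (by positivity), Real.rpow_one, decay]
  push_cast; ring

/-- The stepsizes `a / (k + c) ^ p` and the regularization parameters `e / (k + d) ^ (1 - p)`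
differ from `a (k + 1) ^ (-p)` and `e (k + 1) ^ (-(1 - p))` by terms of higher order. -/
theorem exists_parameter_bound {m : ℕ} {p : ℝ} (hp0 : 0 ≤ p) (hp1 : p ≤ 1) {C D a e : Fin m → ℝ}
    (hC : ∀ j, 0 < C j) (hD : ∀ j, 0 < D j) (ha : ∀ j, 0 < a j) (he : ∀ j, 0 < e j)
    {α ε : ℕ → Fin m → ℝ} (hα : ∀ k j, α k j = a j / ((k : ℝ) + C j) ^ p)
    (hε : ∀ k j, ε k j = e j / ((k : ℝ) + D j) ^ (1 - p)) :
    ∃ M, 0 < M ∧ ∀ k j, 0 < α k j ∧ 0 < ε k j ∧ α k j ≤ M * decay p k ∧ ε k j ≤ M ∧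
      |α k j / a j - decay p k| ≤ M * decay p k ^ 2 ∧
      |α k j / a j * ε k j - e j * decay 1 k| ≤ M * decay p k ^ 2 := by
  have hj : ∀ j, ∃ M, 0 < M ∧ ∀ k, 0 < α k j ∧ 0 < ε k j ∧ α k j ≤ M * decay p k ∧ ε k j ≤ M ∧
      |α k j / a j - decay p k| ≤ M * decay p k ^ 2 ∧
      |α k j / a j * ε k j - e j * decay 1 k| ≤ M * decay p k ^ 2 := by
    intro j
    obtain ⟨M₁, hM₁, h₁⟩ := exists_abs_shift_sub_decay_le hp0 hp1 (hC j)
    obtain ⟨M₂, hM₂, h₂⟩ := exists_abs_shift_sub_decay_le (p := 1 - p) (by linarith) (by linarith) (hD j)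
    refine ⟨a j * (1 + M₁) + e j * (1 + M₂) + M₁ + e j * (M₂ + M₁ * (1 + M₂)) , ?_, fun k => ?_⟩
    · have := ha j; have := he j; positivity
    have haj := ha j
    have hej := he j
    have hCk : 0 < (k : ℝ) + C j := by have := hC j; positivity
    have hDk : 0 < (k : ℝ) + D j := by have := hD j; positivity
    have e1 : α k j / a j = ((k : ℝ) + C j) ^ (-p) := by
      rw [hα, Real.rpow_neg hCk.le]; field_simp
    have e2 : ε k j = e j * ((k : ℝ) + D j) ^ (-(1 - p)) := by
      rw [hε, Real.rpow_neg hDk.le]; field_simp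
    set A := ((k : ℝ) + C j) ^ (-p)
    set B := ((k : ℝ) + D j) ^ (-(1 - p))
    have hA : 0 < A := Real.rpow_pos_of_pos hCk _
    have hB : 0 < B := Real.rpow_pos_of_pos hDk _
    have e3 : α k j = a j * A := by rw [← e1]; field_simp
    have t1 := decay_pos p k
    have t2 := decay_pos (1 - p) k
    have t3 := decay_pos 1 k
    have t4 := decay_le_one hp0 k
    have t5 := decay_le_one (p := 1 - p) (by linarith) k
    have t6 := decay_le_decay hp1 k
    have t7 : decay p k * decay (1 - p) k = decay 1 k := by rw [decay_mul]; congr 1; ring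
    have h1 := h₁ k
    have h2 := h₂ k
    set θ := decay p k
    set η := decay (1 - p) k
    set ι := decay 1 k
    have t8 : ι ≤ 1 := t6.trans t4
    -- Since p ≤ 1, a relative error 1/(k + 1) is at most θ, so the shifts contribute O(θ²).
    have t9 : θ * ι ≤ θ ^ 2 := by nlinarith
    have t10 : ι * ι ≤ θ ^ 2 := by nlinarith
    have hA2 : A ≤ (1 + M₁) * θ := by
      have := (abs_le.1 h1).2
      have : M₁ * (θ * ι) ≤ M₁ * (θ * 1) := by gcongr
      linarith
    have hB2 : B ≤ 1 + M₂ := by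
      have := (abs_le.1 h2).2
      have : M₂ * (η * ι) ≤ M₂ * (1 * 1) := by gcongr
      linarith
    have hB3 : B ≤ (1 + M₂) * η := by
      have := (abs_le.1 h2).2
      have : M₂ * (η * ι) ≤ M₂ * (η * 1) := by gcongr
      linarith
    have hθ2 : 0 ≤ θ ^ 2 := sq_nonneg _
    have hAB : |A * B - ι| ≤ (M₂ + M₁ * (1 + M₂)) * θ ^ 2 := by
      -- The exponents p and 1 - p add up to 1, so the main terms multiply to exactly 1/(k + 1).
      have e4 : A * B - ι = (A - θ) * B + θ * (B - η) := by rw [← t7]; ring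
      rw [e4]
      calc _ ≤ |A - θ| * B + θ * |B - η| := by
            refine (abs_add_le _ _).trans (le_of_eq ?_)
            rw [abs_mul, abs_mul, abs_of_pos hB, abs_of_pos t1]
        _ ≤ (M₁ * (θ * ι)) * ((1 + M₂) * η) + θ * (M₂ * (η * ι)) := by gcongr
        _ = (M₂ + M₁ * (1 + M₂)) * ((θ * η) * ι) := by ring
        _ ≤ _ := by rw [t7]; gcongr
    refine ⟨by rw [e3]; positivity, by rw [e2]; positivity, ?_, ?_, ?_, ?_⟩
    · rw [e3]
      calc a j * A ≤ a j * ((1 + M₁) * θ) := by gcongr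
        _ = (a j * (1 + M₁)) * θ := by ring
        _ ≤ _ := by
          gcongr
          have : 0 ≤ e j * (1 + M₂) + M₁ + e j * (M₂ + M₁ * (1 + M₂)) := by positivity
          linarith
    · rw [e2]
      calc e j * B ≤ e j * (1 + M₂) := by gcongr
        _ ≤ _ := by
          have : 0 ≤ a j * (1 + M₁) + M₁ + e j * (M₂ + M₁ * (1 + M₂)) := by positivity
          linarith
    · rw [e1]
      calc _ ≤ M₁ * (θ * ι) := h1
        _ ≤ M₁ * θ ^ 2 := by gcongr
        _ ≤ _ := by
          gcongr
          have : 0 ≤ a j * (1 + M₁) + e j * (1 + M₂) + e j * (M₂ + M₁ * (1 + M₂)) := by positivity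
          linarith
    · rw [e1, e2]
      have e5 : A * (e j * B) - e j * ι = e j * (A * B - ι) := by ring
      rw [e5, abs_mul, abs_of_pos hej]
      calc _ ≤ e j * ((M₂ + M₁ * (1 + M₂)) * θ ^ 2) := by gcongr
        _ = (e j * (M₂ + M₁ * (1 + M₂))) * θ ^ 2 := by ring
        _ ≤ _ := by
          gcongr
          have : 0 ≤ a j * (1 + M₁) + e j * (1 + M₂) + M₁ := by positivity
          linarith
  choose M hM h using hj
  refine ⟨1 + ∑ j, M j, by have := Finset.sum_nonneg fun j (_ : j ∈ Finset.univ) => (hM j).le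
                           linarith, fun k j => ?_⟩
  have hle : M j ≤ 1 + ∑ j, M j := by
    have := Finset.single_le_sum (fun j _ => (hM j).le) (Finset.mem_univ j)
    linarith
  obtain ⟨h1, h2, h3, h4, h5, h6⟩ := h j k
  have t1 := (decay_pos p k).le
  exact ⟨h1, h2, h3.trans (by gcongr), h4.trans hle, h5.trans (by gcongr), h6.trans (by gcongr)⟩

end Decay

/-! ### Blockwise diagonal operators. -/

section Scale

variable {m : ℕ} {n : Fin m → ℕ}

/-- Multiplication of the `j`-th block by the number `γ j`. -/
noncomputable def scale (γ : Fin m → ℝ) : Whole n →L[ℝ] Whole n :=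
  LinearMap.toContinuousLinearMap
    { toFun := fun x => WithLp.toLp 2 fun j => γ j • x j
      map_add' := fun x y => by ext j i; simp
      map_smul' := fun r x => by ext j i; simp; ring }

@[simp] theorem scale_apply (γ : Fin m → ℝ) (x : Whole n) (j : Fin m) :
    scale γ x j = γ j • x j := rfl

theorem inner_scale (γ : Fin m → ℝ) (x y : Whole n) :
    inner ℝ (scale γ x) y = ∑ j, γ j * inner ℝ (x j) (y j) := by
  rw [PiLp.inner_apply]
  exact Finset.sum_congr rfl fun j _ => real_inner_smul_left _ _ _

theorem inner_scale_comm (γ : Fin m → ℝ) (x y : Whole n) :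
    inner ℝ (scale γ x) y = inner ℝ x (scale γ y) := by
  rw [← real_inner_comm x (scale γ y), inner_scale, inner_scale]
  exact Finset.sum_congr rfl fun j _ => by rw [real_inner_comm]

theorem norm_sq_eq_sum (x : Whole n) : ‖x‖ ^ 2 = ∑ j, ‖x j‖ ^ 2 := by
  rw [PiLp.norm_sq_eq_of_L2]

theorem inner_scale_self (γ : Fin m → ℝ) (x : Whole n) :
    inner ℝ (scale γ x) x = ∑ j, γ j * ‖x j‖ ^ 2 := by
  simp [inner_scale]

theorem le_inner_scale_self {γ : Fin m → ℝ} {M : ℝ} (h : ∀ j, M ≤ γ j) (x : Whole n) :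
    M * ‖x‖ ^ 2 ≤ inner ℝ (scale γ x) x := by
  rw [inner_scale_self, norm_sq_eq_sum, Finset.mul_sum]
  exact Finset.sum_le_sum fun j _ => mul_le_mul_of_nonneg_right (h j) (sq_nonneg _)

theorem inner_scale_self_le {γ : Fin m → ℝ} {M : ℝ} (h : ∀ j, γ j ≤ M) (x : Whole n) :
    inner ℝ (scale γ x) x ≤ M * ‖x‖ ^ 2 := by
  rw [inner_scale_self, norm_sq_eq_sum, Finset.mul_sum]
  exact Finset.sum_le_sum fun j _ => mul_le_mul_of_nonneg_right (h j) (sq_nonneg _)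

theorem norm_scale_le {γ : Fin m → ℝ} {M : ℝ} (h : ∀ j, |γ j| ≤ M) (x : Whole n) (hM : 0 ≤ M) :
    ‖scale γ x‖ ≤ M * ‖x‖ := by
  refine le_of_sq_le_sq ?_ (by positivity)
  rw [mul_pow, norm_sq_eq_sum, norm_sq_eq_sum x, Finset.mul_sum]
  refine Finset.sum_le_sum fun j _ => ?_
  rw [scale_apply, norm_smul, mul_pow, Real.norm_eq_abs]
  gcongr
  exact h j

theorem scale_sub_apply (γ γ' : Fin m → ℝ) (x : Whole n) :
    scale γ x - scale γ' x = scale (fun j => γ j - γ' j) x := by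
  ext j i; simp [sub_mul]

theorem scale_const (r : ℝ) (x : Whole n) : scale (fun _ => r) x = r • x := by
  ext j i; simp

theorem abs_inner_scale_le {γ : Fin m → ℝ} {M : ℝ} (h : ∀ j, |γ j| ≤ M) (hM : 0 ≤ M)
    (x y : Whole n) : |inner ℝ (scale γ x) y| ≤ M * (‖x‖ * ‖y‖) := by
  refine (abs_real_inner_le_norm _ _).trans ?_
  rw [← mul_assoc]
  exact mul_le_mul_of_nonneg_right (norm_scale_le h x hM) (norm_nonneg _)

end Scale

/-! ### Geometry of the constraints. -/

namespace Problem

variable {m : ℕ} {n : Fin m → ℕ} {Ξ I : Fin m → Type*} {P : Problem m n Ξ I}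

theorem gPos_nonneg (j : Fin m) (i : I j) (x : Block n j) : 0 ≤ P.gPos j i x :=
  EReal.toReal_nonneg (le_max_right _ _)

theorem gPos_eq_zero {j : Fin m} {i : I j} {x : Block n j} (hx : P.g j i x ≤ 0) :
    P.gPos j i x = 0 := by
  have : positivePart (P.g j i) x = 0 := max_eq_right hx
  simp [gPos, this]

variable [∀ j, MeasurableSpace (I j)]

/-- On the hard set the positive part is finite: it vanishes where the constraint holds, and where
the constraint is violated a subgradient exists, which by the definition of `subdiff` excludes the
value ⊤. -/
theorem coe_gPos (hP : P.ConstraintAssumption) {j : Fin m} (i : I j) {x : Block n j}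
    (hx : x ∈ P.X₀ j) : ((P.gPos j i x : ℝ) : EReal) = positivePart (P.g j i) x := by
  refine EReal.coe_toReal ?_ (ne_of_gt (lt_of_lt_of_le EReal.bot_lt_zero (le_max_right _ _)))
  by_cases h : x ∈ P.soft j i
  · have : positivePart (P.g j i) x = 0 := max_eq_right h
    simp [this]
  · obtain ⟨d, hd⟩ := hP.exists_subgradient j i x hx h
    exact hd.1

theorem gPos_add_inner_le (hP : P.ConstraintAssumption) {j : Fin m} {i : I j} {x z d : Block n j}
    (hx : x ∈ P.X₀ j) (hz : z ∈ P.X₀ j) (hd : d ∈ subdiff (positivePart (P.g j i)) x) :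
    P.gPos j i x + inner ℝ d (z - x) ≤ P.gPos j i z := by
  have := hd.2 z
  rw [← coe_gPos hP i hx, ← coe_gPos hP i hz] at this
  exact_mod_cast this

/-- Over the hard set the positive parts are Lipschitz with a common constant. -/
theorem exists_gPos_bound (hP : P.ConstraintAssumption) : ∃ M, 0 < M ∧
    (∀ j i, ∀ x ∈ P.X₀ j, ∀ d ∈ subdiff (positivePart (P.g j i)) x, ‖d‖ ≤ M) ∧
    ∀ j i, ∀ x ∈ P.X₀ j, ∀ z ∈ P.X₀ j, P.gPos j i x ≤ P.gPos j i z + M * ‖x - z‖ := by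
  choose M hM h using hP.bounded_subgradient
  have hle : ∀ j, M j ≤ 1 + ∑ j, M j := fun j => by
    have := Finset.single_le_sum (fun j _ => (hM j).le) (Finset.mem_univ j)
    linarith
  have hb : ∀ j i, ∀ x ∈ P.X₀ j, ∀ d ∈ subdiff (positivePart (P.g j i)) x,
      ‖d‖ ≤ 1 + ∑ j, M j := fun j i x hx d hd => (h j i x hx d hd).trans (hle j)
  have hpos : 0 < 1 + ∑ j, M j := by
    have := Finset.sum_nonneg fun j (_ : j ∈ Finset.univ) => (hM j).le
    linarith
  refine ⟨_, hpos, hb, fun j i x hx z hz => ?_⟩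
  by_cases hs : x ∈ P.soft j i
  · rw [gPos_eq_zero hs]
    have := P.gPos_nonneg j i z
    positivity
  · obtain ⟨d, hd⟩ := hP.exists_subgradient j i x hx hs
    have h1 := gPos_add_inner_le hP hx hz hd
    have h2 := real_inner_le_norm d (x - z)
    have h3 : inner ℝ d (z - x) = - inner ℝ d (x - z) := by rw [← inner_neg_right, neg_sub]
    have h4 := mul_le_mul_of_nonneg_right (hb j i x hx d hd) (norm_nonneg (x - z))
    linarith

theorem isClosed_agentSet (hP : P.ConstraintAssumption) (j : Fin m) : IsClosed (P.agentSet j) :=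
  (hP.isClosed_hard j).inter (isClosed_iInter fun i => hP.isClosed_soft j i)

theorem convex_soft (hP : P.ConstraintAssumption) (j : Fin m) (i : I j) :
    Convex ℝ (P.soft j i) := by
  intro x hx y hy s t hs ht hst
  have hx' : P.g j i x ≤ 0 := hx
  have hy' : P.g j i y ≤ 0 := hy
  have := (hP.convex_g j i).2 (x := (x, 0)) (y := (y, 0)) (by simpa using hx') (by simpa using hy')
    hs ht hst
  show P.g j i (s • x + t • y) ≤ 0
  simpa using this

theorem convex_agentSet (hP : P.ConstraintAssumption) (j : Fin m) : Convex ℝ (P.agentSet j) :=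
  (hP.convex_hard j).inter (convex_iInter fun i => convex_soft hP j i)

theorem isClosed_feasible (hP : P.ConstraintAssumption) : IsClosed P.feasible := by
  have : P.feasible = ⋂ j, (fun x : Whole n => x j) ⁻¹' P.agentSet j := by
    ext x; simp [feasible]
  rw [this]
  exact isClosed_iInter fun j => (isClosed_agentSet hP j).preimage (by fun_prop)

theorem convex_feasible (hP : P.ConstraintAssumption) : Convex ℝ P.feasible := by
  intro x hx y hy s t hs ht hst j
  exact convex_agentSet hP j (hx j) (hy j) hs ht hst

/-- Projecting each block onto its own set produces a feasible point. This transfers the agentwise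
regularity to the product. -/
theorem infDist_feasible_sq_le (hP : P.ConstraintAssumption) (hne : P.feasible.Nonempty)
    (x : Whole n) :
    Metric.infDist x P.feasible ^ 2 ≤ ∑ j, Metric.infDist (x j) (P.agentSet j) ^ 2 := by
  obtain ⟨z, hz⟩ := hne
  set p : Whole n := WithLp.toLp 2 fun j => proj (P.agentSet j) (x j) with hp
  have hpm : p ∈ P.feasible := fun j =>
    proj_mem ⟨_, hz j⟩ (isClosed_agentSet hP j) (convex_agentSet hP j) _
  have h1 : Metric.infDist x P.feasible ≤ ‖x - p‖ := by
    rw [← dist_eq_norm]; exact Metric.infDist_le_dist_of_mem hpm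
  refine (pow_le_pow_left₀ Metric.infDist_nonneg h1 2).trans (le_of_eq ?_)
  rw [norm_sq_eq_sum]
  refine Finset.sum_congr rfl fun j _ => ?_
  rw [infDist_eq_norm_sub_proj ⟨_, hz j⟩ (isClosed_agentSet hP j) (convex_agentSet hP j)]
  rfl

end Problem

/-! ### Histories, samples and random constraints; conditional expectations appear as integrals over
history events. -/

/-- Fubini for a function of two independent random variables. -/
theorem integral_comp_of_indepFun {Ω Ξ B : Type*} [MeasurableSpace Ω] [MeasurableSpace Ξ]
    [MeasurableSpace B] {μ : Measure Ω} [IsFiniteMeasure μ] {S : Ω → Ξ} {Z : Ω → B}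
    (hS : Measurable S) (hZ : Measurable Z) (h : IndepFun S Z μ) {f : Ξ × B → ℝ}
    (hf : Measurable f) (hi : Integrable (fun o => f (S o, Z o)) μ) :
    ∫ o, f (S o, Z o) ∂μ = ∫ o, ∫ ξ, f (ξ, Z o) ∂(μ.map S) ∂μ := by
  have hmap : μ.map (fun o => (S o, Z o)) = (μ.map S).prod (μ.map Z) :=
    (indepFun_iff_map_prod_eq_prod_map_map hS.aemeasurable hZ.aemeasurable).1 h
  have hi' : Integrable f ((μ.map S).prod (μ.map Z)) := by
    rw [← hmap]
    exact (integrable_map_measure hf.aestronglyMeasurable (hS.prodMk hZ).aemeasurable).2 hi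
  rw [← integral_map (φ := fun o => (S o, Z o)) (hS.prodMk hZ).aemeasurable
    hf.aestronglyMeasurable, hmap, integral_prod_symm _ hi', integral_map hZ.aemeasurable]
  exact hi'.swap.integral_prod_left.aestronglyMeasurable

theorem integrable_inner_of_memLp {Ω E : Type*} [MeasurableSpace Ω] [NormedAddCommGroup E]
    [InnerProductSpace ℝ E] {μ : Measure Ω} {f g : Ω → E} (hf : MemLp f 2 μ) (hg : MemLp g 2 μ) :
    Integrable (fun o => (inner ℝ (f o) (g o) : ℝ)) μ := by
  refine ((hf.integrable_norm_pow two_ne_zero).add (hg.integrable_norm_pow two_ne_zero)).mono'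
    (hf.1.inner hg.1) (Eventually.of_forall fun o => ?_)
  have h1 := norm_inner_le_norm (𝕜 := ℝ) (f o) (g o)
  simp only [Pi.add_apply]
  nlinarith [sq_nonneg (‖f o‖ - ‖g o‖), norm_nonneg (f o), norm_nonneg (g o)]

namespace Problem

variable {m : ℕ} {n : Fin m → ℕ} {Ξ I : Fin m → Type*} {P : Problem m n Ξ I}
  [∀ j, MeasurableSpace (Ξ j)] [∀ j, MeasurableSpace (I j)]
  {Ω : Type*} [m0 : MeasurableSpace Ω] {μ : Measure Ω} [IsProbabilityMeasure μ]
  {v : Ω → ∀ j, Ξ j} {c : ℕ → Ω → ∀ j, I j} {s : ℕ → Ω → ∀ j, Ξ j}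

section History

theorem history_mono {k l : ℕ} (h : k ≤ l) : history c s k ≤ history c s l :=
  iSup_le fun i => le_iSup (fun i : Fin l => MeasurableSpace.comap (c i) inferInstance ⊔
    MeasurableSpace.comap (s i) inferInstance) ⟨i, i.2.trans_le h⟩

theorem history_le (hs : P.SamplingAssumption μ v c s) (k : ℕ) : history c s k ≤ m0 :=
  iSup_le fun i => sup_le (hs.measurable_control i).comap_le (hs.measurable_sample i).comap_le

theorem measurable_control_history (k : ℕ) : Measurable[history c s (k + 1)] (c k) :=
  Measurable.mono (comap_measurable (c k)) (le_sup_left.trans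
    (le_iSup (fun i : Fin (k + 1) => MeasurableSpace.comap (c i) inferInstance ⊔
      MeasurableSpace.comap (s i) inferInstance) ⟨k, k.lt_succ_self⟩)) le_rfl

theorem measurable_sample_history (k : ℕ) : Measurable[history c s (k + 1)] (s k) :=
  Measurable.mono (comap_measurable (s k)) (le_sup_right.trans
    (le_iSup (fun i : Fin (k + 1) => MeasurableSpace.comap (c i) inferInstance ⊔
      MeasurableSpace.comap (s i) inferInstance) ⟨k, k.lt_succ_self⟩)) le_rfl

theorem measurable_of_coord {m' : MeasurableSpace Ω} {X : Ω → Whole n}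
    (h : ∀ j, Measurable fun o => X o j) : Measurable X :=
  (WithLp.measurable_toLp 2 (∀ j, Block n j)).comp (measurable_pi_lambda _ h)

theorem measurable_coord {m' : MeasurableSpace Ω} {X : Ω → Whole n} (h : Measurable X)
    (j : Fin m) : Measurable fun o => X o j :=
  (measurable_pi_apply j).comp ((WithLp.measurable_ofLp 2 (∀ j, Block n j)).comp h)

theorem measurable_gPos (hP : P.ConstraintAssumption) (j : Fin m) :
    Measurable fun p : I j × Block n j => P.gPos j p.1 p.2 :=
  ((hP.measurable_g j).max measurable_const).ereal_toReal

theorem measurable_op (hF : P.OperatorAssumption μ v) :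
    Measurable fun p : (∀ j, Ξ j) × Whole n => P.op p.1 p.2 :=
  measurable_of_coord fun j => (hF.measurable_F j).comp
    (((measurable_pi_apply j).comp measurable_fst).prodMk measurable_snd)

variable {α β ε : ℕ → Fin m → ℝ} {x0 : Whole n} {x y d : ℕ → Ω → Whole n}

/-- The auxiliary iterate involves the sample `s k` and is thus known only at time k + 1. The
regularity condition, which is conditional on the history at time k, therefore has to be applied at
`x k`. -/
theorem measurable_aux (hP : P.ConstraintAssumption) (hF : P.OperatorAssumption μ v)
    (hne : P.feasible.Nonempty) (hx : P.IsRun α β ε x0 c s x y d) {k : ℕ}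
    (h : Measurable[history c s k] (x k)) : Measurable[history c s (k + 1)] (y k) := by
  obtain ⟨z, hz⟩ := hne
  have h' : Measurable[history c s (k + 1)] (x k) := h.mono (history_mono k.le_succ) le_rfl
  refine measurable_of_coord fun j => ?_
  simp_rw [hx.operator_step]
  refine (continuous_proj ⟨_, (hz j).1⟩ (hP.isClosed_hard j) (hP.convex_hard j)).measurable.comp ?_
  have h1 := measurable_coord h' j
  have h2 : Measurable[history c s (k + 1)] fun o => P.F j (s k o j) (x k o) :=
    (hF.measurable_F j).comp (((measurable_pi_apply j).comp (measurable_sample_history k)).prodMk h')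
  exact h1.sub ((h2.add (h1.const_smul (ε k j))).const_smul (α k j))

theorem measurable_iterate (hP : P.ConstraintAssumption) (hF : P.OperatorAssumption μ v)
    (hne : P.feasible.Nonempty) (hx : P.IsRun α β ε x0 c s x y d) (k : ℕ) :
    Measurable[history c s k] (x k) := by
  induction k with
  | zero =>
    have : x 0 = fun _ => x0 := funext hx.init
    rw [this]
    exact measurable_const
  | succ k ih =>
    have hy := measurable_aux hP hF hne hx ih
    obtain ⟨z, hz⟩ := hne
    refine measurable_of_coord fun j => ?_
    simp_rw [hx.feasibility_step]
    refine (continuous_proj ⟨_, (hz j).1⟩ (hP.isClosed_hard j)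
      (hP.convex_hard j)).measurable.comp ?_
    have h1 := measurable_coord hy j
    have h2 := hx.direction_adapted k j
    have h3 : Measurable[history c s (k + 1)] fun o => P.gPos j (c k o j) (y k o j) :=
      (measurable_gPos hP j).comp
        (((measurable_pi_apply j).comp (measurable_control_history k)).prodMk h1)
    exact h1.sub (((h3.div ((measurable_norm.comp h2).pow_const 2)).const_mul _).smul h2)

end History

section Operator

theorem indepFun_sample (hs : P.SamplingAssumption μ v c s) {B : Type*} [MeasurableSpace B] {k : ℕ}
    {Z : Ω → B} (hZ : Measurable[history c s k] Z) : IndepFun (s k) Z μ :=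
  (IndepFun_iff_Indep _ _ _).2 (indep_of_indep_of_le_right (hs.indep k) hZ.comap_le)

theorem integrable_comp_sample (hs : P.SamplingAssumption μ v c s) {k : ℕ} {φ : (∀ j, Ξ j) → ℝ}
    (hφ : Measurable φ) (hi : Integrable (fun o => φ (v o)) μ) :
    Integrable (fun o => φ (s k o)) μ ∧ ∫ o, φ (s k o) ∂μ = ∫ o, φ (v o) ∂μ := by
  have := (hs.identDistrib k).comp hφ
  exact ⟨this.integrable_iff.2 hi, this.integral_eq⟩

/-- The indicator of `A` is merged with `Y` into one history-measurable factor, from which the fresh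
sample is independent. -/
theorem setIntegral_sample_mul (hs : P.SamplingAssumption μ v c s) {k : ℕ} {φ : (∀ j, Ξ j) → ℝ}
    (hφ : Measurable φ) (hi : Integrable (fun o => φ (v o)) μ) {Y : Ω → ℝ}
    (hY : Measurable[history c s k] Y) (hYi : Integrable Y μ) {A : Set Ω}
    (hA : MeasurableSet[history c s k] A) :
    Integrable (fun o => φ (s k o) * Y o) μ ∧
      ∫ o in A, φ (s k o) * Y o ∂μ = (∫ o, φ (v o) ∂μ) * ∫ o in A, Y o ∂μ := by
  obtain ⟨h1, h2⟩ := integrable_comp_sample hs (k := k) hφ hi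
  have hA' := history_le hs k _ hA
  have hind : ∀ {Y : Ω → ℝ}, Measurable[history c s k] Y → IndepFun (fun o => φ (s k o)) Y μ :=
    fun hY => (indepFun_sample hs hY).comp hφ measurable_id
  refine ⟨(hind hY).integrable_mul h1 hYi, ?_⟩
  have hYA : Measurable[history c s k] (A.indicator Y) := hY.indicator hA
  rw [← integral_indicator hA', ← h2, ← integral_indicator hA',
    ← (hind hYA).integral_fun_mul_eq_mul_integral h1.aestronglyMeasurable
      (hYi.indicator hA').aestronglyMeasurable]
  refine integral_congr_ae (Eventually.of_forall fun o => ?_)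
  by_cases ho : o ∈ A <;> simp [ho]

theorem integrable_op (hF : P.OperatorAssumption μ v) (x : Whole n) :
    Integrable (fun o => P.op (v o) x) μ := (hF.memLp_F x).integrable (by norm_num)

theorem exists_lipschitz_mean (hF : P.OperatorAssumption μ v) :
    ∃ K, 0 < K ∧ ∀ x y, ‖P.mean μ v x - P.mean μ v y‖ ≤ K * ‖x - y‖ := by
  obtain ⟨L, hLm, hL0, hL2, hL⟩ := hF.lipschitz
  have hL' := ae_of_ae_map hF.measurable_v.aemeasurable hL
  have hLi : Integrable (fun o => L (v o)) μ := hL2.integrable (by norm_num)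
  have hK : 0 ≤ ∫ o, L (v o) ∂μ := integral_nonneg fun o => hL0 _
  -- The summand 1 only makes the constant positive.
  refine ⟨1 + ∫ o, L (v o) ∂μ, by linarith, fun x y => ?_⟩
  rw [mean, mean, ← integral_sub (integrable_op hF x) (integrable_op hF y)]
  calc _ ≤ ∫ o, L (v o) * ‖x - y‖ ∂μ :=
        norm_integral_le_of_norm_le (hLi.mul_const _) (hL'.mono fun o ho => ho y x)
    _ = (∫ o, L (v o) ∂μ) * ‖x - y‖ := integral_mul_const _ _
    _ ≤ _ := by gcongr; linarith

/-- Second moment bound for the sampled operator along a square-integrable adapted variable. -/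
theorem exists_op_moment_bound (hF : P.OperatorAssumption μ v)
    (hs : P.SamplingAssumption μ v c s) :
    ∃ M, 0 < M ∧ ∀ (k : ℕ) (X : Ω → Whole n), Measurable[history c s k] X → MemLp X 2 μ →
      MemLp (fun o => P.op (s k o) (X o)) 2 μ ∧ ∀ A, MeasurableSet[history c s k] A →
        ∫ o in A, ‖P.op (s k o) (X o)‖ ^ 2 ∂μ ≤ M * ∫ o in A, (1 + ‖X o‖ ^ 2) ∂μ := by
  obtain ⟨L, hLm, hL0, hL2, hL⟩ := hF.lipschitz
  set N2 := ∫ o, ‖P.op (v o) 0‖ ^ 2 ∂μ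
  set L2 := ∫ o, L (v o) ^ 2 ∂μ
  have hN20 : 0 ≤ N2 := integral_nonneg fun o => sq_nonneg _
  have hL20 : 0 ≤ L2 := integral_nonneg fun o => sq_nonneg _
  have hφN : Measurable fun ξ => ‖P.op ξ (0 : Whole n)‖ ^ 2 :=
    (((measurable_op hF).comp (measurable_id.prodMk measurable_const)).norm).pow_const 2
  have hφL : Measurable fun ξ => L ξ ^ 2 := hLm.pow_const 2
  have hNi : Integrable (fun o => ‖P.op (v o) 0‖ ^ 2) μ := (hF.memLp_F 0).integrable_norm_pow two_ne_zero
  have hLi : Integrable (fun o => L (v o) ^ 2) μ := hL2.integrable_sq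
  refine ⟨1 + 2 * N2 + 2 * L2, by positivity, fun k X hX hX2 => ?_⟩
  have hL' : ∀ᵐ o ∂μ, ∀ x y, ‖P.op (s k o) y - P.op (s k o) x‖ ≤ L (s k o) * ‖y - x‖ := by
    rw [← (hs.identDistrib k).map_eq] at hL
    exact ae_of_ae_map (hs.measurable_sample k).aemeasurable hL
  have hXm : Measurable X := hX.mono (history_le hs k) le_rfl
  have hXsq : Integrable (fun o => ‖X o‖ ^ 2) μ := hX2.integrable_norm_pow two_ne_zero
  have hXh : Measurable[history c s k] fun o => ‖X o‖ ^ 2 :=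
    (measurable_norm.comp hX).pow_const 2
  -- The Lipschitz property gives linear growth, and each summand is a function of the sample times
  -- a history-measurable variable, so independence applies to both.
  have hb : ∀ᵐ o ∂μ, ‖P.op (s k o) (X o)‖ ^ 2
      ≤ 2 * (‖P.op (s k o) 0‖ ^ 2 * 1) + 2 * (L (s k o) ^ 2 * ‖X o‖ ^ 2) := by
    filter_upwards [hL'] with o ho
    have h1 := ho 0 (X o)
    rw [sub_zero] at h1
    have h2 : ‖P.op (s k o) (X o)‖ ≤ ‖P.op (s k o) 0‖ + L (s k o) * ‖X o‖ := by
      have := norm_sub_norm_le (P.op (s k o) (X o)) (P.op (s k o) 0)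
      linarith
    have h3 := pow_le_pow_left₀ (norm_nonneg _) h2 2
    nlinarith [sq_nonneg (‖P.op (s k o) 0‖ - L (s k o) * ‖X o‖)]
  have h1 := fun A hA => setIntegral_sample_mul hs (k := k) hφN hNi measurable_const
    (integrable_const (1 : ℝ)) (A := A) hA
  have h2 := fun A hA => setIntegral_sample_mul hs (k := k) hφL hLi hXh hXsq (A := A) hA
  have hi1 := (h1 Set.univ MeasurableSet.univ).1
  have hi2 := (h2 Set.univ MeasurableSet.univ).1
  have hi := (hi1.const_mul 2).add (hi2.const_mul 2)
  have hm : Measurable fun o => P.op (s k o) (X o) :=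
    (measurable_op hF).comp ((hs.measurable_sample k).prodMk hXm)
  have hsq : Integrable (fun o => ‖P.op (s k o) (X o)‖ ^ 2) μ :=
    hi.mono' (hm.norm.pow_const 2).aestronglyMeasurable (hb.mono fun o ho => by
      rwa [Real.norm_of_nonneg (sq_nonneg _)])
  refine ⟨(memLp_two_iff_integrable_sq_norm hm.aestronglyMeasurable).2 hsq, fun A hA => ?_⟩
  have hXA : 0 ≤ ∫ o in A, ‖X o‖ ^ 2 ∂μ := integral_nonneg fun o => sq_nonneg _
  have h1A : 0 ≤ ∫ o in A, (1 : ℝ) ∂μ := integral_nonneg fun o => zero_le_one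
  calc _ ≤ ∫ o in A, (2 * (‖P.op (s k o) 0‖ ^ 2 * 1) + 2 * (L (s k o) ^ 2 * ‖X o‖ ^ 2)) ∂μ :=
        setIntegral_mono_ae hsq.integrableOn hi.integrableOn hb
    _ = 2 * (N2 * ∫ o in A, (1 : ℝ) ∂μ) + 2 * (L2 * ∫ o in A, ‖X o‖ ^ 2 ∂μ) := by
        rw [integral_add (hi1.const_mul 2).integrableOn (hi2.const_mul 2).integrableOn,
          integral_const_mul, integral_const_mul, (h1 A hA).2, (h2 A hA).2]
    _ ≤ _ := by
        rw [integral_add (integrable_const _) hXsq.integrableOn]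
        nlinarith [mul_nonneg hN20 hXA, mul_nonneg hL20 h1A]

/-- The samples are unbiased conditionally on the history. -/
theorem setIntegral_inner_op (hF : P.OperatorAssumption μ v) (hs : P.SamplingAssumption μ v c s)
    {k : ℕ} {X h : Ω → Whole n} (hX : Measurable[history c s k] X) (hX2 : MemLp X 2 μ)
    (hh : Measurable[history c s k] h) (hh2 : MemLp h 2 μ) {A : Set Ω}
    (hA : MeasurableSet[history c s k] A) :
    ∫ o in A, inner ℝ (P.op (s k o) (X o)) (h o) ∂μ
      = ∫ o in A, inner ℝ (P.mean μ v (X o)) (h o) ∂μ := by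
  obtain ⟨M, -, hM⟩ := exists_op_moment_bound hF hs
  have hA' := history_le hs k _ hA
  -- The pair is independent of the sample, so Fubini freezes both entries while the sample is
  -- averaged; the inner integral is the mean operator.
  have hZ : Measurable[history c s k] fun o => (X o, A.indicator h o) := hX.prodMk (hh.indicator hA)
  have hf : Measurable fun p : (∀ j, Ξ j) × (Whole n × Whole n) =>
      (inner ℝ (P.op p.1 p.2.1) p.2.2 : ℝ) :=
    ((measurable_op hF).comp (measurable_fst.prodMk (measurable_fst.comp measurable_snd))).inner
      (measurable_snd.comp measurable_snd)
  have hi : Integrable (fun o => (inner ℝ (P.op (s k o) (X o)) (A.indicator h o) : ℝ)) μ :=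
    integrable_inner_of_memLp (hM k X hX hX2).1 (hh2.indicator hA')
  have key := integral_comp_of_indepFun (hs.measurable_sample k) (hZ.mono (history_le hs k) le_rfl)
    (indepFun_sample hs hZ) hf hi
  have hmean : ∀ x w : Whole n, ∫ ξ, (inner ℝ (P.op ξ x) w : ℝ) ∂(μ.map (s k))
      = inner ℝ (P.mean μ v x) w := by
    intro x w
    have hm : Measurable fun ξ => P.op ξ x :=
      (measurable_op hF).comp (measurable_id.prodMk measurable_const)
    rw [(hs.identDistrib k).map_eq, integral_map hF.measurable_v.aemeasurable
      (hm.inner measurable_const).aestronglyMeasurable, mean]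
    simp_rw [real_inner_comm w]
    exact integral_inner (integrable_op hF x) w
  simp only [hmean] at key
  rw [← integral_indicator hA', ← integral_indicator hA']
  convert key using 3 with o o
  · by_cases ho : o ∈ A <;> simp [ho]
  · by_cases ho : o ∈ A <;> simp [ho]

end Operator

section Regularity

theorem infDist_agentSet_le {j : Fin m} {z : Block n j} (hz : z ∈ P.agentSet j) (x : Block n j) :
    Metric.infDist x (P.agentSet j) ≤ ‖x - z‖ := by
  rw [← dist_eq_norm]; exact Metric.infDist_le_dist_of_mem hz

/-- The regularity of the random constraints at random points determined by the history. -/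
theorem exists_regularity (hP : P.ConstraintAssumption) (hne : P.feasible.Nonempty)
    (hs : P.SamplingAssumption μ v c s) :
    ∃ κ, 0 < κ ∧ ∀ (k : ℕ) (j : Fin m) (X : Ω → Block n j), Measurable[history c s k] X →
      MemLp X 2 μ → (∀ o, X o ∈ P.X₀ j) →
      Integrable (fun o => P.gPos j (c k o j) (X o) ^ 2) μ ∧
      ∀ A, MeasurableSet[history c s k] A →
        ∫ o in A, Metric.infDist (X o) (P.agentSet j) ^ 2 ∂μ
          ≤ κ * ∫ o in A, P.gPos j (c k o j) (X o) ^ 2 ∂μ := by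
  obtain ⟨z, hz⟩ := hne
  choose κ' hκ' hreg using hs.regularity
  obtain ⟨M, hM, -, hLip⟩ := exists_gPos_bound hP
  have hle : ∀ j, κ' j ≤ 1 + ∑ j, κ' j := fun j => by
    have := Finset.single_le_sum (fun j _ => (hκ' j).le) (Finset.mem_univ j)
    linarith
  have hpos : 0 < 1 + ∑ j, κ' j := by
    have := Finset.sum_nonneg fun j (_ : j ∈ Finset.univ) => (hκ' j).le
    linarith
  refine ⟨_, hpos, fun k j X hX hX2 hX0 => ?_⟩
  set κ := 1 + ∑ j, κ' j
  have hgz : ∀ i, P.gPos j i (z j) = 0 := fun i => gPos_eq_zero (Set.mem_iInter.1 (hz j).2 i)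
  have hzX : z j ∈ P.X₀ j := (hz j).1
  have hgb : ∀ i, ∀ x ∈ P.X₀ j, P.gPos j i x ≤ M * ‖x - z j‖ := fun i x hx => by
    have := hLip j i x hx _ hzX
    rwa [hgz, zero_add] at this
  have hXm : Measurable X := hX.mono (history_le hs k) le_rfl
  have hck : Measurable fun o => c k o j := (measurable_pi_apply j).comp (hs.measurable_control k)
  have hgm : ∀ Y : Ω → Block n j, Measurable Y →
      Measurable fun o => P.gPos j (c k o j) (Y o) ^ 2 := fun Y hY =>
    ((measurable_gPos hP j).comp (hck.prodMk hY)).pow_const 2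
  have hXz : Integrable (fun o => ‖X o - z j‖ ^ 2) μ :=
    (hX2.sub (memLp_const (z j))).integrable_norm_pow two_ne_zero
  have hXi : Integrable (fun o => P.gPos j (c k o j) (X o) ^ 2) μ := by
    refine (hXz.const_mul (M ^ 2)).mono' (hgm X hXm).aestronglyMeasurable
      (Eventually.of_forall fun o => ?_)
    rw [Real.norm_of_nonneg (sq_nonneg _), ← mul_pow]
    exact pow_le_pow_left₀ (gPos_nonneg _ _ _) (hgb _ _ (hX0 o)) 2
  refine ⟨hXi, fun A hA => ?_⟩
  have hA' := history_le hs k _ hA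
  -- The exceptional null set of the regularity condition depends on the point. So `X` is
  -- approximated by simple functions with values in the hard set; on each of their finitely many
  -- fibres the point is fixed.
  set φ : ℕ → SimpleFunc (Block n j) (Block n j) := fun N =>
    SimpleFunc.approxOn id measurable_id (P.X₀ j) (z j) hzX N with hφ
  have hφm : ∀ N w, φ N w ∈ P.X₀ j := fun N w => SimpleFunc.approxOn_mem measurable_id hzX N w
  have hφt : ∀ o, Tendsto (fun N => φ N (X o)) atTop (𝓝 (X o)) := fun o =>
    SimpleFunc.tendsto_approxOn measurable_id hzX (subset_closure (hX0 o))
  -- The approximation starts from the feasible point `z j`; this bound provides the dominating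
  -- function.
  have hφb : ∀ N o, ‖φ N (X o) - z j‖ ≤ 2 * ‖X o - z j‖ := fun N o => by
    have := SimpleFunc.edist_approxOn_y0_le (f := id) measurable_id hzX (X o) N
    rw [edist_dist, id, edist_dist, ← ENNReal.ofReal_add dist_nonneg dist_nonneg,
      ENNReal.ofReal_le_ofReal_iff (by positivity), dist_comm, dist_eq_norm, dist_comm,
      dist_eq_norm] at this
    linarith
  have hsimple : ∀ N, ∫ o in A, Metric.infDist (φ N (X o)) (P.agentSet j) ^ 2 ∂μ
      ≤ κ * ∫ o in A, P.gPos j (c k o j) (φ N (X o)) ^ 2 ∂μ := by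
    intro N
    set B : Block n j → Set Ω := fun r => A ∩ (fun o => φ N (X o)) ⁻¹' {r} with hB
    have hφX : Measurable[history c s k] fun o => φ N (X o) := (φ N).measurable.comp hX
    have hBm : ∀ r, MeasurableSet[history c s k] (B r) := fun r =>
      hA.inter (hφX (measurableSet_singleton r))
    have hBm' : ∀ r, MeasurableSet (B r) := fun r => history_le hs k _ (hBm r)
    have hAB : A = ⋃ r ∈ (φ N).range, B r := by
      ext o
      simp only [hB, Set.mem_iUnion, Set.mem_inter_iff, Set.mem_preimage, Set.mem_singleton_iff,
        exists_prop]
      exact ⟨fun h => ⟨φ N (X o), (φ N).mem_range_self _, h, rfl⟩, fun ⟨_, _, h, _⟩ => h⟩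
    have hdisj : Set.PairwiseDisjoint (↑(φ N).range) B := by
      intro r _ r' _ hrr
      refine Set.disjoint_left.2 fun o ho ho' => hrr ?_
      rw [← ho.2, ← ho'.2]
    have hDi : Integrable (fun o => Metric.infDist (φ N (X o)) (P.agentSet j) ^ 2) μ := by
      refine (hXz.const_mul (2 ^ 2)).mono' ?_ (Eventually.of_forall fun o => ?_)
      · exact (((Metric.continuous_infDist_pt _).measurable.comp
          ((φ N).measurable.comp hXm)).pow_const 2).aestronglyMeasurable
      · rw [Real.norm_of_nonneg (sq_nonneg _), ← mul_pow]
        exact pow_le_pow_left₀ Metric.infDist_nonneg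
          ((infDist_agentSet_le (hz j) _).trans (hφb N o)) 2
    have hGi : Integrable (fun o => P.gPos j (c k o j) (φ N (X o)) ^ 2) μ := by
      refine (hXz.const_mul ((M * 2) ^ 2)).mono'
        (hgm _ ((φ N).measurable.comp hXm)).aestronglyMeasurable (Eventually.of_forall fun o => ?_)
      rw [Real.norm_of_nonneg (sq_nonneg _), ← mul_pow]
      refine pow_le_pow_left₀ (gPos_nonneg _ _ _) ((hgb _ _ (hφm N _)).trans ?_) 2
      rw [mul_assoc]
      exact mul_le_mul_of_nonneg_left (hφb N o) hM.le
    rw [hAB, integral_biUnion_finset _ (fun r _ => hBm' r) hdisj fun r _ => hDi.integrableOn,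
      integral_biUnion_finset _ (fun r _ => hBm' r) hdisj fun r _ => hGi.integrableOn,
      Finset.mul_sum]
    refine Finset.sum_le_sum fun r hr => ?_
    obtain ⟨w, rfl⟩ := SimpleFunc.mem_range.1 hr
    set r := φ N w
    have hr0 : r ∈ P.X₀ j := hφm N w
    have hgi : Integrable (fun o => P.gPos j (c k o j) r ^ 2) μ := by
      refine (integrable_const ((M * ‖r - z j‖) ^ 2)).mono'
        (hgm _ measurable_const).aestronglyMeasurable (Eventually.of_forall fun o => ?_)
      rw [Real.norm_of_nonneg (sq_nonneg _)]
      exact pow_le_pow_left₀ (gPos_nonneg _ _ _) (hgb _ _ hr0) 2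
    calc _ = ∫ o in B r, Metric.infDist r (P.agentSet j) ^ 2 ∂μ :=
          setIntegral_congr_fun (hBm' r) fun o ho => by
            have : φ N (X o) = r := ho.2
            simp only [this]
      _ ≤ ∫ o in B r, κ' j * (μ[fun o' => P.gPos j (c k o' j) r ^ 2 | history c s k]) o ∂μ :=
          setIntegral_mono_ae (integrable_const _).integrableOn
            (integrable_condExp.const_mul _).integrableOn (hreg j k r hr0)
      _ = κ' j * ∫ o in B r, P.gPos j (c k o j) r ^ 2 ∂μ := by
          rw [integral_const_mul, setIntegral_condExp (history_le hs k) hgi (hBm r)]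
      _ ≤ κ * ∫ o in B r, P.gPos j (c k o j) r ^ 2 ∂μ :=
          mul_le_mul_of_nonneg_right (hle j) (integral_nonneg fun o => sq_nonneg _)
      _ = _ := by
          congr 1
          exact setIntegral_congr_fun (hBm' r) fun o ho => by
            have : φ N (X o) = r := ho.2
            simp only [this]
  have hlim1 : Tendsto (fun N => ∫ o in A, Metric.infDist (φ N (X o)) (P.agentSet j) ^ 2 ∂μ) atTop
      (𝓝 (∫ o in A, Metric.infDist (X o) (P.agentSet j) ^ 2 ∂μ)) := by
    refine tendsto_integral_of_dominated_convergence (fun o => 2 ^ 2 * ‖X o - z j‖ ^ 2)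
      (fun N => ?_) (hXz.const_mul _).integrableOn
      (fun N => Eventually.of_forall fun o => ?_) (Eventually.of_forall fun o => ?_)
    · exact (((Metric.continuous_infDist_pt _).measurable.comp
          ((φ N).measurable.comp hXm)).pow_const 2).aestronglyMeasurable
    · rw [Real.norm_of_nonneg (sq_nonneg _), ← mul_pow]
      exact pow_le_pow_left₀ Metric.infDist_nonneg
        ((infDist_agentSet_le (hz j) _).trans (hφb N o)) 2
    · exact (((Metric.continuous_infDist_pt _).tendsto _).comp (hφt o)).pow 2
  have hlim2 : Tendsto (fun N => ∫ o in A, P.gPos j (c k o j) (φ N (X o)) ^ 2 ∂μ) atTop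
      (𝓝 (∫ o in A, P.gPos j (c k o j) (X o) ^ 2 ∂μ)) := by
    refine tendsto_integral_of_dominated_convergence (fun o => (M * 2) ^ 2 * ‖X o - z j‖ ^ 2)
      (fun N => (hgm _ ((φ N).measurable.comp hXm)).aestronglyMeasurable)
      (hXz.const_mul _).integrableOn
      (fun N => Eventually.of_forall fun o => ?_) (Eventually.of_forall fun o => ?_)
    · rw [Real.norm_of_nonneg (sq_nonneg _), ← mul_pow]
      refine pow_le_pow_left₀ (gPos_nonneg _ _ _) ((hgb _ _ (hφm N _)).trans ?_) 2
      rw [mul_assoc]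
      exact mul_le_mul_of_nonneg_left (hφb N o) hM.le
    · refine Tendsto.pow ?_ 2
      rw [tendsto_iff_norm_sub_tendsto_zero]
      have h0 : Tendsto (fun N => M * ‖φ N (X o) - X o‖) atTop (𝓝 0) := by
        simpa using (tendsto_iff_norm_sub_tendsto_zero.1 (hφt o)).const_mul M
      -- The positive parts are Lipschitz on the hard set uniformly in the index, so the random
      -- index does not disturb the limit.
      refine squeeze_zero (fun _ => norm_nonneg _) (fun N => ?_) h0
      have h1 := hLip j (c k o j) _ (hφm N (X o)) _ (hX0 o)
      have h2 := hLip j (c k o j) _ (hX0 o) _ (hφm N (X o))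
      rw [norm_sub_rev (X o)] at h2
      rw [Real.norm_eq_abs, abs_le]
      constructor <;> linarith
  exact le_of_tendsto_of_tendsto' hlim1 (hlim2.const_mul κ) hsimple

end Regularity

end Problem

/-! ### Uniform bounds for finite families and the weighted norm. -/

theorem exists_pos_le_family {m : ℕ} {f : Fin m → ℝ} (h : ∀ j, 0 < f j) :
    ∃ r, 0 < r ∧ ∀ j, r ≤ f j := by
  have h0 : 0 ≤ ∑ j, (f j)⁻¹ := Finset.sum_nonneg fun j _ => (inv_pos.2 (h j)).le
  refine ⟨(1 + ∑ j, (f j)⁻¹)⁻¹, by positivity, fun j => ?_⟩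
  have := Finset.single_le_sum (fun j _ => (inv_pos.2 (h j)).le) (Finset.mem_univ j)
  rw [inv_le_comm₀ (by positivity) (h j)]
  linarith

theorem exists_family_le {m : ℕ} (f : Fin m → ℝ) : ∃ r, 0 < r ∧ ∀ j, f j ≤ r := by
  have h0 : 0 ≤ ∑ j, |f j| := Finset.sum_nonneg fun j _ => abs_nonneg _
  refine ⟨1 + ∑ j, |f j|, by positivity, fun j => ?_⟩
  have := Finset.single_le_sum (fun j _ => abs_nonneg (f j)) (Finset.mem_univ j)
  linarith [le_abs_self (f j)]

/-- The parameters are, up to terms of higher order, `a j (k + 1) ^ (-p)` and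
`e j (k + 1) ^ (-(1 - p))`. -/
def ParameterBound {m : ℕ} (p : ℝ) (a e : Fin m → ℝ) (α ε : ℕ → Fin m → ℝ) (M : ℝ) : Prop :=
  ∀ k j, 0 < α k j ∧ 0 < ε k j ∧ α k j ≤ M * decay p k ∧ ε k j ≤ M ∧
      |α k j / a j - decay p k| ≤ M * decay p k ^ 2 ∧
      |α k j / a j * ε k j - e j * decay 1 k| ≤ M * decay p k ^ 2

/-- The square of the weighted norm with weights `1 / a j`. -/
noncomputable def weightedSq {m : ℕ} {n : Fin m → ℕ} (a : Fin m → ℝ) (x : Whole n) : ℝ :=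
  inner ℝ (scale (fun j => (a j)⁻¹) x) x

section Weighted

variable {m : ℕ} {n : Fin m → ℕ} {a : Fin m → ℝ}

theorem weightedSq_eq (x : Whole n) : weightedSq a x = ∑ j, (a j)⁻¹ * ‖x j‖ ^ 2 :=
  inner_scale_self _ _

theorem weightedSq_nonneg (ha : ∀ j, 0 < a j) (x : Whole n) : 0 ≤ weightedSq a x := by
  rw [weightedSq_eq]
  exact Finset.sum_nonneg fun j _ => mul_nonneg (inv_pos.2 (ha j)).le (sq_nonneg _)

theorem exists_weightedSq_bounds (ha : ∀ j, 0 < a j) :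
    ∃ l u, 0 < l ∧ 0 < u ∧ ∀ x : Whole n, l * ‖x‖ ^ 2 ≤ weightedSq a x ∧
      weightedSq a x ≤ u * ‖x‖ ^ 2 := by
  obtain ⟨l, hl, hl'⟩ := exists_pos_le_family fun j => inv_pos.2 (ha j)
  obtain ⟨u, hu, hu'⟩ := exists_family_le fun j => (a j)⁻¹
  exact ⟨l, u, hl, hu, fun x => ⟨le_inner_scale_self hl' x, inner_scale_self_le hu' x⟩⟩

theorem continuous_weightedSq : Continuous fun x : Whole n => weightedSq a x :=
  (scale _).continuous.inner continuous_id

/-- Young's inequality in each block. It serves, with τ of order 1/(k + 1), to change the reference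
point from `z k` to `z (k + 1)`. -/
theorem weightedSq_add_le (ha : ∀ j, 0 < a j) (x y : Whole n) {τ : ℝ} (hτ : 0 < τ) :
    weightedSq a (x + y) ≤ (1 + τ) * weightedSq a x + (1 + τ⁻¹) * weightedSq a y := by
  simp only [weightedSq_eq, Finset.mul_sum, ← Finset.sum_add_distrib]
  refine Finset.sum_le_sum fun j _ => ?_
  have h1 : ‖(x + y) j‖ ^ 2 ≤ (1 + τ) * ‖x j‖ ^ 2 + (1 + τ⁻¹) * ‖y j‖ ^ 2 := by
    have h2 : ‖(x + y) j‖ ≤ ‖x j‖ + ‖y j‖ := norm_add_le (x j) (y j)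
    have h3 := pow_le_pow_left₀ (norm_nonneg _) h2 2
    have h4 : 2 * (‖x j‖ * ‖y j‖) ≤ τ * ‖x j‖ ^ 2 + τ⁻¹ * ‖y j‖ ^ 2 := by
      have e : τ * ‖x j‖ ^ 2 + τ⁻¹ * ‖y j‖ ^ 2 - 2 * (‖x j‖ * ‖y j‖)
          = τ⁻¹ * (τ * ‖x j‖ - ‖y j‖) ^ 2 := by field_simp; ring
      have : 0 ≤ τ⁻¹ * (τ * ‖x j‖ - ‖y j‖) ^ 2 := by positivity
      linarith
    nlinarith
  have h2 : 0 < (a j)⁻¹ := inv_pos.2 (ha j)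
  have := mul_le_mul_of_nonneg_left h1 h2.le
  linarith

end Weighted

/-! ### One iteration along a sample path. -/

namespace Problem

variable {m : ℕ} {n : Fin m → ℕ} {Ξ I : Fin m → Type*} {P : Problem m n Ξ I}
  [∀ j, MeasurableSpace (Ξ j)] [∀ j, MeasurableSpace (I j)]
  {Ω : Type*} [m0 : MeasurableSpace Ω] {μ : Measure Ω} [IsProbabilityMeasure μ]
  {v : Ω → ∀ j, Ξ j} {c : ℕ → Ω → ∀ j, I j} {s : ℕ → Ω → ∀ j, Ξ j}
  {α β ε : ℕ → Fin m → ℝ} {x0 : Whole n} {x y d : ℕ → Ω → Whole n}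
  {p M₀ : ℝ} {a e b : Fin m → ℝ}

theorem iterate_mem_hard (hP : P.ConstraintAssumption) (hne : P.feasible.Nonempty)
    (hx : P.IsRun α β ε x0 c s x y d) (k : ℕ) (o : Ω) (j : Fin m) : x (k + 1) o j ∈ P.X₀ j := by
  obtain ⟨z, hz⟩ := hne
  rw [hx.feasibility_step]
  exact proj_mem ⟨_, (hz j).1⟩ (hP.isClosed_hard j) (hP.convex_hard j) _

theorem aux_mem_hard (hP : P.ConstraintAssumption) (hne : P.feasible.Nonempty)
    (hx : P.IsRun α β ε x0 c s x y d) (k : ℕ) (o : Ω) (j : Fin m) : y k o j ∈ P.X₀ j := by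
  obtain ⟨z, hz⟩ := hne
  rw [hx.operator_step]
  exact proj_mem ⟨_, (hz j).1⟩ (hP.isClosed_hard j) (hP.convex_hard j) _

/-- The operator step, followed along every sample path. -/
theorem exists_operator_step_bound (hP : P.ConstraintAssumption) (ha : ∀ j, 0 < a j)
    (hM₀ : 0 < M₀) (hpar : ParameterBound p a e α ε M₀)
    (hx : P.IsRun α β ε x0 c s x y d) :
    ∃ M, 0 < M ∧ ∀ z ∈ P.feasible, ∀ k o,
      weightedSq a (y k o - z) ≤ weightedSq a (x k o - z)
        - 2 * inner ℝ (P.op (s k o) (x k o)) (scale (fun j => α k j / a j) (x k o - z))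
        - 2 * inner ℝ (scale (fun j => α k j / a j * ε k j) (x k o)) (x k o - z)
        + M * (decay p k ^ 2 * (‖P.op (s k o) (x k o)‖ ^ 2 + ‖x k o‖ ^ 2)) := by
  obtain ⟨A, hA, hA'⟩ := exists_family_le fun j => (a j)⁻¹
  refine ⟨A * (M₀ ^ 2 * (2 + 2 * M₀ ^ 2)), by positivity, fun z hz k o => ?_⟩
  rw [norm_sq_eq_sum (P.op _ _), norm_sq_eq_sum (x k o), ← inner_scale_comm, inner_scale,
    inner_scale, weightedSq_eq, weightedSq_eq, ← Finset.sum_add_distrib]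
  simp only [Finset.mul_sum, ← Finset.sum_add_distrib, ← Finset.sum_sub_distrib]
  refine Finset.sum_le_sum fun j _ => ?_
  obtain ⟨h1, h2, h3, h4, -, -⟩ := hpar k j
  have ha' := inv_pos.2 (ha j)
  set u : Block n j := P.F j (s k o j) (x k o)
  have hu : (P.op (s k o) (x k o)) j = u := rfl
  rw [hu]
  have hs : ∀ w : Whole n, (w - z) j = w j - z j := fun _ => rfl
  rw [hs, hs]
  set xj : Block n j := x k o j
  have hstep : ‖y k o j - z j‖ ^ 2 ≤ ‖xj - z j‖ ^ 2 - 2 * α k j * inner ℝ u (xj - z j)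
      - 2 * α k j * ε k j * inner ℝ xj (xj - z j)
      + M₀ ^ 2 * (2 + 2 * M₀ ^ 2) * decay p k ^ 2 * (‖u‖ ^ 2 + ‖xj‖ ^ 2) := by
    rw [hx.operator_step]
    refine (norm_proj_sub_sq_le ⟨_, (hz j).1⟩ (hP.isClosed_hard j) (hP.convex_hard j) _
      (hz j).1).trans ?_
    have e1 : x k o j - α k j • (P.F j (s k o j) (x k o) + ε k j • x k o j) - z j
        = (xj - z j) - α k j • (u + ε k j • xj) := by
      simp only [u, xj]; abel
    rw [e1, @norm_sub_sq_real, norm_smul, inner_smul_right, inner_add_right, inner_smul_right,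
      real_inner_comm u, real_inner_comm xj, mul_pow, Real.norm_of_nonneg h1.le]
    have h5 : ‖u + ε k j • xj‖ ^ 2 ≤ (2 + 2 * M₀ ^ 2) * (‖u‖ ^ 2 + ‖xj‖ ^ 2) := by
      have h6 : ‖u + ε k j • xj‖ ≤ ‖u‖ + M₀ * ‖xj‖ := by
        refine (norm_add_le _ _).trans ?_
        rw [norm_smul, Real.norm_of_nonneg h2.le]
        gcongr
      have h7 := pow_le_pow_left₀ (norm_nonneg _) h6 2
      nlinarith [sq_nonneg (‖u‖ - M₀ * ‖xj‖), sq_nonneg (M₀ * ‖u‖), sq_nonneg ‖xj‖]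
    have h8 : α k j ^ 2 ≤ M₀ ^ 2 * decay p k ^ 2 := by
      rw [← mul_pow]; exact pow_le_pow_left₀ h1.le h3 2
    have h9 : α k j ^ 2 * ‖u + ε k j • xj‖ ^ 2
        ≤ (M₀ ^ 2 * decay p k ^ 2) * ((2 + 2 * M₀ ^ 2) * (‖u‖ ^ 2 + ‖xj‖ ^ 2)) :=
      mul_le_mul h8 h5 (sq_nonneg _) (by positivity)
    linarith
  -- Division by `a j` replaces the individual stepsize by `α k j / a j`, which is the same for all
  -- agents up to higher order.
  have hmul := mul_le_mul_of_nonneg_left hstep ha'.le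
  refine hmul.trans ?_
  have h10 : (a j)⁻¹ * (M₀ ^ 2 * (2 + 2 * M₀ ^ 2) * decay p k ^ 2 * (‖u‖ ^ 2 + ‖xj‖ ^ 2))
      ≤ A * (M₀ ^ 2 * (2 + 2 * M₀ ^ 2) * decay p k ^ 2 * (‖u‖ ^ 2 + ‖xj‖ ^ 2)) :=
    mul_le_mul_of_nonneg_right (hA' j) (by positivity)
  rw [div_eq_mul_inv]
  linarith

/-- The displacement of the operator step. -/
theorem exists_operator_displacement_bound (hP : P.ConstraintAssumption)
    (hM₀ : 0 < M₀) (hpar : ParameterBound p a e α ε M₀)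
    (hx : P.IsRun α β ε x0 c s x y d) :
    ∃ M, 0 < M ∧ ∀ k o j, x k o j ∈ P.X₀ j → ‖x k o j - y k o j‖ ^ 2
      ≤ M * (decay p k ^ 2 * (‖P.F j (s k o j) (x k o)‖ ^ 2 + ‖x k o j‖ ^ 2)) := by
  refine ⟨M₀ ^ 2 * (2 + 2 * M₀ ^ 2), by positivity, fun k o j hm => ?_⟩
  obtain ⟨h1, h2, h3, h4, -, -⟩ := hpar k j
  set u : Block n j := P.F j (s k o j) (x k o)
  set xj : Block n j := x k o j
  have h0 : ‖xj - y k o j‖ ≤ α k j * (‖u‖ + M₀ * ‖xj‖) := by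
    rw [norm_sub_rev, hx.operator_step]
    refine (norm_proj_sub_self_le ⟨_, hm⟩ (hP.isClosed_hard j) (hP.convex_hard j) hm _).trans ?_
    rw [norm_smul, Real.norm_of_nonneg h1.le]
    refine mul_le_mul_of_nonneg_left ((norm_add_le _ _).trans ?_) h1.le
    rw [norm_smul, Real.norm_of_nonneg h2.le]
    gcongr
  have h5 : (‖u‖ + M₀ * ‖xj‖) ^ 2 ≤ (2 + 2 * M₀ ^ 2) * (‖u‖ ^ 2 + ‖xj‖ ^ 2) := by
    nlinarith [sq_nonneg (‖u‖ - M₀ * ‖xj‖), sq_nonneg (M₀ * ‖u‖), sq_nonneg ‖xj‖]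
  have h8 : α k j ^ 2 ≤ M₀ ^ 2 * decay p k ^ 2 := by
    rw [← mul_pow]; exact pow_le_pow_left₀ h1.le h3 2
  calc _ ≤ (α k j * (‖u‖ + M₀ * ‖xj‖)) ^ 2 := pow_le_pow_left₀ (norm_nonneg _) h0 2
    _ = α k j ^ 2 * (‖u‖ + M₀ * ‖xj‖) ^ 2 := mul_pow _ _ _
    _ ≤ (M₀ ^ 2 * decay p k ^ 2) * ((2 + 2 * M₀ ^ 2) * (‖u‖ ^ 2 + ‖xj‖ ^ 2)) :=
        mul_le_mul h8 h5 (sq_nonneg _) (by positivity)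
    _ = _ := by ring

/-- The feasibility step, followed along every sample path. -/
theorem exists_feasibility_step_bound (hP : P.ConstraintAssumption) (ha : ∀ j, 0 < a j)
    (hb : ∀ j, b j ∈ Set.Ioo (0 : ℝ) 2) (hβ : ∀ k j, β k j = b j)
    (hx : P.IsRun α β ε x0 c s x y d) :
    ∃ r, 0 < r ∧ ∀ z ∈ P.feasible, ∀ k o,
      weightedSq a (x (k + 1) o - z) + r * ∑ j, P.gPos j (c k o j) (y k o j) ^ 2
        ≤ weightedSq a (y k o - z) := by
  obtain ⟨M, hM, hMb, -⟩ := exists_gPos_bound hP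
  obtain ⟨r, hr, hr'⟩ := exists_pos_le_family (f := fun j => (a j)⁻¹ * (b j * (2 - b j) / M ^ 2))
    fun j => by
      have := ha j; have := (hb j).1; have : 0 < 2 - b j := by linarith [(hb j).2]
      positivity
  refine ⟨r, hr, fun z hz k o => ?_⟩
  rw [weightedSq_eq, weightedSq_eq, Finset.mul_sum, ← Finset.sum_add_distrib]
  refine Finset.sum_le_sum fun j _ => ?_
  have hym := aux_mem_hard hP ⟨z, hz⟩ hx k o j
  have hsub : 0 < P.gPos j (c k o j) (y k o j) →
      d k o j ∈ subdiff (positivePart (P.g j (c k o j))) (y k o j) := fun h => by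
    refine hx.direction_mem k o j ?_
    by_contra hle
    rw [gPos_eq_zero (not_lt.1 hle)] at h
    exact lt_irrefl _ h
  have hstep := polyak_step ⟨_, (hz j).1⟩ (hP.isClosed_hard j) (hP.convex_hard j)
    (y := y k o j) (z := z j) (d := d k o j) (β := b j) (r := P.gPos j (c k o j) (y k o j)) (M := M)
    (hz j).1 (hb j).1.le (hb j).2.le (gPos_nonneg _ _ _) (hx.direction_ne_zero k o j)
    (fun h => hMb j _ _ hym _ (hsub h)) (fun h => by
      have h1 := gPos_add_inner_le hP hym (hz j).1 (hsub h)
      rw [gPos_eq_zero (Set.mem_iInter.1 (hz j).2 _), ← neg_sub, inner_neg_right] at h1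
      linarith) hym
  rw [← hβ k, ← hx.feasibility_step, hβ] at hstep
  have h1 := mul_le_mul_of_nonneg_left hstep (inv_pos.2 (ha j)).le
  have h2 := mul_le_mul_of_nonneg_right (hr' j) (sq_nonneg (P.gPos j (c k o j) (y k o j)))
  have hs : ∀ w : Whole n, (w - z) j = w j - z j := fun _ => rfl
  rw [hs, hs]
  linarith

/-- One full iteration, followed along every sample path. -/
theorem exists_iteration_bound (hP : P.ConstraintAssumption) (hne : P.feasible.Nonempty)
    (ha : ∀ j, 0 < a j)
    (hM₀ : 0 < M₀) (hpar : ParameterBound p a e α ε M₀)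
    (hb : ∀ j, b j ∈ Set.Ioo (0 : ℝ) 2) (hβ : ∀ k j, β k j = b j)
    (hx : P.IsRun α β ε x0 c s x y d) :
    ∃ M r, 0 < M ∧ 0 < r ∧ ∀ z ∈ P.feasible, ∀ k o,
      weightedSq a (x (k + 1) o - z) ≤ weightedSq a (x k o - z)
        - 2 * inner ℝ (P.op (s k o) (x k o)) (scale (fun j => α k j / a j) (x k o - z))
        - 2 * inner ℝ (scale (fun j => α k j / a j * ε k j) (x k o)) (x k o - z)
        + M * (decay p k ^ 2 * (‖P.op (s k o) (x k o)‖ ^ 2 + ‖x k o‖ ^ 2)) ∧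
      (1 ≤ k → weightedSq a (x (k + 1) o - z) + r * ∑ j, P.gPos j (c k o j) (x k o j) ^ 2
        ≤ weightedSq a (x k o - z)
        - 2 * inner ℝ (P.op (s k o) (x k o)) (scale (fun j => α k j / a j) (x k o - z))
        - 2 * inner ℝ (scale (fun j => α k j / a j * ε k j) (x k o)) (x k o - z)
        + M * (decay p k ^ 2 * (‖P.op (s k o) (x k o)‖ ^ 2 + ‖x k o‖ ^ 2))) := by
  obtain ⟨M₁, hM₁, h₁⟩ := exists_operator_step_bound hP ha hM₀ hpar hx
  obtain ⟨M₂, hM₂, h₂⟩ := exists_operator_displacement_bound hP hM₀ hpar hx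
  obtain ⟨r, hr, h₃⟩ := exists_feasibility_step_bound hP ha hb hβ hx
  obtain ⟨M₃, hM₃, -, hLip⟩ := exists_gPos_bound hP
  refine ⟨M₁ + r * (M₃ ^ 2 * M₂), r / 2, by positivity, by positivity, fun z hz k o => ⟨?_, fun hk => ?_⟩⟩
  · have h1 := h₁ z hz k o
    have h3 := h₃ z hz k o
    have h4 : 0 ≤ r * ∑ j, P.gPos j (c k o j) (y k o j) ^ 2 := by positivity
    have h5 : 0 ≤ r * (M₃ ^ 2 * M₂) *
        (decay p k ^ 2 * (‖P.op (s k o) (x k o)‖ ^ 2 + ‖x k o‖ ^ 2)) := by positivity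
    linarith
  · have h1 := h₁ z hz k o
    have h3 := h₃ z hz k o
    -- The violation is moved from `y k` to `x k` by the Lipschitz bound. The displacement has size
    -- O(θ²) after squaring, and the factor 2 is why the gain is `r / 2`.
    have h4 : ∑ j, P.gPos j (c k o j) (x k o j) ^ 2 ≤
        2 * ∑ j, P.gPos j (c k o j) (y k o j) ^ 2 + 2 * (M₃ ^ 2 * M₂ *
        (decay p k ^ 2 * (‖P.op (s k o) (x k o)‖ ^ 2 + ‖x k o‖ ^ 2))) := by
      rw [norm_sq_eq_sum (P.op _ _), norm_sq_eq_sum (x k o), ← Finset.sum_add_distrib]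
      simp only [Finset.mul_sum, ← Finset.sum_add_distrib]
      refine Finset.sum_le_sum fun j _ => ?_
      -- The initial point is arbitrary; from index 1 on the iterates lie in the hard set.
      obtain ⟨k', rfl⟩ := Nat.exists_eq_add_of_le' hk
      have hxm := iterate_mem_hard hP hne hx k' o j
      have h6 := hLip j (c (k' + 1) o j) _ hxm _ (aux_mem_hard hP hne hx (k' + 1) o j)
      have h7 := h₂ (k' + 1) o j hxm
      have h8 := pow_le_pow_left₀ (gPos_nonneg _ _ _) h6 2
      have h9 := mul_le_mul_of_nonneg_left h7 (sq_nonneg M₃)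
      have hu : (P.op (s (k' + 1) o) (x (k' + 1) o)) j = P.F j (s (k' + 1) o j) (x (k' + 1) o) := rfl
      rw [hu]
      set G := P.gPos j (c (k' + 1) o j) (y (k' + 1) o j)
      set Δ := ‖x (k' + 1) o j - y (k' + 1) o j‖
      nlinarith [sq_nonneg (G - M₃ * Δ)]
    have h5 := mul_le_mul_of_nonneg_left h4 hr.le
    linarith

/-- The iterates are square integrable. -/
theorem memLp_iterate (hP : P.ConstraintAssumption) (hF : P.OperatorAssumption μ v)
    (hs : P.SamplingAssumption μ v c s) (ha : ∀ j, 0 < a j)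
    (hM₀ : 0 < M₀) (hpar : ParameterBound p a e α ε M₀)
    (hb : ∀ j, b j ∈ Set.Ioo (0 : ℝ) 2) (hβ : ∀ k j, β k j = b j)
    (hx : P.IsRun α β ε x0 c s x y d) (k : ℕ) : MemLp (x k) 2 μ := by
  obtain ⟨z, hz, -⟩ := hF.consistent
  have hne : P.feasible.Nonempty := ⟨z, hz⟩
  have hm := measurable_iterate hP hF hne hx
  obtain ⟨M, r, hM, hr, h⟩ := exists_iteration_bound hP hne ha hM₀ hpar hb hβ hx
  obtain ⟨l, u, hl, hu, hw⟩ := exists_weightedSq_bounds (n := n) ha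
  obtain ⟨M', -, hM'⟩ := exists_op_moment_bound hF hs
  induction k with
  | zero =>
    have : x 0 = fun _ => x0 := funext hx.init
    rw [this]
    exact memLp_const x0
  | succ k ih =>
    have hop := (hM' k (x k) (hm k) ih).1
    have hxz := ih.sub (memLp_const z)
    have hscale : ∀ γ : Fin m → ℝ, ∀ {f : Ω → Whole n}, MemLp f 2 μ →
        MemLp (fun o => scale γ (f o)) 2 μ := fun γ f hf => (scale γ).comp_memLp' hf
    have hi1 := integrable_inner_of_memLp hop (hscale (fun j => α k j / a j) hxz)
    have hi2 := integrable_inner_of_memLp (hscale (fun j => α k j / a j * ε k j) ih) hxz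
    have hi3 := (hop.integrable_norm_pow two_ne_zero).add (ih.integrable_norm_pow two_ne_zero)
    have hi4 := integrable_inner_of_memLp (hscale (fun j => (a j)⁻¹) hxz) hxz
    have hi := (((hi4.sub (hi1.const_mul 2)).sub (hi2.const_mul 2)).add
      ((hi3.const_mul (decay p k ^ 2)).const_mul M)).const_mul l⁻¹
    have hmeas : AEStronglyMeasurable (x (k + 1)) μ :=
      ((hm (k + 1)).mono (history_le hs _) le_rfl).aestronglyMeasurable
    have hz2 : MemLp (fun o => x (k + 1) o - z) 2 μ := by
      refine (memLp_two_iff_integrable_sq_norm (hmeas.sub aestronglyMeasurable_const)).2 ?_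
      refine hi.mono' ((hmeas.sub aestronglyMeasurable_const).norm.pow 2)
        (Eventually.of_forall fun o => ?_)
      rw [Real.norm_of_nonneg (sq_nonneg _)]
      have h1 := (h z hz k o).1
      have h2 := (hw (x (k + 1) o - z)).1
      have h3 := h2.trans h1
      have h4 := mul_le_mul_of_nonneg_left h3 (inv_pos.2 hl).le
      rw [inv_mul_cancel_left₀ hl.ne'] at h4
      exact h4
    have := hz2.add (memLp_const z)
    refine this.ae_eq (Eventually.of_forall fun o => ?_)
    simp

end Problem

/-! ### Expected decrease of the distance to a regularized solution. -/

theorem continuous_of_norm_sub_le {E : Type*} [NormedAddCommGroup E] {T : E → E} {K : ℝ}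
    (hK : 0 ≤ K) (hlip : ∀ x y, ‖T x - T y‖ ≤ K * ‖x - y‖) : Continuous T :=
  (LipschitzWith.of_dist_le_mul (K := K.toNNReal) fun x y => by
    simpa only [dist_eq_norm, Real.coe_toNNReal K hK] using hlip x y).continuous

set_option maxHeartbeats 1000000 in
/-- The expected decrease of the weighted distance to a regularized solution. -/
theorem exists_drift_bound {m : ℕ} {n : Fin m → ℕ} {T : Whole n → Whole n} {X : Set (Whole n)}
    (hne : X.Nonempty) (hc : IsClosed X) (hv : Convex ℝ X)
    (hmono : ∀ x y, 0 ≤ inner ℝ (T x - T y) (x - y)) {K : ℝ} (hK : 0 < K)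
    (hlip : ∀ x y, ‖T x - T y‖ ≤ K * ‖x - y‖) {p M₀ : ℝ} (hp1 : p ≤ 1)
    {a e : Fin m → ℝ} {α ε : ℕ → Fin m → ℝ}
    (ha : ∀ j, 0 < a j) (he : ∀ j, 0 < e j)
    (hM₀ : 0 < M₀) (hpar : ParameterBound p a e α ε M₀) {M₁ r R : ℝ} (hM₁ : 0 < M₁) (hr : 0 < r)
    (hR : 0 < R) :
    ∃ c M, 0 < c ∧ c ≤ 1 ∧ 0 < M ∧ ∀ (k : ℕ), ∀ z ∈ X, ‖z‖ ≤ R →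
      (∀ w ∈ X, 0 ≤ inner ℝ (T z + decay (1 - p) k • scale e z) (w - z)) → ∀ x,
      weightedSq a (x - z) - 2 * inner ℝ (T x) (scale (fun j => α k j / a j) (x - z))
        - 2 * inner ℝ (scale (fun j => α k j / a j * ε k j) x) (x - z)
        + M₁ * (decay p k ^ 2 * (1 + ‖x‖ ^ 2)) - r * Metric.infDist x X ^ 2
      ≤ (1 - 2 * (c * decay 1 k) + M * decay p k ^ 2) * weightedSq a (x - z)
        + M * decay p k ^ 2 - r / 2 * Metric.infDist x X ^ 2 := by
  obtain ⟨l, u, hl, hu, hw⟩ := exists_weightedSq_bounds (n := n) ha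
  obtain ⟨em, hem, hem'⟩ := exists_pos_le_family he
  obtain ⟨eM, heM, heM'⟩ := exists_family_le e
  set G₁ : ℝ := ‖T 0‖ + K * R with hG₁
  set G : ℝ := G₁ + eM * R with hG
  have hG₁0 : 0 ≤ G₁ := by positivity
  have hG0 : 0 ≤ G := by positivity
  set N : ℝ := 2 * M₀ * (2 * (G₁ + K)) + 2 * M₀ * (2 * (R + 1)) + M₁ * (1 + 2 * R ^ 2 + 2)
    + 2 * G ^ 2 / r with hN
  have hN0 : 0 < N := by positivity
  -- Here `em / u` compares the coercivity of `scale e` with the weighted norm, and the cap 1 keeps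
  -- the later Young parameter at most 1. `N` collects the coefficients of θ² (1 + q²), and `N / l`
  -- converts q² into the weighted norm.
  refine ⟨min 1 (em / u), N + N / l, by positivity, min_le_left _ _, by positivity,
    fun k z hz hzR hvi x => ?_⟩
  set θ := decay p k with hθ
  set η := decay (1 - p) k with hη
  set ι := decay 1 k with hι
  have hθ0 : 0 < θ := decay_pos p k
  have hη0 : 0 < η := decay_pos _ k
  have hι0 : 0 < ι := decay_pos _ k
  have hθη : θ * η = ι := by rw [hθ, hη, decay_mul, hι]; congr 1; ring
  have hη1 : η ≤ 1 := decay_le_one (by linarith) k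
  set D := Metric.infDist x X with hD
  have hD0 : 0 ≤ D := Metric.infDist_nonneg
  set q := ‖x - z‖ with hq
  have hq0 : 0 ≤ q := norm_nonneg _
  have hTz : ‖T z‖ ≤ G₁ := by
    have h1 := hlip z 0
    have h2 := norm_sub_norm_le (T z) (T 0)
    rw [sub_zero] at h1
    have h3 : K * ‖z‖ ≤ K * R := by gcongr
    rw [hG₁]; linarith
  have hTx : ‖T x‖ ≤ G₁ + K * q := by
    have h1 := hlip x z
    have h2 := norm_sub_norm_le (T x) (T z)
    linarith
  have hxq : ‖x‖ ≤ R + q := by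
    have := norm_sub_norm_le x z
    linarith
  have hreg : ‖T z + η • scale e z‖ ≤ G := by
    have h1 : ‖scale e z‖ ≤ eM * ‖z‖ :=
      norm_scale_le (fun j => by rw [abs_of_pos (he j)]; exact heM' j) z heM.le
    calc _ ≤ ‖T z‖ + η * ‖scale e z‖ := by
          refine (norm_add_le _ _).trans ?_
          rw [norm_smul, Real.norm_of_nonneg hη0.le]
      _ ≤ G₁ + 1 * (eM * R) := by gcongr; exact h1.trans (by gcongr)
      _ = G := by rw [hG, one_mul]
  -- Strong monotonicity of the regularized operator. As `x` may be infeasible, the inequality for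
  -- `z` is tested at the projection of `x`, at the cost `G * D`.
  have hmain : η * (em * q ^ 2) - G * D
      ≤ inner ℝ (T x) (x - z) + η * inner ℝ (scale e x) (x - z) := by
    have h1 := hvi _ (proj_mem hne hc hv x)
    have h2 : -(G * D) ≤ inner ℝ (T z + η • scale e z) (x - proj X x) := by
      have := abs_real_inner_le_norm (T z + η • scale e z) (x - proj X x)
      rw [← infDist_eq_norm_sub_proj hne hc hv] at this
      have h3 := mul_le_mul_of_nonneg_right hreg hD0
      have := (abs_le.1 this).1
      linarith
    have h3 := hmono x z
    have h4 : em * q ^ 2 ≤ inner ℝ (scale e (x - z)) (x - z) := le_inner_scale_self hem' _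
    have h5 := mul_le_mul_of_nonneg_left h4 hη0.le
    simp only [map_sub, inner_sub_left, inner_sub_right, inner_add_left, real_inner_smul_left] at *
    linarith
  have h1 : θ * inner ℝ (T x) (x - z) - M₀ * θ ^ 2 * ((G₁ + K * q) * q)
      ≤ inner ℝ (T x) (scale (fun j => α k j / a j) (x - z)) := by
    have h := abs_inner_scale_le (γ := fun j => α k j / a j - θ) (M := M₀ * θ ^ 2)
      (fun j => (hpar k j).2.2.2.2.1) (by positivity) (x - z) (T x)
    rw [← scale_sub_apply, scale_const, inner_sub_left, real_inner_smul_left,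
      real_inner_comm, real_inner_comm (T x)] at h
    have h2 := (abs_le.1 h).1
    have h3 : M₀ * θ ^ 2 * (‖x - z‖ * ‖T x‖) ≤ M₀ * θ ^ 2 * ((G₁ + K * q) * q) := by
      rw [mul_comm ‖x - z‖]
      gcongr
    linarith
  have h2 : ι * inner ℝ (scale e x) (x - z) - M₀ * θ ^ 2 * ((R + q) * q)
      ≤ inner ℝ (scale (fun j => α k j / a j * ε k j) x) (x - z) := by
    have h := abs_inner_scale_le (γ := fun j => α k j / a j * ε k j - e j * ι) (M := M₀ * θ ^ 2)
      (fun j => (hpar k j).2.2.2.2.2) (by positivity) x (x - z)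
    have e1 : scale (fun j => e j * ι) x = ι • scale e x := by
      ext j i; simp; ring
    rw [← scale_sub_apply, e1, inner_sub_left, real_inner_smul_left] at h
    have h2 := (abs_le.1 h).1
    have h3 : M₀ * θ ^ 2 * (‖x‖ * ‖x - z‖) ≤ M₀ * θ ^ 2 * ((R + q) * q) := by gcongr
    linarith
  -- Half of the feasibility gain absorbs the infeasibility cost up to O(θ²).
  have h3 : 2 * (θ * (G * D)) ≤ r / 2 * D ^ 2 + 2 * G ^ 2 / r * θ ^ 2 := by
    have e1 : r / 2 * D ^ 2 + 2 * G ^ 2 / r * θ ^ 2 - 2 * (θ * (G * D))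
        = r / 2 * (D - 2 * G * θ / r) ^ 2 := by field_simp; ring
    have : 0 ≤ r / 2 * (D - 2 * G * θ / r) ^ 2 := by positivity
    linarith
  have h4 := mul_le_mul_of_nonneg_left hmain hθ0.le
  have h5 : 1 + ‖x‖ ^ 2 ≤ (1 + 2 * R ^ 2 + 2) * (1 + q ^ 2) := by
    have := pow_le_pow_left₀ (norm_nonneg _) hxq 2
    linarith [sq_nonneg (R - q), sq_nonneg (R * q), sq_nonneg q]
  have h6 := mul_le_mul_of_nonneg_left h5 (by positivity : 0 ≤ M₁ * θ ^ 2)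
  have h7 : (G₁ + K * q) * q ≤ (2 * (G₁ + K)) * (1 + q ^ 2) := by
    linarith [mul_nonneg hG₁0 (sq_nonneg (1 - q)), mul_nonneg hK.le (sq_nonneg q),
      mul_nonneg hG₁0 (sq_nonneg q)]
  have h8 : (R + q) * q ≤ (2 * (R + 1)) * (1 + q ^ 2) := by
    linarith [mul_nonneg hR.le (sq_nonneg (1 - q)), mul_nonneg hR.le (sq_nonneg q), sq_nonneg q]
  have h9 := mul_le_mul_of_nonneg_left h7 (by positivity : 0 ≤ 2 * M₀ * θ ^ 2)
  have h10 := mul_le_mul_of_nonneg_left h8 (by positivity : 0 ≤ 2 * M₀ * θ ^ 2)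
  have h11 : 2 * G ^ 2 / r * θ ^ 2 ≤ 2 * G ^ 2 / r * θ ^ 2 * (1 + q ^ 2) :=
    le_mul_of_one_le_right (by positivity) (by nlinarith [sq_nonneg q])
  have hV0 := weightedSq_nonneg ha (x - z)
  have h12 : min 1 (em / u) * weightedSq a (x - z) ≤ em * q ^ 2 := by
    calc _ ≤ em / u * (u * q ^ 2) :=
          mul_le_mul (min_le_right _ _) (hw (x - z)).2 hV0 (by positivity)
      _ = _ := by field_simp
  have h13 := mul_le_mul_of_nonneg_left h12 hι0.le
  have h14 : N * θ ^ 2 * q ^ 2 ≤ N / l * θ ^ 2 * weightedSq a (x - z) := by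
    have := mul_le_mul_of_nonneg_left (hw (x - z)).1 (by positivity : 0 ≤ N / l * θ ^ 2)
    have e1 : N / l * θ ^ 2 * (l * ‖x - z‖ ^ 2) = N * θ ^ 2 * q ^ 2 := by rw [hq]; field_simp
    linarith
  have h15 : 0 ≤ N * θ ^ 2 * weightedSq a (x - z) := by positivity
  have h16 : 0 ≤ N / l * θ ^ 2 := by positivity
  have h17 : N * θ ^ 2 * (1 + q ^ 2) = 2 * M₀ * θ ^ 2 * (2 * (G₁ + K) * (1 + q ^ 2))
      + 2 * M₀ * θ ^ 2 * (2 * (R + 1) * (1 + q ^ 2)) + M₁ * θ ^ 2 * ((1 + 2 * R ^ 2 + 2) * (1 + q ^ 2))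
      + 2 * G ^ 2 / r * θ ^ 2 * (1 + q ^ 2) := by rw [hN]; ring
  have h18 : θ * (η * (em * q ^ 2) - G * D) = ι * (em * q ^ 2) - θ * (G * D) := by rw [← hθη]; ring
  have h19 : θ * (inner ℝ (T x) (x - z) + η * inner ℝ (scale e x) (x - z))
      = θ * inner ℝ (T x) (x - z) + ι * inner ℝ (scale e x) (x - z) := by rw [← hθη]; ring
  rw [h18, h19] at h4
  linarith

/-! ### One iteration integrated over history events. -/

namespace Problem

variable {m : ℕ} {n : Fin m → ℕ} {Ξ I : Fin m → Type*} {P : Problem m n Ξ I}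
  [∀ j, MeasurableSpace (Ξ j)] [∀ j, MeasurableSpace (I j)]
  {Ω : Type*} [m0 : MeasurableSpace Ω] {μ : Measure Ω} [IsProbabilityMeasure μ]
  {v : Ω → ∀ j, Ξ j} {c : ℕ → Ω → ∀ j, I j} {s : ℕ → Ω → ∀ j, Ξ j}
  {α β ε : ℕ → Fin m → ℝ} {x0 : Whole n} {x y d : ℕ → Ω → Whole n}
  {p M₀ : ℝ} {a e b : Fin m → ℝ}

theorem memLp_scale {f : Ω → Whole n} (γ : Fin m → ℝ) (hf : MemLp f 2 μ) :
    MemLp (fun o => scale γ (f o)) 2 μ := (scale γ).comp_memLp' hf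

theorem integrable_infDist_sq (hne : P.feasible.Nonempty)
    {f : Ω → Whole n} (hf : MemLp f 2 μ) :
    Integrable (fun o => Metric.infDist (f o) P.feasible ^ 2) μ := by
  obtain ⟨z, hz⟩ := hne
  refine ((hf.sub (memLp_const z)).integrable_norm_pow two_ne_zero).mono'
    (((Metric.continuous_infDist_pt _).comp_aestronglyMeasurable hf.1).pow 2)
    (Eventually.of_forall fun o => ?_)
  rw [Real.norm_of_nonneg (sq_nonneg _)]
  refine pow_le_pow_left₀ Metric.infDist_nonneg ?_ 2
  have := Metric.infDist_le_dist_of_mem (x := f o) hz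
  rwa [dist_eq_norm] at this

theorem integrable_weightedSq {f : Ω → Whole n} (hf : MemLp f 2 μ) :
    Integrable (fun o => weightedSq a (f o)) μ :=
  integrable_inner_of_memLp (memLp_scale _ hf) hf

theorem memLp_mean (hF : P.OperatorAssumption μ v) {f : Ω → Whole n} (hf : MemLp f 2 μ) :
    MemLp (fun o => P.mean μ v (f o)) 2 μ := by
  obtain ⟨K, hK, hlip⟩ := exists_lipschitz_mean hF
  have hcont := continuous_of_norm_sub_le hK.le hlip
  have h0 : MemLp (fun o => K * ‖f o‖) 2 μ := hf.norm.const_mul K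
  have hb : MemLp (fun o => ‖P.mean μ v 0‖ + K * ‖f o‖) 2 μ :=
    (memLp_const ‖P.mean μ v 0‖).add h0
  refine hb.mono (hcont.comp_aestronglyMeasurable hf.1) (Eventually.of_forall fun o => ?_)
  rw [Real.norm_of_nonneg (by positivity)]
  have h1 := hlip (f o) 0
  have h2 := norm_sub_norm_le (P.mean μ v (f o)) (P.mean μ v 0)
  rw [sub_zero] at h1
  linarith

theorem setIntegral_lincomb {A : Set Ω} {f₁ f₂ f₃ f₄ f₅ : Ω → ℝ} (h₁ : Integrable f₁ μ)
    (h₂ : Integrable f₂ μ) (h₃ : Integrable f₃ μ) (h₄ : Integrable f₄ μ) (h₅ : Integrable f₅ μ)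
    (M t r : ℝ) :
    Integrable (fun o => f₁ o - 2 * f₂ o - 2 * f₃ o + M * (t * f₄ o) - r * f₅ o) μ ∧
    ∫ o in A, (f₁ o - 2 * f₂ o - 2 * f₃ o + M * (t * f₄ o) - r * f₅ o) ∂μ
      = ∫ o in A, f₁ o ∂μ - 2 * ∫ o in A, f₂ o ∂μ - 2 * ∫ o in A, f₃ o ∂μ
        + M * (t * ∫ o in A, f₄ o ∂μ) - r * ∫ o in A, f₅ o ∂μ := by
  have h12 : Integrable (fun o => f₁ o - 2 * f₂ o) μ := h₁.sub (h₂.const_mul 2)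
  have h123 : Integrable (fun o => f₁ o - 2 * f₂ o - 2 * f₃ o) μ := h12.sub (h₃.const_mul 2)
  have h4 : Integrable (fun o => M * (t * f₄ o)) μ := (h₄.const_mul t).const_mul M
  have h1234 : Integrable (fun o => f₁ o - 2 * f₂ o - 2 * f₃ o + M * (t * f₄ o)) μ := h123.add h4
  refine ⟨h1234.sub (h₅.const_mul r), ?_⟩
  rw [integral_sub h1234.integrableOn (h₅.const_mul r).integrableOn,
    integral_add h123.integrableOn h4.integrableOn,
    integral_sub h12.integrableOn (h₃.const_mul 2).integrableOn,
    integral_sub h₁.integrableOn (h₂.const_mul 2).integrableOn, integral_const_mul,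
    integral_const_mul, integral_const_mul, integral_const_mul, integral_const_mul]

set_option maxHeartbeats 1000000 in
/-- One iteration, integrated over an event determined by the history. -/
theorem exists_integrated_iteration_bound (hP : P.ConstraintAssumption)
    (hF : P.OperatorAssumption μ v) (hs : P.SamplingAssumption μ v c s)
    (ha : ∀ j, 0 < a j) (hM₀ : 0 < M₀) (hpar : ParameterBound p a e α ε M₀)
    (hb : ∀ j, b j ∈ Set.Ioo (0 : ℝ) 2) (hβ : ∀ k j, β k j = b j)
    (hx : P.IsRun α β ε x0 c s x y d) :
    ∃ M r, 0 < M ∧ 0 < r ∧ ∀ z ∈ P.feasible, ∀ k, 1 ≤ k → ∀ A, MeasurableSet[history c s k] A →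
      ∫ o in A, weightedSq a (x (k + 1) o - z) ∂μ ≤ ∫ o in A, (weightedSq a (x k o - z)
        - 2 * inner ℝ (P.mean μ v (x k o)) (scale (fun j => α k j / a j) (x k o - z))
        - 2 * inner ℝ (scale (fun j => α k j / a j * ε k j) (x k o)) (x k o - z)
        + M * (decay p k ^ 2 * (1 + ‖x k o‖ ^ 2))
        - r * Metric.infDist (x k o) P.feasible ^ 2) ∂μ := by
  obtain ⟨z₀, hz₀, -⟩ := hF.consistent
  have hne : P.feasible.Nonempty := ⟨z₀, hz₀⟩
  have hm := measurable_iterate hP hF hne hx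
  have hL := memLp_iterate hP hF hs ha hM₀ hpar hb hβ hx
  obtain ⟨M, r, hM, hr, h⟩ := exists_iteration_bound hP hne ha hM₀ hpar hb hβ hx
  obtain ⟨M', hM'0, hM'⟩ := exists_op_moment_bound hF hs
  obtain ⟨κ, hκ, hreg⟩ := exists_regularity hP hne hs
  refine ⟨M * (M' + 1), r * κ⁻¹, by positivity, by positivity, fun z hz k hk A hA => ?_⟩
  have hA' := history_le hs k _ hA
  have hcoord : ∀ j, MemLp (fun o => x k o j) 2 μ := fun j =>
    ((PiLp.proj 2 (𝕜 := ℝ) (Block n) j)).comp_memLp' (hL k)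
  have hhard : ∀ j o, x k o j ∈ P.X₀ j := fun j o => by
    obtain ⟨k', rfl⟩ := Nat.exists_eq_add_of_le' hk
    exact iterate_mem_hard hP hne hx k' o j
  have hR := fun j => hreg k j (fun o => x k o j) (measurable_coord (hm k) j) (hcoord j) (hhard j)
  obtain ⟨hop, hopA⟩ := hM' k (x k) (hm k) (hL k)
  have hxz : MemLp (fun o => x k o - z) 2 μ := (hL k).sub (memLp_const z)
  have hxz' : MemLp (fun o => x (k + 1) o - z) 2 μ := (hL (k + 1)).sub (memLp_const z)
  have hmean := memLp_mean hF (hL k)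
  set γ : Fin m → ℝ := fun j => α k j / a j
  set γ' : Fin m → ℝ := fun j => α k j / a j * ε k j
  have i1 : Integrable (fun o => weightedSq a (x k o - z)) μ := integrable_weightedSq hxz
  have i1' : Integrable (fun o => weightedSq a (x (k + 1) o - z)) μ := integrable_weightedSq hxz'
  have i2 : Integrable (fun o => (inner ℝ (P.op (s k o) (x k o)) (scale γ (x k o - z)) : ℝ)) μ :=
    integrable_inner_of_memLp hop (memLp_scale γ hxz)
  have i2' : Integrable (fun o => (inner ℝ (P.mean μ v (x k o)) (scale γ (x k o - z)) : ℝ)) μ :=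
    integrable_inner_of_memLp hmean (memLp_scale γ hxz)
  have i3 : Integrable (fun o => (inner ℝ (scale γ' (x k o)) (x k o - z) : ℝ)) μ :=
    integrable_inner_of_memLp (memLp_scale γ' (hL k)) hxz
  have i4 : Integrable (fun o => ‖P.op (s k o) (x k o)‖ ^ 2) μ := hop.integrable_norm_pow two_ne_zero
  have i5 : Integrable (fun o => ‖x k o‖ ^ 2) μ := (hL k).integrable_norm_pow two_ne_zero
  have i5' : Integrable (fun o => 1 + ‖x k o‖ ^ 2) μ := (integrable_const _).add i5
  have i6 : Integrable (fun o => ∑ j, P.gPos j (c k o j) (x k o j) ^ 2) μ :=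
    integrable_finsetSum _ fun j _ => (hR j).1
  have i7 : Integrable (fun o => Metric.infDist (x k o) P.feasible ^ 2) μ :=
    integrable_infDist_sq hne (hL k)
  have hunb := setIntegral_inner_op hF hs (hm k) (hL k)
    ((scale γ).continuous.measurable.comp ((hm k).sub measurable_const)) (memLp_scale γ hxz) hA
  have hunb' : ∫ o in A, inner ℝ (P.op (s k o) (x k o)) (scale γ (x k o - z)) ∂μ
      = ∫ o in A, inner ℝ (P.mean μ v (x k o)) (scale γ (x k o - z)) ∂μ := hunb
  -- Regularity in each block, summed over the agents, turns the random constraint violation into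
  -- distance to the feasible set.
  have hdist : ∫ o in A, Metric.infDist (x k o) P.feasible ^ 2 ∂μ
      ≤ κ * ∫ o in A, ∑ j, P.gPos j (c k o j) (x k o j) ^ 2 ∂μ := by
    have hdj : ∀ j, Integrable (fun o => Metric.infDist (x k o j) (P.agentSet j) ^ 2) μ := fun j => by
      refine (((hcoord j).sub (memLp_const (z j))).integrable_norm_pow two_ne_zero).mono'
        (((Metric.continuous_infDist_pt _).comp_aestronglyMeasurable (hcoord j).1).pow 2)
        (Eventually.of_forall fun o => ?_)
      rw [Real.norm_of_nonneg (sq_nonneg _)]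
      exact pow_le_pow_left₀ Metric.infDist_nonneg (infDist_agentSet_le (hz j) _) 2
    calc _ ≤ ∫ o in A, ∑ j, Metric.infDist (x k o j) (P.agentSet j) ^ 2 ∂μ :=
          setIntegral_mono i7.integrableOn (integrable_finsetSum _ fun j _ => hdj j).integrableOn
            fun o => infDist_feasible_sq_le hP hne _
      _ = ∑ j, ∫ o in A, Metric.infDist (x k o j) (P.agentSet j) ^ 2 ∂μ :=
          integral_finsetSum _ fun j _ => (hdj j).integrableOn
      _ ≤ ∑ j, κ * ∫ o in A, P.gPos j (c k o j) (x k o j) ^ 2 ∂μ :=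
          Finset.sum_le_sum fun j _ => (hR j).2 A hA
      _ = _ := by
          rw [integral_finsetSum _ fun j _ => (hR j).1.integrableOn, Finset.mul_sum]
  have i45 : Integrable (fun o => ‖P.op (s k o) (x k o)‖ ^ 2 + ‖x k o‖ ^ 2) μ := i4.add i5
  obtain ⟨hl, hl'⟩ := setIntegral_lincomb (A := A) i1 i2 i3 i45 i6 M (decay p k ^ 2) r
  have hpath := setIntegral_mono (s := A) i1'.integrableOn hl.integrableOn fun o => by
    have := (h z hz k o).2 hk
    exact le_sub_iff_add_le.2 this
  rw [hl', hunb'] at hpath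
  have hE : ∫ o in A, (‖P.op (s k o) (x k o)‖ ^ 2 + ‖x k o‖ ^ 2) ∂μ
      ≤ (M' + 1) * ∫ o in A, (1 + ‖x k o‖ ^ 2) ∂μ := by
    rw [integral_add i4.integrableOn i5.integrableOn]
    have h1 := hopA A hA
    have h2 : ∫ o in A, ‖x k o‖ ^ 2 ∂μ ≤ ∫ o in A, (1 + ‖x k o‖ ^ 2) ∂μ :=
      setIntegral_mono i5.integrableOn i5'.integrableOn fun o => by simp
    linarith
  have hE' := mul_le_mul_of_nonneg_left hE (by positivity : 0 ≤ M * decay p k ^ 2)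
  rw [(setIntegral_lincomb (A := A) i1 i2' i3 i5' i7 _ _ _).2]
  have hd' := mul_le_mul_of_nonneg_left hdist (by positivity : 0 ≤ r * κ⁻¹)
  have e1 : r * κ⁻¹ * (κ * ∫ o in A, ∑ j, P.gPos j (c k o j) (x k o j) ^ 2 ∂μ)
      = r * ∫ o in A, ∑ j, P.gPos j (c k o j) (x k o j) ^ 2 ∂μ := by field_simp
  linarith

end Problem

/-! ### Deterministic and stochastic recursions. -/

/-- A nonnegative sequence with `u (k+1) ≤ (1 - q k) u k + t k - w k`, where `∑ t < ∞ = ∑ q`,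
tends to zero, is bounded, and `∑ w < ∞`. -/
theorem recursion_real {u q t w : ℕ → ℝ} (hu : ∀ k, 0 ≤ u k) (hq : ∀ k, 0 ≤ q k)
    (ht : ∀ k, 0 ≤ t k) (hw : ∀ k, 0 ≤ w k) (hts : Summable t) (hqs : ¬ Summable q)
    (hrec : ∀ k, u (k + 1) ≤ (1 - q k) * u k + t k - w k) :
    Tendsto u atTop (𝓝 0) ∧ (∃ B, ∀ k, u k ≤ B) ∧ ∃ B, ∀ N, ∑ k ∈ Finset.range N, w k ≤ B := by
  have hsum : ∀ N, u N + ∑ k ∈ Finset.range N, q k * u k + ∑ k ∈ Finset.range N, w k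
      ≤ u 0 + ∑ k ∈ Finset.range N, t k := by
    intro N
    induction N with
    | zero => simp
    | succ N ih =>
      simp only [Finset.sum_range_succ]
      linarith [hrec N]
  have htN : ∀ N, ∑ k ∈ Finset.range N, t k ≤ ∑' k, t k := fun N =>
    hts.sum_le_tsum _ fun k _ => ht k
  have h1 : ∀ N, 0 ≤ ∑ k ∈ Finset.range N, q k * u k := fun N =>
    Finset.sum_nonneg fun k _ => mul_nonneg (hq k) (hu k)
  have h2 : ∀ N, 0 ≤ ∑ k ∈ Finset.range N, w k := fun N => Finset.sum_nonneg fun k _ => hw k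
  refine ⟨?_, ⟨u 0 + ∑' k, t k, fun k => by linarith [hsum k, htN k, h1 k, h2 k]⟩,
    ⟨u 0 + ∑' k, t k, fun N => by linarith [hsum N, htN N, h1 N, hu N]⟩⟩
  -- Removing the accumulated errors leaves an antitone sequence bounded below, so `u` converges.
  set S : ℕ → ℝ := fun k => u k - ∑ i ∈ Finset.range k, t i with hS
  have hanti : Antitone S := antitone_nat_of_succ_le fun k => by
    simp only [hS, Finset.sum_range_succ]
    linarith [hrec k, hw k, mul_nonneg (hq k) (hu k)]
  have hbdd : BddBelow (Set.range S) := ⟨-∑' k, t k, by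
    rintro _ ⟨k, rfl⟩
    simp only [hS]
    linarith [htN k, hu k]⟩
  have hlim := (tendsto_atTop_ciInf hanti hbdd).add hts.hasSum.tendsto_sum_nat
  simp only [hS, sub_add_cancel] at hlim
  set l := (⨅ i, (u i - ∑ j ∈ Finset.range i, t j)) + ∑' k, t k with hl
  have hl0 : 0 ≤ l := ge_of_tendsto' hlim hu
  rcases hl0.eq_or_lt with h0 | h0
  · rw [← h0] at hlim
    exact hlim
  -- If the limit `l` were positive, `u` would eventually exceed l/2, and the bound for ∑ q u would
  -- make `q` summable.
  · exfalso
    obtain ⟨k₀, hk₀⟩ := eventually_atTop.1 (hlim.eventually (lt_mem_nhds (half_lt_self h0)))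
    refine hqs ((summable_nat_add_iff k₀).1 ?_)
    refine summable_of_sum_range_le (c := (l / 2)⁻¹ * (u 0 + ∑' k, t k)) (fun k => hq _) fun N => ?_
    rw [inv_mul_eq_div, le_div_iff₀ (by positivity)]
    calc (∑ i ∈ Finset.range N, q (i + k₀)) * (l / 2)
        = ∑ i ∈ Finset.range N, q (i + k₀) * (l / 2) := Finset.sum_mul _ _ _
      _ ≤ ∑ i ∈ Finset.range N, q (i + k₀) * u (i + k₀) :=
          Finset.sum_le_sum fun i _ => mul_le_mul_of_nonneg_left (hk₀ _ (by omega)).le (hq _)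
      _ ≤ ∑ i ∈ Finset.range (k₀ + N), q i * u i := by
          rw [Finset.sum_range_add]
          simp_rw [add_comm k₀]
          linarith [h1 k₀]
      _ ≤ _ := by linarith [hsum (k₀ + N), htN (k₀ + N), hu (k₀ + N), h2 (k₀ + N)]

/-- Almost sure convergence for a nonnegative almost supermartingale. -/
theorem recursion_ae {Ω : Type*} {m0 : MeasurableSpace Ω} {μ : Measure Ω} [IsProbabilityMeasure μ]
    {ℱ : Filtration ℕ m0} {V D : ℕ → Ω → ℝ} {q t : ℕ → ℝ} {r : ℝ}
    (hVm : ∀ k, Measurable[ℱ k] (V k)) (hV0 : ∀ k o, 0 ≤ V k o) (hVi : ∀ k, Integrable (V k) μ)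
    (hD0 : ∀ k o, 0 ≤ D k o) (hr : 0 < r) (hq : ∀ k, 0 ≤ q k)
    (ht : ∀ k, 0 ≤ t k) (hts : Summable t) (hqs : ¬ Summable q)
    (hrec : ∀ k A, MeasurableSet[ℱ k] A → ∫ o in A, V (k + 1) o ∂μ
      ≤ (1 - q k) * ∫ o in A, V k o ∂μ + t k * μ.real A - r * ∫ o in A, D k o ∂μ) :
    (∀ᵐ o ∂μ, Tendsto (fun k => V k o) atTop (𝓝 0)) ∧ (∃ B, ∀ k, ∫ o, V k o ∂μ ≤ B) ∧
      ∃ B, ∀ N, ∑ k ∈ Finset.range N, ∫ o, D k o ∂μ ≤ B := by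
  have hVint0 : ∀ k, 0 ≤ ∫ o, V k o ∂μ := fun k => integral_nonneg (hV0 k)
  have hDint0 : ∀ k A, 0 ≤ ∫ o in A, D k o ∂μ := fun k A => integral_nonneg (hD0 k)
  obtain ⟨hlim, hB, B', hB'⟩ := recursion_real (u := fun k => ∫ o, V k o ∂μ)
    (w := fun k => r * ∫ o, D k o ∂μ) hVint0 hq ht
    (fun k => mul_nonneg hr.le (integral_nonneg (hD0 k))) hts hqs fun k => by
      have := hrec k Set.univ MeasurableSet.univ
      simpa using this
  refine ⟨?_, hB, r⁻¹ * B', fun N => ?_⟩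
  swap
  · have := hB' N
    rw [← Finset.mul_sum] at this
    rw [inv_mul_eq_div, le_div_iff₀ hr]
    linarith
  -- Adding the tail of ∑ t compensates the errors exactly and turns `V` into a supermartingale.
  set tl : ℕ → ℝ := fun k => ∑' i, t i - ∑ i ∈ Finset.range k, t i with htl
  have htl0 : ∀ k, 0 ≤ tl k := fun k => sub_nonneg.2 (hts.sum_le_tsum _ fun i _ => ht i)
  have htls : ∀ k, tl (k + 1) = tl k - t k := fun k => by
    simp only [htl, Finset.sum_range_succ]; ring
  have htl_lim : Tendsto tl atTop (𝓝 0) := by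
    have := hts.hasSum.tendsto_sum_nat.const_sub (∑' i, t i)
    rwa [sub_self] at this
  have hsuper : Supermartingale (fun k o => V k o + tl k) ℱ μ := by
    refine supermartingale_of_setIntegral_succ_le
      (fun k => ((hVm k).add measurable_const).stronglyMeasurable)
      (fun k => (hVi k).add (integrable_const _)) fun k A hA => ?_
    rw [integral_add (hVi _).integrableOn (integrable_const _),
      integral_add (hVi _).integrableOn (integrable_const _), setIntegral_const, setIntegral_const,
      htls, smul_eq_mul, smul_eq_mul]
    have h1 := hrec k A hA
    have h2 : 0 ≤ q k * ∫ o in A, V k o ∂μ := mul_nonneg (hq k) (integral_nonneg (hV0 k))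
    have h3 := mul_nonneg hr.le (hDint0 k A)
    linarith
  obtain ⟨B, hB⟩ := hB
  have hbdd : ∀ k, eLpNorm ((-fun k o => V k o + tl k) k) 1 μ
      ≤ ((B + tl 0).toNNReal : ENNReal) := by
    intro k
    have e1 : (-fun k o => V k o + tl k) k = -fun o => V k o + tl k := rfl
    have hanti : tl k ≤ tl 0 := antitone_nat_of_succ_le (fun k => by linarith [htls k, ht k])
      (Nat.zero_le k)
    have hi : Integrable (fun o => V k o + tl k) μ := (hVi k).add (integrable_const _)
    rw [e1, eLpNorm_neg, eLpNorm_one_eq_lintegral_enorm,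
      ← ofReal_integral_norm_eq_lintegral_enorm hi]
    refine ENNReal.ofReal_le_ofReal ?_
    calc _ = ∫ o, (V k o + tl k) ∂μ := integral_congr_ae (Eventually.of_forall fun o =>
          Real.norm_of_nonneg (add_nonneg (hV0 k o) (htl0 k)))
      _ = ∫ o, V k o ∂μ + tl k := by
          rw [integral_add (hVi k) (integrable_const _)]; simp
      _ ≤ _ := by linarith [hB k]
  have hconv := hsuper.neg.exists_ae_tendsto_of_bdd hbdd
  -- Supermartingale convergence does not identify the limit. Convergence of the expectations to 0
  -- does, through an almost surely convergent subsequence.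
  have hmeas : TendstoInMeasure μ V atTop (fun _ => (0 : ℝ)) := by
    refine tendstoInMeasure_of_tendsto_eLpNorm one_ne_zero
      (fun k => (hVi k).aestronglyMeasurable) aestronglyMeasurable_const ?_
    have e1 : ∀ k, eLpNorm (V k - fun _ => (0 : ℝ)) 1 μ = ENNReal.ofReal (∫ o, V k o ∂μ) := by
      intro k
      have : (V k - fun _ => (0 : ℝ)) = V k := by ext o; simp
      rw [this, eLpNorm_one_eq_lintegral_enorm, ← ofReal_integral_norm_eq_lintegral_enorm (hVi k)]
      congr 1
      exact integral_congr_ae (Eventually.of_forall fun o => Real.norm_of_nonneg (hV0 k o))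
    simp_rw [e1]
    simpa using ENNReal.tendsto_ofReal hlim
  obtain ⟨ns, hns, hae⟩ := hmeas.exists_seq_tendsto_ae
  filter_upwards [hconv, hae] with o ho ho'
  obtain ⟨l, hl⟩ := ho
  have hl1 : Tendsto (fun k => V k o) atTop (𝓝 (-l)) := by
    have := hl.neg.sub htl_lim
    simpa using this
  rwa [tendsto_nhds_unique (hl1.comp hns.tendsto_atTop) ho'] at hl1

/-! ### Tracking of the Tikhonov trajectory and almost sure convergence. -/

namespace Problem

variable {m : ℕ} {n : Fin m → ℕ} {Ξ I : Fin m → Type*} {P : Problem m n Ξ I}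
  [∀ j, MeasurableSpace (Ξ j)] [∀ j, MeasurableSpace (I j)]
  {Ω : Type*} [m0 : MeasurableSpace Ω] {μ : Measure Ω} [IsProbabilityMeasure μ]
  {v : Ω → ∀ j, Ξ j} {c : ℕ → Ω → ∀ j, I j} {s : ℕ → Ω → ∀ j, Ξ j}
  {α β ε : ℕ → Fin m → ℝ} {x0 : Whole n} {x y d : ℕ → Ω → Whole n}
  {p M₀ : ℝ} {a e b : Fin m → ℝ}

theorem mean_monotone (hF : P.OperatorAssumption μ v) (x y : Whole n) :
    0 ≤ inner ℝ (P.mean μ v x - P.mean μ v y) (x - y) := hF.monotone y x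

/-- The Tikhonov trajectory. -/
theorem exists_regularized_solutions (hP : P.ConstraintAssumption) (hF : P.OperatorAssumption μ v)
    (he : ∀ j, 0 < e j) :
    ∃ z : ℕ → Whole n, (∀ k, z k ∈ P.feasible) ∧
      (∀ k, ∀ w ∈ P.feasible,
        0 ≤ inner ℝ (P.mean μ v (z k) + decay (1 - p) k • scale e (z k)) (w - z k)) := by
  obtain ⟨z₀, hz₀, -⟩ := hF.consistent
  have hne : P.feasible.Nonempty := ⟨z₀, hz₀⟩
  obtain ⟨K, hK, hlip⟩ := exists_lipschitz_mean hF
  obtain ⟨l, hl, hl'⟩ := exists_pos_le_family he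
  obtain ⟨u, hu, hu'⟩ := exists_family_le e
  have key : ∀ k : ℕ, ∃ z ∈ P.feasible, ∀ w ∈ P.feasible,
      0 ≤ inner ℝ (P.mean μ v z + decay (1 - p) k • scale e z) (w - z) := by
    intro k
    have hη : 0 < decay (1 - p) k := decay_pos _ k
    refine exists_strongly_monotone_vi hne (isClosed_feasible hP) (convex_feasible hP)
      (fun x => P.mean μ v x + decay (1 - p) k • scale e x)
      (K := K + decay (1 - p) k * u) (σ := decay (1 - p) k * l) (by positivity) (by positivity)
      (fun x y => ?_) (fun x y => ?_)
    · have e1 : P.mean μ v x + decay (1 - p) k • scale e x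
          - (P.mean μ v y + decay (1 - p) k • scale e y)
          = (P.mean μ v x - P.mean μ v y) + decay (1 - p) k • scale e (x - y) := by
        rw [map_sub, smul_sub]; abel
      rw [e1, add_mul, mul_assoc]
      refine (norm_add_le _ _).trans (add_le_add (hlip x y) ?_)
      rw [norm_smul, Real.norm_of_nonneg hη.le]
      exact mul_le_mul_of_nonneg_left
        (norm_scale_le (fun j => by rw [abs_of_pos (he j)]; exact hu' j) _ hu.le) hη.le
    · have e1 : P.mean μ v x + decay (1 - p) k • scale e x
          - (P.mean μ v y + decay (1 - p) k • scale e y)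
          = (P.mean μ v x - P.mean μ v y) + decay (1 - p) k • scale e (x - y) := by
        rw [map_sub, smul_sub]; abel
      rw [e1, inner_add_left, real_inner_smul_left, mul_assoc]
      have h1 := mean_monotone hF x y
      have h2 := mul_le_mul_of_nonneg_left (le_inner_scale_self hl' (x - y)) hη.le
      linarith
  choose z hz hz' using key
  exact ⟨z, hz, hz'⟩

/-- The recursion for the distance to the Tikhonov trajectory. -/
theorem exists_tracking_recursion (hP : P.ConstraintAssumption)
    (hF : P.OperatorAssumption μ v) (hs : P.SamplingAssumption μ v c s)
    (ha : ∀ j, 0 < a j) (he : ∀ j, 0 < e j) (hp0 : 1 / 2 < p) (hp1 : p < 1)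
    (hM₀ : 0 < M₀) (hpar : ParameterBound p a e α ε M₀)
    (hb : ∀ j, b j ∈ Set.Ioo (0 : ℝ) 2) (hβ : ∀ k j, β k j = b j)
    (hx : P.IsRun α β ε x0 c s x y d) {z : ℕ → Whole n} (hz : ∀ k, z k ∈ P.feasible)
    (hvi : ∀ k, ∀ w ∈ P.feasible,
        0 ≤ inner ℝ (P.mean μ v (z k) + decay (1 - p) k • scale e (z k)) (w - z k))
    {R : ℝ} (hR : 0 < R) (hzR : ∀ k, ‖z k‖ ≤ R)
    (hsum : Summable fun k : ℕ => (k + 1 : ℝ) * ‖z (k + 1) - z k‖ ^ 2) :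
    ∃ (k₀ : ℕ) (r q : ℝ) (t : ℕ → ℝ), 0 < r ∧ 0 < q ∧ (∀ k, 0 ≤ t k) ∧ Summable t ∧
      ∀ k, k₀ ≤ k → ∀ A, MeasurableSet[history c s k] A →
        ∫ o in A, weightedSq a (x (k + 1) o - z (k + 1)) ∂μ
          ≤ (1 - q * decay 1 k) * ∫ o in A, weightedSq a (x k o - z k) ∂μ + t k * μ.real A
            - r * ∫ o in A, Metric.infDist (x k o) P.feasible ^ 2 ∂μ := by
  have hne : P.feasible.Nonempty := ⟨_, hz 0⟩
  obtain ⟨K, hK, hlip⟩ := exists_lipschitz_mean hF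
  obtain ⟨l, u, hl, hu, hw⟩ := exists_weightedSq_bounds (n := n) ha
  have hL := memLp_iterate hP hF hs ha hM₀ hpar hb hβ hx
  obtain ⟨M₁, r, hM₁, hr, hit⟩ :=
    exists_integrated_iteration_bound hP hF hs ha hM₀ hpar hb hβ hx
  obtain ⟨q, M, hq, hq1, hM, hdrift⟩ := exists_drift_bound hne (isClosed_feasible hP)
    (convex_feasible hP) (mean_monotone hF) hK hlip hp1.le ha he hM₀ hpar hM₁ hr hR
  -- As 2p > 1, the second-order terms are eventually dominated by the contraction of order 1/(k +
  -- 1).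
  have hev : ∀ᶠ k in atTop, 2 * M * decay p k ^ 2 ≤ q / 2 * decay 1 k := by
    have h1 : Tendsto (fun k => 2 * M * decay (2 * p - 1) k) atTop (𝓝 (2 * M * 0)) :=
      (tendsto_decay (by linarith)).const_mul _
    rw [mul_zero] at h1
    filter_upwards [h1.eventually (ge_mem_nhds (show (0 : ℝ) < q / 2 by positivity))] with k hk
    have e1 : decay p k ^ 2 = decay (2 * p - 1) k * decay 1 k := by
      rw [decay_sq, decay_mul]; congr 1; ring
    rw [e1, ← mul_assoc]
    exact mul_le_mul_of_nonneg_right hk (decay_pos 1 k).le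
  obtain ⟨k₁, hk₁⟩ := eventually_atTop.1 hev
  -- The index 1 is the first at which the iterates are known to lie in the hard sets.
  refine ⟨max 1 k₁, r / 2, q / 2,
    fun k => 2 * M * decay p k ^ 2 + 2 * u / q * ((k + 1 : ℝ) * ‖z (k + 1) - z k‖ ^ 2),
    by positivity, by positivity, fun k => by positivity, ?_, fun k hk A hA => ?_⟩
  · refine Summable.add ?_ (hsum.mul_left _)
    simp_rw [decay_sq]
    exact (summable_decay (by linarith)).mul_left _
  have hxz : ∀ k w, MemLp (fun o => x k o - w) 2 μ := fun k w => (hL k).sub (memLp_const w)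
  have hWi : ∀ k w, Integrable (fun o => weightedSq a (x k o - w)) μ := fun k w =>
    integrable_weightedSq (hxz k w)
  have hDi : Integrable (fun o => Metric.infDist (x k o) P.feasible ^ 2) μ :=
    integrable_infDist_sq hne (hL k)
  set θ2 := decay p k ^ 2 with hθ2
  set ι := decay 1 k with hι
  have hι0 : 0 < ι := decay_pos 1 k
  have hι1 : ι ≤ 1 := decay_le_one zero_le_one k
  have hθ20 : 0 ≤ θ2 := sq_nonneg _
  set V := ∫ o in A, weightedSq a (x k o - z k) ∂μ with hV
  set Dk := ∫ o in A, Metric.infDist (x k o) P.feasible ^ 2 ∂μ with hDk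
  have hV0 : 0 ≤ V := integral_nonneg fun o => weightedSq_nonneg ha _
  have hD0 : 0 ≤ Dk := integral_nonneg fun o => sq_nonneg _
  have hA0 : 0 ≤ μ.real A := measureReal_nonneg
  have h1 : ∫ o in A, weightedSq a (x (k + 1) o - z k) ∂μ
      ≤ (1 - 2 * (q * ι) + M * θ2) * V + M * θ2 * μ.real A - r / 2 * Dk := by
    have hi1 : Integrable (fun o => (1 - 2 * (q * ι) + M * θ2) * weightedSq a (x k o - z k)
        + M * θ2) μ := ((hWi k (z k)).const_mul _).add (integrable_const _)
    refine (hit (z k) (hz k) k ((le_max_left _ _).trans hk) A hA).trans ?_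
    calc _ ≤ ∫ o in A, ((1 - 2 * (q * ι) + M * θ2) * weightedSq a (x k o - z k) + M * θ2
          - r / 2 * Metric.infDist (x k o) P.feasible ^ 2) ∂μ := by
          refine setIntegral_mono (Integrable.integrableOn ?_)
            (hi1.sub (hDi.const_mul _)).integrableOn
            fun o => hdrift k (z k) (hz k) (hzR k) (hvi k) (x k o)
          have i5 : Integrable (fun o => 1 + ‖x k o‖ ^ 2) μ :=
            (integrable_const _).add ((hL k).integrable_norm_pow two_ne_zero)
          exact (setIntegral_lincomb (A := A) (hWi k (z k))
            (integrable_inner_of_memLp (memLp_mean hF (hL k)) (memLp_scale _ (hxz k (z k))))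
            (integrable_inner_of_memLp (memLp_scale _ (hL k)) (hxz k (z k))) i5 hDi _ _ _).1
      _ = _ := by
          rw [integral_sub hi1.integrableOn (hDi.const_mul _).integrableOn,
            integral_add ((hWi k (z k)).const_mul _).integrableOn (integrable_const _),
            setIntegral_const, integral_const_mul, integral_const_mul, smul_eq_mul]
          ring
  -- Young's inequality with parameter τ = q/(k + 1) spends part of the contraction 2τ; the factor 1
  -- + τ⁻¹ is of order k + 1, the weight with which the increments of `z` are summable.
  have h2 : ∫ o in A, weightedSq a (x (k + 1) o - z (k + 1)) ∂μ
      ≤ (1 + q * ι) * ∫ o in A, weightedSq a (x (k + 1) o - z k) ∂μ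
        + (1 + (q * ι)⁻¹) * weightedSq a (z k - z (k + 1)) * μ.real A := by
    have hi1 : Integrable (fun o => (1 + q * ι) * weightedSq a (x (k + 1) o - z k)) μ :=
      (hWi (k + 1) (z k)).const_mul _
    calc _ ≤ ∫ o in A, ((1 + q * ι) * weightedSq a (x (k + 1) o - z k)
          + (1 + (q * ι)⁻¹) * weightedSq a (z k - z (k + 1))) ∂μ := by
          refine setIntegral_mono (hWi _ _).integrableOn
            (hi1.add (integrable_const _)).integrableOn fun o => ?_
          have := weightedSq_add_le ha (x (k + 1) o - z k) (z k - z (k + 1))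
            (show 0 < q * ι by positivity)
          rwa [sub_add_sub_cancel] at this
      _ = _ := by
          rw [integral_add hi1.integrableOn (integrable_const _), integral_const_mul,
            setIntegral_const, smul_eq_mul]
          ring
  have h3 : (1 + (q * ι)⁻¹) * weightedSq a (z k - z (k + 1))
      ≤ 2 * u / q * ((k + 1 : ℝ) * ‖z (k + 1) - z k‖ ^ 2) := by
    have h4 := (hw (z k - z (k + 1))).2
    rw [norm_sub_rev] at h4
    have h5 : 1 + (q * ι)⁻¹ ≤ 2 * (q⁻¹ * (k + 1 : ℝ)) := by
      have h6 : (q * ι)⁻¹ = q⁻¹ * (k + 1 : ℝ) := by rw [mul_inv, hι, decay_one, inv_inv]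
      have h7 : 1 ≤ (q * ι)⁻¹ := by
        rw [one_le_inv₀ (by positivity)]
        exact mul_le_one₀ hq1 hι0.le hι1
      linarith
    calc _ ≤ 2 * (q⁻¹ * (k + 1 : ℝ)) * (u * ‖z (k + 1) - z k‖ ^ 2) :=
          mul_le_mul h5 h4 (weightedSq_nonneg ha _) (by positivity)
      _ = _ := by field_simp
  have hτ1 : q * ι ≤ 1 := mul_le_one₀ hq1 hι0.le hι1
  have hτ0 : 0 < q * ι := by positivity
  have h6 := hk₁ k ((le_max_right _ _).trans hk)
  set τ := q * ι with hτ
  have h7 := mul_le_mul_of_nonneg_left h1 (by positivity : 0 ≤ 1 + τ)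
  have h8 := mul_le_mul_of_nonneg_right h3 hA0
  -- (1 + τ)(1 - 2τ) ≤ 1 - τ, and the remaining term is at most 2Mθ² ≤ τ/2 by the choice of `k₁`.
  have h9 : (1 + τ) * (1 - 2 * τ + M * θ2) ≤ 1 - q / 2 * ι := by
    have : τ * (M * θ2) ≤ 1 * (M * θ2) := mul_le_mul_of_nonneg_right hτ1 (by positivity)
    have e1 : q / 2 * ι = τ / 2 := by rw [hτ]; ring
    rw [e1] at h6 ⊢
    nlinarith [sq_nonneg τ]
  have h10 := mul_le_mul_of_nonneg_right h9 hV0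
  have h11 : (1 + τ) * (M * θ2 * μ.real A) ≤ 2 * (M * θ2 * μ.real A) :=
    mul_le_mul_of_nonneg_right (by linarith) (by positivity)
  have h12 : 0 ≤ τ * (r / 2 * Dk) := by positivity
  linarith

theorem not_summable_decay_one (k₀ : ℕ) {q : ℝ} (hq : 0 < q) :
    ¬ Summable fun k => q * decay 1 (k + k₀) := by
  rw [summable_mul_left_iff hq.ne', summable_nat_add_iff (f := decay 1) k₀]
  intro h
  refine Real.not_summable_natCast_inv ((summable_nat_add_iff 1).1 (h.congr fun k => ?_))
  rw [decay_one]; push_cast; rfl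

/-- Almost sure convergence of the iterates to the solution of least weighted norm, boundedness
of the second moments, and summability of the expected squared distances to the feasible set. -/
theorem exists_limit (hP : P.ConstraintAssumption)
    (hF : P.OperatorAssumption μ v) (hs : P.SamplingAssumption μ v c s)
    (ha : ∀ j, 0 < a j) (he : ∀ j, 0 < e j) (hp0 : 1 / 2 < p) (hp1 : p < 1)
    (hM₀ : 0 < M₀) (hpar : ParameterBound p a e α ε M₀)
    (hb : ∀ j, b j ∈ Set.Ioo (0 : ℝ) 2) (hβ : ∀ k j, β k j = b j)
    (hx : P.IsRun α β ε x0 c s x y d) :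
    (∃ w ∈ solutionSet (P.mean μ v) P.feasible,
      (∀ q ∈ solutionSet (P.mean μ v) P.feasible,
        inner ℝ (scale e w) w ≤ inner ℝ (scale e q) q) ∧
      ∀ᵐ o ∂μ, Tendsto (fun k => x k o) atTop (𝓝 w)) ∧
    (∃ B, ∀ k, ∫ o, ‖x k o‖ ^ 2 ∂μ ≤ B) ∧
    ∃ B, ∀ N, ∑ k ∈ Finset.range N, ∫ o, Metric.infDist (x k o) P.feasible ^ 2 ∂μ ≤ B := by
  obtain ⟨z, hz, hvi⟩ := exists_regularized_solutions (p := p) hP hF he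
  have hne : P.feasible.Nonempty := ⟨_, hz 0⟩
  obtain ⟨K, hK, hlip⟩ := exists_lipschitz_mean hF
  obtain ⟨em, hem, hem'⟩ := exists_pos_le_family he
  have hcoer : ∀ x : Whole n, em * ‖x‖ ^ 2 ≤ inner ℝ (scale e x) x := le_inner_scale_self hem'
  have hsymm : ∀ x y : Whole n, inner ℝ (scale e x) y = inner ℝ x (scale e y) :=
    inner_scale_comm e
  have hη : ∀ k, 0 < decay (1 - p) k := decay_pos _
  have hanti : Antitone (decay (1 - p)) := antitone_decay (by linarith)
  have hsum := summable_tikhonov_increments (mean_monotone hF) hsymm hem hcoer hη hanti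
    (decay_ratio (by linarith)) hz hvi hF.consistent
  obtain ⟨w, hw, hzw, hwmin⟩ := exists_tendsto_tikhonov (mean_monotone hF) hsymm hem hcoer
    (continuous_of_norm_sub_le hK.le hlip) (isClosed_feasible hP) hη hanti
    (tendsto_decay (by linarith)) hz hvi hF.consistent
  obtain ⟨R, hR, hzR⟩ : ∃ R, 0 < R ∧ ∀ k, ‖z k‖ ≤ R := by
    obtain ⟨R, hR⟩ := (Metric.isBounded_range_of_tendsto z hzw).exists_norm_le
    exact ⟨max R 1, by positivity, fun k => (hR _ ⟨k, rfl⟩).trans (le_max_left _ _)⟩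
  have hL := memLp_iterate hP hF hs ha hM₀ hpar hb hβ hx
  have hm := measurable_iterate hP hF hne hx
  obtain ⟨l, u, hl, hu, hW⟩ := exists_weightedSq_bounds (n := n) ha
  obtain ⟨k₀, r, q, t, hr, hq, ht, hts, hrec⟩ := exists_tracking_recursion hP hF hs ha he hp0 hp1
    hM₀ hpar hb hβ hx hz hvi hR hzR hsum
  -- The recursion holds only from `k₀` on, so time is shifted; finitely many initial terms are
  -- restored in the bounds at the end.
  let ℱ : Filtration ℕ m0 :=
    { seq := fun k => history c s (k + k₀)
      mono' := fun i j hij => history_mono (by omega)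
      le' := fun k => history_le hs _ }
  have hVi : ∀ k, Integrable (fun o => weightedSq a (x k o - z k)) μ := fun k =>
    integrable_weightedSq ((hL k).sub (memLp_const (z k)))
  obtain ⟨hae, ⟨B₁, hB₁⟩, B₂, hB₂⟩ := recursion_ae (μ := μ) (ℱ := ℱ)
    (V := fun k o => weightedSq a (x (k + k₀) o - z (k + k₀)))
    (D := fun k o => Metric.infDist (x (k + k₀) o) P.feasible ^ 2)
    (q := fun k => q * decay 1 (k + k₀)) (t := fun k => t (k + k₀)) (r := r)
    (fun k => continuous_weightedSq.measurable.comp ((hm (k + k₀)).sub measurable_const))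
    (fun k o => weightedSq_nonneg ha _) (fun k => hVi _) (fun k o => sq_nonneg _) hr
    (fun k => mul_nonneg hq.le (decay_pos _ _).le) (fun k => ht _)
    ((summable_nat_add_iff k₀).2 hts) (not_summable_decay_one k₀ hq) (fun k A hA => by
      have := hrec (k + k₀) (Nat.le_add_left _ _) A hA
      rwa [show k + 1 + k₀ = k + k₀ + 1 by omega])
  refine ⟨⟨w, hw, hwmin, ?_⟩, ⟨(2 * l⁻¹ * B₁ + 2 * R ^ 2)
    + ∑ k ∈ Finset.range k₀, ∫ o, ‖x k o‖ ^ 2 ∂μ, fun k => ?_⟩,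
    B₂ + ∑ k ∈ Finset.range k₀, ∫ o, Metric.infDist (x k o) P.feasible ^ 2 ∂μ, fun N => ?_⟩
  · filter_upwards [hae] with o ho
    have h1 : Tendsto (fun k => weightedSq a (x k o - z k)) atTop (𝓝 0) :=
      (tendsto_add_atTop_iff_nat (f := fun k => weightedSq a (x k o - z k)) k₀).1 ho
    have h2 : Tendsto (fun k => ‖x k o - z k‖ ^ 2) atTop (𝓝 0) := by
      have h3 := h1.const_mul l⁻¹
      rw [mul_zero] at h3
      refine squeeze_zero (fun k => sq_nonneg _) (fun k => ?_) h3
      rw [inv_mul_eq_div, le_div_iff₀ hl, mul_comm]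
      exact (hW _).1
    have h3 : Tendsto (fun k => ‖x k o - z k‖) atTop (𝓝 0) := by
      have := h2.sqrt
      simpa [Real.sqrt_sq (norm_nonneg _)] using this
    have h4 := (tendsto_zero_iff_norm_tendsto_zero.2 h3).add hzw
    simpa using h4
  · have hsn : ∀ N, 0 ≤ ∑ k ∈ Finset.range N, ∫ o, ‖x k o‖ ^ 2 ∂μ := fun N =>
      Finset.sum_nonneg fun k _ => integral_nonneg fun o => sq_nonneg _
    have hB₁0 : 0 ≤ B₁ := (integral_nonneg fun o => weightedSq_nonneg ha _).trans (hB₁ 0)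
    rcases lt_or_ge k k₀ with hk | hk
    · have := Finset.single_le_sum (f := fun k => ∫ o, ‖x k o‖ ^ 2 ∂μ)
        (fun k _ => integral_nonneg fun o => sq_nonneg _) (Finset.mem_range.2 hk)
      have : 0 ≤ 2 * l⁻¹ * B₁ + 2 * R ^ 2 := by positivity
      linarith
    · obtain ⟨k', rfl⟩ := Nat.exists_eq_add_of_le' hk
      have h1 : ∫ o, ‖x (k' + k₀) o‖ ^ 2 ∂μ
          ≤ ∫ o, (2 * l⁻¹ * weightedSq a (x (k' + k₀) o - z (k' + k₀)) + 2 * R ^ 2) ∂μ := by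
        refine integral_mono ((hL _).integrable_norm_pow two_ne_zero)
          (((hVi _).const_mul _).add (integrable_const _)) fun o => ?_
        simp only
        have h2 := (hW (x (k' + k₀) o - z (k' + k₀))).1
        have h3 : ‖x (k' + k₀) o‖ ≤ ‖x (k' + k₀) o - z (k' + k₀)‖ + R := by
          have := norm_sub_norm_le (x (k' + k₀) o) (z (k' + k₀))
          linarith [hzR (k' + k₀)]
        have h4 := pow_le_pow_left₀ (norm_nonneg _) h3 2
        have h5 := mul_le_mul_of_nonneg_left h2 (by positivity : 0 ≤ 2 * l⁻¹)
        rw [mul_assoc 2, inv_mul_cancel_left₀ hl.ne'] at h5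
        nlinarith [sq_nonneg (‖x (k' + k₀) o - z (k' + k₀)‖ - R)]
      rw [integral_add ((hVi _).const_mul _) (integrable_const _), integral_const_mul] at h1
      have h2 := mul_le_mul_of_nonneg_left (hB₁ k') (by positivity : 0 ≤ 2 * l⁻¹)
      simp only [integral_const, probReal_univ, one_smul] at h1
      linarith [hsn k₀]
  · have h0 : ∀ k, 0 ≤ ∫ o, Metric.infDist (x k o) P.feasible ^ 2 ∂μ := fun k =>
      integral_nonneg fun o => sq_nonneg _
    calc _ ≤ ∑ k ∈ Finset.range (k₀ + N), ∫ o, Metric.infDist (x k o) P.feasible ^ 2 ∂μ :=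
          Finset.sum_le_sum_of_subset_of_nonneg (Finset.range_subset_range.2 (by omega)) fun k _ _ => h0 k
      _ ≤ _ := by
          rw [Finset.sum_range_add, add_comm]
          have := hB₂ N
          simp_rw [add_comm k₀]
          linarith

end Problem

/-! ### The dual gap function. -/

section DualGap

variable {H : Type*} [NormedAddCommGroup H] [InnerProductSpace ℝ H] {T : H → H} {X : Set H}

theorem dualGap_le {w : H} {q : ℝ} (h : ∀ y ∈ X, inner ℝ (T y) (w - y) ≤ q) :
    dualGap T X w ≤ (q : EReal) :=
  iSup₂_le fun y hy => EReal.coe_le_coe_iff.2 (h y hy)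

theorem dualGap_nonneg {w : H} (hw : w ∈ X) : 0 ≤ dualGap T X w := by
  have : ((inner ℝ (T w) (w - w) : ℝ) : EReal) ≤ dualGap T X w :=
    le_iSup₂ (f := fun y (_ : y ∈ X) => ((inner ℝ (T y) (w - y) : ℝ) : EReal)) w hw
  simpa using this

theorem dualGap_toReal_le {w : H} (hw : w ∈ X) {q : ℝ}
    (h : ∀ y ∈ X, inner ℝ (T y) (w - y) ≤ q) : (dualGap T X w).toReal ≤ q := by
  have h1 := dualGap_le h
  have h2 := dualGap_nonneg (T := T) hw
  have := EReal.toReal_le_toReal h1 (ne_of_gt (lt_of_lt_of_le EReal.bot_lt_zero h2))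
    (EReal.coe_ne_top q)
  simpa using this

/-- A possibly uncountable supremum of continuous functions is lower semicontinuous, hence Borel. -/
theorem measurable_dualGap [MeasurableSpace H] [BorelSpace H] : Measurable (dualGap T X) := by
  have : LowerSemicontinuous (dualGap T X) :=
    lowerSemicontinuous_biSup fun y _ => Continuous.lowerSemicontinuous
      (continuous_coe_real_ereal.comp (continuous_const.inner (continuous_id.sub continuous_const)))
  exact this.measurable

end DualGap

/-! ### The gap along a sample path and the accumulated noise. -/

namespace Problem

variable {m : ℕ} {n : Fin m → ℕ} {Ξ I : Fin m → Type*} {P : Problem m n Ξ I}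
  [∀ j, MeasurableSpace (Ξ j)] [∀ j, MeasurableSpace (I j)]
  {Ω : Type*} [m0 : MeasurableSpace Ω] {μ : Measure Ω} [IsProbabilityMeasure μ]
  {v : Ω → ∀ j, Ξ j} {c : ℕ → Ω → ∀ j, I j} {s : ℕ → Ω → ∀ j, Ξ j}
  {α β ε : ℕ → Fin m → ℝ} {x0 : Whole n} {x y d : ℕ → Ω → Whole n}
  {p M₀ : ℝ} {a e b : Fin m → ℝ}

set_option maxHeartbeats 600000 in
/-- One step of the estimate of the gap function, along every sample path. -/
theorem exists_gap_step (hP : P.ConstraintAssumption) (hF : P.OperatorAssumption μ v)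
    (ha : ∀ j, 0 < a j) (he : ∀ j, 0 < e j)
    (hM₀ : 0 < M₀) (hpar : ParameterBound p a e α ε M₀)
    (hb : ∀ j, b j ∈ Set.Ioo (0 : ℝ) 2) (hβ : ∀ k j, β k j = b j)
    (hx : P.IsRun α β ε x0 c s x y d) {R G : ℝ}
    (hXR : ∀ z ∈ P.feasible, ‖z‖ ≤ R) (hXG : ∀ z ∈ P.feasible, ‖P.mean μ v z‖ ≤ G) :
    ∃ C, 0 < C ∧ ∀ z ∈ P.feasible, ∀ k o,
      2 * (decay p k * inner ℝ (P.mean μ v z) (proj P.feasible (x k o) - z))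
        ≤ weightedSq a (x k o - z) - weightedSq a (x (k + 1) o - z)
          - 2 * (decay p k * inner ℝ (P.op (s k o) (x k o) - P.mean μ v (x k o)) (x k o))
          + 2 * (decay p k * inner ℝ (P.op (s k o) (x k o) - P.mean μ v (x k o)) z)
          + C * (decay p k ^ 2 * ‖P.op (s k o) (x k o)‖ ^ 2
            + (decay p k ^ 2 + decay 1 k) * (1 + ‖x k o‖ ^ 2)
            + Metric.infDist (x k o) P.feasible ^ 2) := by
  obtain ⟨z₀, hz₀, -⟩ := hF.consistent
  have hne : P.feasible.Nonempty := ⟨z₀, hz₀⟩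
  obtain ⟨M, r, hM, hr, h⟩ := exists_iteration_bound hP hne ha hM₀ hpar hb hβ hx
  obtain ⟨u, hu, hu'⟩ := exists_family_le e
  refine ⟨M₀ + M + (2 + 2 * R ^ 2) * M₀ + (3 + 2 * R ^ 2) * (u + M₀) + G ^ 2 + 1, by positivity,
    fun z hz k o => ?_⟩
  have hstep := (h z hz k o).1
  set θ := decay p k
  set ι := decay 1 k
  have hθ0 : 0 < θ := decay_pos p k
  have hι0 : 0 < ι := decay_pos 1 k
  set F := P.op (s k o) (x k o)
  set w := x k o
  set D := Metric.infDist w P.feasible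
  have hD0 : 0 ≤ D := Metric.infDist_nonneg
  have hq : ‖w - z‖ ^ 2 ≤ 2 * ‖w‖ ^ 2 + 2 * R ^ 2 := by
    have h1 : ‖w - z‖ ≤ ‖w‖ + R := (norm_sub_le _ _).trans (by linarith [hXR z hz])
    have h2 := pow_le_pow_left₀ (norm_nonneg _) h1 2
    linarith [sq_nonneg (‖w‖ - R)]
  have h1 : 2 * (θ * inner ℝ F (w - z)) - M₀ * θ ^ 2 * (‖F‖ ^ 2 + 2 * ‖w‖ ^ 2 + 2 * R ^ 2)
      ≤ 2 * inner ℝ F (scale (fun j => α k j / a j) (w - z)) := by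
    have h := abs_inner_scale_le (γ := fun j => α k j / a j - θ) (M := M₀ * θ ^ 2)
      (fun j => (hpar k j).2.2.2.2.1) (by positivity) (w - z) F
    rw [← scale_sub_apply, scale_const, inner_sub_left, real_inner_smul_left,
      real_inner_comm, real_inner_comm F] at h
    have h2 := (abs_le.1 h).1
    have h3 : 2 * (‖w - z‖ * ‖F‖) ≤ ‖F‖ ^ 2 + 2 * ‖w‖ ^ 2 + 2 * R ^ 2 := by
      linarith [sq_nonneg (‖w - z‖ - ‖F‖)]
    have h4 := mul_le_mul_of_nonneg_left h3 (by positivity : 0 ≤ M₀ * θ ^ 2)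
    linarith
  -- For the gap the regularization is only an error, of order 1/(k + 1); its sum is the source of
  -- the logarithm.
  have h2 : -((u * ι + M₀ * θ ^ 2) * (3 * ‖w‖ ^ 2 + 2 * R ^ 2))
      ≤ 2 * inner ℝ (scale (fun j => α k j / a j * ε k j) w) (w - z) := by
    have h := abs_inner_scale_le (γ := fun j => α k j / a j * ε k j) (M := u * ι + M₀ * θ ^ 2)
      (fun j => by
        have h1 := (hpar k j).2.2.2.2.2
        have h2 := abs_sub_abs_le_abs_sub (α k j / a j * ε k j) (e j * ι)
        have h3 : |e j * ι| ≤ u * ι := by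
          rw [abs_of_pos (mul_pos (he j) hι0)]
          exact mul_le_mul_of_nonneg_right (hu' j) hι0.le
        linarith) (by positivity) w (w - z)
    have h2 := (abs_le.1 h).1
    have h3 : 2 * (‖w‖ * ‖w - z‖) ≤ 3 * ‖w‖ ^ 2 + 2 * R ^ 2 := by
      linarith [sq_nonneg (‖w‖ - ‖w - z‖)]
    have h4 := mul_le_mul_of_nonneg_left h3 (by positivity : 0 ≤ u * ι + M₀ * θ ^ 2)
    linarith
  -- Monotonicity moves the operator from `w` to `z`, and replacing `w` by its projection costs at
  -- most `G * D`.
  have h3 : inner ℝ (P.mean μ v z) (proj P.feasible w - z) - G * D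
      ≤ inner ℝ (P.mean μ v w) (w - z) := by
    have h4 := mean_monotone hF w z
    have h5 := abs_real_inner_le_norm (P.mean μ v z) (w - proj P.feasible w)
    rw [← infDist_eq_norm_sub_proj hne (isClosed_feasible hP) (convex_feasible hP)] at h5
    have h6 := mul_le_mul_of_nonneg_right (hXG z hz) hD0
    have h7 := (abs_le.1 h5).1
    simp only [inner_sub_left, inner_sub_right] at *
    linarith
  have h4 := mul_le_mul_of_nonneg_left h3 hθ0.le
  have h5 : 2 * (θ * (G * D)) ≤ G ^ 2 * θ ^ 2 + D ^ 2 := by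
    linarith [sq_nonneg (G * θ - D)]
  -- The noise is split because its pairing with `w` has mean zero, whereas its pairing with `z` has
  -- to be bounded uniformly in `z` before taking expectations.
  have h6 : θ * inner ℝ F (w - z) = θ * inner ℝ (P.mean μ v w) (w - z)
      + θ * inner ℝ (F - P.mean μ v w) w - θ * inner ℝ (F - P.mean μ v w) z := by
    simp only [inner_sub_left, inner_sub_right]; ring
  set E := (θ ^ 2 + ι) * (1 + ‖w‖ ^ 2) with hE
  have hw0 := sq_nonneg ‖w‖
  have hθ2 := sq_nonneg θ
  have hpp := mul_nonneg hθ2 hw0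
  have hip := mul_nonneg hι0.le hw0
  have e1 : θ ^ 2 ≤ E := by rw [hE]; linarith
  have e2 : θ ^ 2 * ‖w‖ ^ 2 ≤ E := by rw [hE]; linarith
  have e3 : ι ≤ E := by rw [hE]; linarith
  have e4 : ι * ‖w‖ ^ 2 ≤ E := by rw [hE]; linarith
  have hR2 := sq_nonneg R
  have f1 : M₀ * θ ^ 2 * (‖F‖ ^ 2 + 2 * ‖w‖ ^ 2 + 2 * R ^ 2)
      ≤ M₀ * (θ ^ 2 * ‖F‖ ^ 2) + (2 + 2 * R ^ 2) * M₀ * E := by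
    have g1 := mul_le_mul_of_nonneg_left e2 (by positivity : 0 ≤ 2 * M₀)
    have g2 := mul_le_mul_of_nonneg_left e1 (by positivity : 0 ≤ 2 * R ^ 2 * M₀)
    linarith
  have f2 : (u * ι + M₀ * θ ^ 2) * (3 * ‖w‖ ^ 2 + 2 * R ^ 2) ≤ (3 + 2 * R ^ 2) * (u + M₀) * E := by
    have g1 := mul_le_mul_of_nonneg_left e2 (by positivity : 0 ≤ 3 * M₀)
    have g2 := mul_le_mul_of_nonneg_left e1 (by positivity : 0 ≤ 2 * R ^ 2 * M₀)
    have g3 := mul_le_mul_of_nonneg_left e4 (by positivity : 0 ≤ 3 * u)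
    have g4 := mul_le_mul_of_nonneg_left e3 (by positivity : 0 ≤ 2 * R ^ 2 * u)
    linarith
  have f3 : G ^ 2 * θ ^ 2 ≤ G ^ 2 * E := mul_le_mul_of_nonneg_left e1 (sq_nonneg G)
  have f4 : M * (θ ^ 2 * (‖F‖ ^ 2 + ‖w‖ ^ 2)) ≤ M * (θ ^ 2 * ‖F‖ ^ 2) + M * E := by
    have g1 := mul_le_mul_of_nonneg_left e2 hM.le
    linarith
  have hE0 : 0 ≤ E := by positivity
  have hF0 : 0 ≤ θ ^ 2 * ‖F‖ ^ 2 := by positivity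
  have c1 : 0 ≤ (2 + 2 * R ^ 2) * M₀ := by positivity
  have c2 : 0 ≤ (3 + 2 * R ^ 2) * (u + M₀) := by positivity
  have c3 : 0 ≤ G ^ 2 := sq_nonneg G
  have f5 : (M₀ + M) * (θ ^ 2 * ‖F‖ ^ 2)
      + ((2 + 2 * R ^ 2) * M₀ + (3 + 2 * R ^ 2) * (u + M₀) + G ^ 2 + M) * E + D ^ 2
      ≤ (M₀ + M + (2 + 2 * R ^ 2) * M₀ + (3 + 2 * R ^ 2) * (u + M₀) + G ^ 2 + 1)
        * (θ ^ 2 * ‖F‖ ^ 2 + E + D ^ 2) := by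
    set A₁ := (2 + 2 * R ^ 2) * M₀
    set A₂ := (3 + 2 * R ^ 2) * (u + M₀)
    have g1 : 0 ≤ (A₁ + A₂ + G ^ 2 + 1) * (θ ^ 2 * ‖F‖ ^ 2) := by positivity
    have g2 : 0 ≤ (M₀ + 1) * E := by positivity
    have g3 : 0 ≤ (M₀ + M + A₁ + A₂ + G ^ 2) * D ^ 2 := by positivity
    linarith
  set A₁ := (2 + 2 * R ^ 2) * M₀
  set A₂ := (3 + 2 * R ^ 2) * (u + M₀)
  linarith

/-- The accumulated sampling noise. -/
noncomputable def noise (P : Problem m n Ξ I) (μ : Measure Ω) (v : Ω → ∀ j, Ξ j)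
    (s : ℕ → Ω → ∀ j, Ξ j) (x : ℕ → Ω → Whole n) (p : ℝ) (N : ℕ) (o : Ω) : Whole n :=
  ∑ k ∈ Finset.range N, decay p k • (P.op (s k o) (x k o) - P.mean μ v (x k o))

theorem integral_inner_noise (hF : P.OperatorAssumption μ v) (hs : P.SamplingAssumption μ v c s)
    {k : ℕ} {X h : Ω → Whole n} (hX : Measurable[history c s k] X) (hX2 : MemLp X 2 μ)
    (hh : Measurable[history c s k] h) (hh2 : MemLp h 2 μ) :
    Integrable (fun o => (inner ℝ (P.op (s k o) (X o) - P.mean μ v (X o)) (h o) : ℝ)) μ ∧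
    ∫ o, inner ℝ (P.op (s k o) (X o) - P.mean μ v (X o)) (h o) ∂μ = 0 := by
  obtain ⟨M, -, hM⟩ := exists_op_moment_bound hF hs
  have h1 := (hM k X hX hX2).1
  have h2 := memLp_mean hF hX2
  have h3 := setIntegral_inner_op hF hs hX hX2 hh hh2 (A := Set.univ) MeasurableSet.univ
  simp only [Measure.restrict_univ] at h3
  refine ⟨integrable_inner_of_memLp (h1.sub h2) hh2, ?_⟩
  simp_rw [inner_sub_left]
  rw [integral_sub (integrable_inner_of_memLp h1 hh2) (integrable_inner_of_memLp h2 hh2), h3,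
    sub_self]

/-- The noise increments are orthogonal to everything known before, so the second moments of the
weighted increments add up, and the weights θ_k² are summable. This bounds the noise paired with all
feasible `z` at once. -/
theorem exists_noise_bound (hF : P.OperatorAssumption μ v) (hs : P.SamplingAssumption μ v c s)
    (hm : ∀ k, Measurable[history c s k] (x k)) (hL : ∀ k, MemLp (x k) 2 μ) {B : ℝ}
    (hB : ∀ k, ∫ o, ‖x k o‖ ^ 2 ∂μ ≤ B) (hp0 : 1 / 2 < p) :
    ∃ B', (∀ k, ∫ o, ‖P.op (s k o) (x k o)‖ ^ 2 ∂μ ≤ B') ∧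
      ∀ N, MemLp (noise P μ v s x p N) 2 μ ∧ ∫ o, ‖noise P μ v s x p N o‖ ^ 2 ∂μ ≤ B' := by
  obtain ⟨M, hM0, hM⟩ := exists_op_moment_bound hF hs
  obtain ⟨K, hK, hlip⟩ := exists_lipschitz_mean hF
  have hB0 : 0 ≤ B := (integral_nonneg fun o => sq_nonneg _).trans (hB 0)
  have hxi : ∀ k, Integrable (fun o => ‖x k o‖ ^ 2) μ := fun k =>
    (hL k).integrable_norm_pow two_ne_zero
  have hop := fun k => (hM k (x k) (hm k) (hL k)).1
  have hopi : ∀ k, Integrable (fun o => ‖P.op (s k o) (x k o)‖ ^ 2) μ := fun k =>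
    (hop k).integrable_norm_pow two_ne_zero
  have hop2 : ∀ k, ∫ o, ‖P.op (s k o) (x k o)‖ ^ 2 ∂μ ≤ M * (1 + B) := fun k => by
    have h1 := (hM k (x k) (hm k) (hL k)).2 Set.univ MeasurableSet.univ
    simp only [Measure.restrict_univ] at h1
    rw [integral_add (integrable_const _) (hxi k)] at h1
    simp only [integral_const, probReal_univ, one_smul] at h1
    exact h1.trans (mul_le_mul_of_nonneg_left (by linarith [hB k]) hM0.le)
  have hmean := fun k => memLp_mean hF (hL k)
  set W := 2 * (M * (1 + B)) + 2 * (2 * ‖P.mean μ v 0‖ ^ 2 + 2 * K ^ 2 * B) with hW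
  have hW0 : 0 ≤ W := by positivity
  have hw2 : ∀ k, ∫ o, ‖P.op (s k o) (x k o) - P.mean μ v (x k o)‖ ^ 2 ∂μ ≤ W := fun k => by
    have i1 : Integrable (fun o => 2 * ‖P.op (s k o) (x k o)‖ ^ 2
        + 2 * (2 * ‖P.mean μ v 0‖ ^ 2)) μ := ((hopi k).const_mul 2).add (integrable_const _)
    calc _ ≤ ∫ o, (2 * ‖P.op (s k o) (x k o)‖ ^ 2 + 2 * (2 * ‖P.mean μ v 0‖ ^ 2)
          + 2 * (2 * K ^ 2) * ‖x k o‖ ^ 2) ∂μ := by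
          refine integral_mono (((hop k).sub (hmean k)).integrable_norm_pow two_ne_zero)
            (i1.add ((hxi k).const_mul _)) fun o => ?_
          simp only
          have h1 := pow_le_pow_left₀ (norm_nonneg _)
            (norm_sub_le (P.op (s k o) (x k o)) (P.mean μ v (x k o))) 2
          have h2 : ‖P.mean μ v (x k o)‖ ≤ ‖P.mean μ v 0‖ + K * ‖x k o‖ := by
            have h3 := hlip (x k o) 0
            have h4 := norm_sub_norm_le (P.mean μ v (x k o)) (P.mean μ v 0)
            rw [sub_zero] at h3
            linarith
          have h3 := pow_le_pow_left₀ (norm_nonneg _) h2 2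
          linarith [sq_nonneg (‖P.op (s k o) (x k o)‖ - ‖P.mean μ v (x k o)‖),
            sq_nonneg (‖P.mean μ v 0‖ - K * ‖x k o‖)]
      _ = 2 * ∫ o, ‖P.op (s k o) (x k o)‖ ^ 2 ∂μ + 2 * (2 * ‖P.mean μ v 0‖ ^ 2)
          + 2 * (2 * K ^ 2) * ∫ o, ‖x k o‖ ^ 2 ∂μ := by
          rw [integral_add i1 ((hxi k).const_mul _),
            integral_add ((hopi k).const_mul 2) (integrable_const _), integral_const,
            integral_const_mul, integral_const_mul]
          simp
      _ ≤ W := by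
          have := mul_le_mul_of_nonneg_left (hB k) (by positivity : 0 ≤ 2 * (2 * K ^ 2))
          rw [hW]
          linarith [hop2 k]
  have hmm : ∀ N, Measurable[history c s N] (noise P μ v s x p N) := fun N => by
    have e1 : noise P μ v s x p N = fun o => ∑ k ∈ Finset.range N,
      decay p k • (P.op (s k o) (x k o) - P.mean μ v (x k o)) := rfl
    rw [e1]
    refine Finset.measurable_fun_sum _ fun k hk => ?_
    have hk' : k + 1 ≤ N := Finset.mem_range.1 hk
    have h1 : Measurable[history c s N] (x k) :=
      (hm k).mono (history_mono (k.le_succ.trans hk')) le_rfl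
    have h2 : Measurable[history c s N] (s k) :=
      (measurable_sample_history k).mono (history_mono hk') le_rfl
    have h3 : Measurable[history c s N] fun o => P.op (s k o) (x k o) :=
      (measurable_op hF).comp (h2.prodMk h1)
    have h4 : Measurable[history c s N] fun o => P.mean μ v (x k o) :=
      (continuous_of_norm_sub_le hK.le hlip).measurable.comp h1
    exact (h3.sub h4).const_smul (decay p k)
  have hrec : ∀ N, MemLp (noise P μ v s x p N) 2 μ ∧
      ∫ o, ‖noise P μ v s x p N o‖ ^ 2 ∂μ ≤ W * ∑ k ∈ Finset.range N, decay p k ^ 2 := by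
    intro N
    induction N with
    | zero =>
      have : noise P μ v s x p 0 = fun _ => 0 := by ext o; simp [noise]
      rw [this]
      exact ⟨memLp_const 0, by simp⟩
    | succ N ih =>
      obtain ⟨ih1, ih2⟩ := ih
      set w : Ω → Whole n := fun o => P.op (s N o) (x N o) - P.mean μ v (x N o) with hwd
      have e1 : noise P μ v s x p (N + 1) = fun o => noise P μ v s x p N o + decay p N • w o := by
        ext1 o; simp [noise, Finset.sum_range_succ, hwd]
      have hwL : MemLp w 2 μ := (hop N).sub (hmean N)
      have hin := integral_inner_noise hF hs (hm N) (hL N) (hmm N) ih1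
      have iS : Integrable (fun o => ‖noise P μ v s x p N o‖ ^ 2) μ :=
        ih1.integrable_norm_pow two_ne_zero
      have iw : Integrable (fun o => ‖w o‖ ^ 2) μ := hwL.integrable_norm_pow two_ne_zero
      rw [e1]
      have hwL' : MemLp (fun o => decay p N • w o) 2 μ := hwL.const_smul (decay p N)
      refine ⟨ih1.add hwL', ?_⟩
      -- The cross term integrates to zero by `hin`, since the noise up to `N` belongs to the
      -- history.
      have e2 : ∀ o, ‖noise P μ v s x p N o + decay p N • w o‖ ^ 2
          = ‖noise P μ v s x p N o‖ ^ 2 + 2 * decay p N * inner ℝ (w o) (noise P μ v s x p N o)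
            + decay p N ^ 2 * ‖w o‖ ^ 2 := fun o => by
        rw [@norm_add_sq_real, inner_smul_right, norm_smul, mul_pow, real_inner_comm,
          Real.norm_of_nonneg (decay_pos p N).le]
        ring
      simp_rw [e2]
      have i1 : Integrable (fun o => ‖noise P μ v s x p N o‖ ^ 2
          + 2 * decay p N * inner ℝ (w o) (noise P μ v s x p N o)) μ := iS.add (hin.1.const_mul _)
      rw [integral_add i1 (iw.const_mul _), integral_add iS (hin.1.const_mul _),
        integral_const_mul, integral_const_mul, hin.2, Finset.sum_range_succ]
      have := mul_le_mul_of_nonneg_left (hw2 N) (sq_nonneg (decay p N))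
      linarith
  have hsq : Summable fun k => decay p k ^ 2 := by
    simp_rw [decay_sq]; exact summable_decay (by linarith)
  refine ⟨M * (1 + B) + W * ∑' k, decay p k ^ 2, fun k => (hop2 k).trans ?_, fun N => ⟨(hrec N).1,
    (hrec N).2.trans ?_⟩⟩
  · have : 0 ≤ W * ∑' k, decay p k ^ 2 := mul_nonneg hW0 (tsum_nonneg fun k => sq_nonneg _)
    linarith
  · have h1 := mul_le_mul_of_nonneg_left
      (hsq.sum_le_tsum (Finset.range N) fun k _ => sq_nonneg (decay p k)) hW0
    have h2 : 0 ≤ M * (1 + B) := by positivity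
    linarith

end Problem

/-! ### Maximal stepsizes and equality of the regularization coefficients. -/

theorem abs_iSup_sub_iSup_le {m : ℕ} [Nonempty (Fin m)] {f g : Fin m → ℝ} {r : ℝ}
    (h : ∀ j, |f j - g j| ≤ r) : |(⨆ j, f j) - ⨆ j, g j| ≤ r := by
  have hf : BddAbove (Set.range f) := Set.finite_range f |>.bddAbove
  have hg : BddAbove (Set.range g) := Set.finite_range g |>.bddAbove
  have h1 : (⨆ j, f j) ≤ (⨆ j, g j) + r := ciSup_le fun j => by
    have := le_ciSup hg j
    linarith [(abs_le.1 (h j)).2]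
  have h2 : (⨆ j, g j) ≤ (⨆ j, f j) + r := ciSup_le fun j => by
    have := le_ciSup hf j
    linarith [(abs_le.1 (h j)).1]
  rw [abs_le]
  constructor <;> linarith

/-- The largest stepsize is, up to terms of higher order, a multiple of `(k + 1) ^ (-p)`. -/
theorem exists_iSup_stepsize_bound {m : ℕ} [Nonempty (Fin m)] {p M₀ : ℝ} {a e : Fin m → ℝ}
    {α ε : ℕ → Fin m → ℝ} (ha : ∀ j, 0 < a j) (hM₀ : 0 < M₀)
    (hpar : ParameterBound p a e α ε M₀) :
    ∃ A M, 0 < A ∧ 0 < M ∧ ∀ k, |(⨆ j, α k j) - A * decay p k| ≤ M * decay p k ^ 2 := by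
  obtain ⟨u, hu, hu'⟩ := exists_family_le a
  refine ⟨⨆ j, a j, u * M₀, ?_, by positivity, fun k => ?_⟩
  · exact (ha (Classical.arbitrary _)).trans_le
      (le_ciSup (Set.finite_range a).bddAbove (Classical.arbitrary _))
  · rw [Real.iSup_mul_of_nonneg (decay_pos p k).le]
    refine abs_iSup_sub_iSup_le fun j => ?_
    have h1 := (hpar k j).2.2.2.2.1
    have e1 : α k j - a j * decay p k = a j * (α k j / a j - decay p k) := by
      have := (ha j).ne'
      field_simp
    rw [e1, abs_mul, abs_of_pos (ha j), mul_assoc]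
    exact mul_le_mul (hu' j) h1 (abs_nonneg _) hu.le

/-- A single agent suffices, by k + C ≤ max(C, 1)(k + 1). It gives positivity of the weights and
growth of their sum, which the two-sided estimate does not give for small k. -/
theorem exists_decay_le_iSup {m : ℕ} [Nonempty (Fin m)] {p : ℝ} (hp : 0 ≤ p) {C a : Fin m → ℝ}
    (hC : ∀ j, 0 < C j) (ha : ∀ j, 0 < a j) {α : ℕ → Fin m → ℝ}
    (hα : ∀ k j, α k j = a j / ((k : ℝ) + C j) ^ p) :
    ∃ r, 0 < r ∧ ∀ k, r * decay p k ≤ ⨆ j, α k j := by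
  set j : Fin m := Classical.arbitrary _
  have haj := ha j
  have hCj := hC j
  refine ⟨a j * (max (C j) 1) ^ (-p), by positivity, fun k => ?_⟩
  refine le_trans ?_ (le_ciSup (Set.finite_range (α k)).bddAbove j)
  rw [hα, div_eq_mul_inv, ← Real.rpow_neg (by positivity), mul_assoc, decay,
    ← Real.mul_rpow (by positivity) (by positivity)]
  refine mul_le_mul_of_nonneg_left ?_ haj.le
  refine Real.rpow_le_rpow_of_nonpos (by positivity) ?_ (by linarith)
  have h1 := le_max_left (C j) 1
  have h2 := le_max_right (C j) 1
  nlinarith [Nat.cast_nonneg (α := ℝ) k]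

/-- If the ratio of the largest and the smallest regularization parameter is asymptotically at
most one, then all the coefficients are equal. -/
theorem coeff_eq_of_limsup_le {m : ℕ} {q : ℝ} (hq0 : 0 ≤ q) (hq1 : q ≤ 1) {D e : Fin m → ℝ}
    (hD : ∀ j, 0 < D j) (he : ∀ j, 0 < e j) {ε : ℕ → Fin m → ℝ}
    (hε : ∀ k j, ε k j = e j / ((k : ℝ) + D j) ^ q)
    (hlim : limsup (fun k => (((⨆ j, ε k j) / (⨅ j, ε k j) : ℝ) : EReal)) atTop ≤ 1)
    (i j : Fin m) : e i ≤ e j := by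
  have hpos : ∀ k j, 0 < ε k j := fun k j => by
    have := hD j; have := he j
    rw [hε]; positivity
  have hlim1 : ∀ j, Tendsto (fun k => ε k j / decay q k) atTop (𝓝 (e j)) := by
    intro j
    obtain ⟨M, hM, h⟩ := exists_abs_shift_sub_decay_le hq0 hq1 (hD j)
    rw [tendsto_iff_norm_sub_tendsto_zero]
    have h0 : Tendsto (fun k => e j * M * decay 1 k) atTop (𝓝 0) := by
      simpa using (tendsto_decay one_pos).const_mul (e j * M)
    refine squeeze_zero (fun _ => norm_nonneg _) (fun k => ?_) h0
    have hd := decay_pos q k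
    have e1 : ε k j / decay q k - e j
        = e j * (((k : ℝ) + D j) ^ (-q) - decay q k) / decay q k := by
      rw [hε, Real.rpow_neg (by have := hD j; positivity)]
      field_simp
    rw [e1, Real.norm_eq_abs, abs_div, abs_mul, abs_of_pos (he j), abs_of_pos hd, div_le_iff₀ hd]
    calc _ ≤ e j * (M * (decay q k * decay 1 k)) := mul_le_mul_of_nonneg_left (h k) (he j).le
      _ = _ := by ring
  -- Every ratio of two parameters converges to the ratio of the coefficients and is dominated by
  -- the ratio of maximum and minimum.
  have hlim2 : Tendsto (fun k => ((ε k i / ε k j : ℝ) : EReal)) atTop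
      (𝓝 ((e i / e j : ℝ) : EReal)) := by
    refine (continuous_coe_real_ereal.tendsto _).comp ?_
    refine ((hlim1 i).div (hlim1 j) (he j).ne').congr fun k => ?_
    exact div_div_div_cancel_right₀ (decay_pos q k).ne' _ _
  have hle : ∀ k, ((ε k i / ε k j : ℝ) : EReal)
      ≤ (((⨆ j, ε k j) / (⨅ j, ε k j) : ℝ) : EReal) := by
    intro k
    rw [EReal.coe_le_coe_iff]
    have h1 : ε k i ≤ ⨆ j, ε k j := le_ciSup (Set.finite_range _).bddAbove i
    have h2 : (⨅ j, ε k j) ≤ ε k j := ciInf_le (Set.finite_range _).bddBelow j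
    have h3 : 0 < ⨅ j, ε k j := by
      have : Nonempty (Fin m) := ⟨i⟩
      obtain ⟨l, hl⟩ := exists_eq_ciInf_of_finite (f := ε k)
      rw [← hl]; exact hpos k l
    exact div_le_div₀ ((hpos k i).le.trans h1) h1 h3 h2
  have h4 := (limsup_le_limsup (Eventually.of_forall hle)).trans hlim
  rw [hlim2.limsup_eq] at h4
  have h5 : e i / e j ≤ 1 := by exact_mod_cast h4
  rwa [div_le_one (he j)] at h5

/-! ### Rate of the expected dual gap. -/

namespace Problem

variable {m : ℕ} {n : Fin m → ℕ} {Ξ I : Fin m → Type*} {P : Problem m n Ξ I}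
  [∀ j, MeasurableSpace (Ξ j)] [∀ j, MeasurableSpace (I j)]
  {Ω : Type*} [m0 : MeasurableSpace Ω] {μ : Measure Ω} [IsProbabilityMeasure μ]
  {v : Ω → ∀ j, Ξ j} {c : ℕ → Ω → ∀ j, I j} {s : ℕ → Ω → ∀ j, Ξ j}
  {α β ε : ℕ → Fin m → ℝ} {x0 : Whole n} {x y d : ℕ → Ω → Whole n}
  {p M₀ : ℝ} {a e b : Fin m → ℝ}

/-- A bound for the weighted sums defining the gap, uniform over the feasible set. -/
theorem exists_gap_path_bound (hP : P.ConstraintAssumption)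
    (hF : P.OperatorAssumption μ v) (hs : P.SamplingAssumption μ v c s)
    (ha : ∀ j, 0 < a j) (he : ∀ j, 0 < e j) (hp0 : 1 / 2 < p) (hp1 : p < 1)
    (hM₀ : 0 < M₀) (hpar : ParameterBound p a e α ε M₀)
    (hb : ∀ j, b j ∈ Set.Ioo (0 : ℝ) 2) (hβ : ∀ k j, β k j = b j)
    (hx : P.IsRun α β ε x0 c s x y d) {R G : ℝ}
    (hXR : ∀ z ∈ P.feasible, ‖z‖ ≤ R) (hXG : ∀ z ∈ P.feasible, ‖P.mean μ v z‖ ≤ G) :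
    ∃ C, 0 < C ∧ ∀ N, ∃ Q : Ω → ℝ, Integrable Q μ ∧
      ∫ o, Q o ∂μ ≤ C * (1 + ∑ i ∈ Finset.range N, decay 1 i) ∧
      ∀ o, ∀ z ∈ P.feasible, ∑ i ∈ Finset.range N,
        decay p i * inner ℝ (P.mean μ v z) (proj P.feasible (x i o) - z) ≤ Q o := by
  obtain ⟨z₀, hz₀, -⟩ := hF.consistent
  have hne : P.feasible.Nonempty := ⟨z₀, hz₀⟩
  have hR : 0 ≤ R := (norm_nonneg _).trans (hXR _ hz₀)
  have hL := memLp_iterate hP hF hs ha hM₀ hpar hb hβ hx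
  have hm := measurable_iterate hP hF hne hx
  obtain ⟨-, ⟨B, hB⟩, B₂, hB₂⟩ := exists_limit hP hF hs ha he hp0 hp1 hM₀ hpar hb hβ hx
  obtain ⟨B', hopB, hnoise⟩ := exists_noise_bound hF hs hm hL hB hp0
  obtain ⟨C, hC, hstep⟩ := exists_gap_step hP hF ha he hM₀ hpar hb hβ hx hXR hXG
  obtain ⟨l, u, hl, hu, hW⟩ := exists_weightedSq_bounds (n := n) ha
  obtain ⟨Mop, -, hMop⟩ := exists_op_moment_bound hF hs
  have hB0 : 0 ≤ B := (integral_nonneg fun o => sq_nonneg _).trans (hB 0)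
  have hB'0 : 0 ≤ B' := (integral_nonneg fun o => sq_nonneg _).trans (hopB 0)
  have hB₂0 : 0 ≤ B₂ := by simpa using hB₂ 0
  have hsq : Summable fun k => decay p k ^ 2 := by
    simp_rw [decay_sq]; exact summable_decay (by linarith)
  set S := ∑' k, decay p k ^ 2 with hS
  have hS0 : 0 ≤ S := tsum_nonneg fun k => sq_nonneg _
  have hxi : ∀ k, Integrable (fun o => ‖x k o‖ ^ 2) μ := fun k =>
    (hL k).integrable_norm_pow two_ne_zero
  have hopi : ∀ k, Integrable (fun o => ‖P.op (s k o) (x k o)‖ ^ 2) μ := fun k =>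
    (hMop k (x k) (hm k) (hL k)).1.integrable_norm_pow two_ne_zero
  have hDi : ∀ k, Integrable (fun o => Metric.infDist (x k o) P.feasible ^ 2) μ := fun k =>
    integrable_infDist_sq hne (hL k)
  have hwx := fun k => integral_inner_noise hF hs (hm k) (hL k) (hm k) (hL k)
  set W₀ := u * (2 * ‖x0‖ ^ 2 + 2 * R ^ 2) with hW₀
  have hW₀0 : 0 ≤ W₀ := by positivity
  set q : ℕ → Ω → ℝ := fun k o => decay p k ^ 2 * ‖P.op (s k o) (x k o)‖ ^ 2
    + (decay p k ^ 2 + decay 1 k) * (1 + ‖x k o‖ ^ 2)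
    + Metric.infDist (x k o) P.feasible ^ 2 with hq
  have hx1 : ∀ k, Integrable (fun o => 1 + ‖x k o‖ ^ 2) μ := fun k =>
    (integrable_const _).add (hxi k)
  have hq12 : ∀ k, Integrable (fun o => decay p k ^ 2 * ‖P.op (s k o) (x k o)‖ ^ 2
    + (decay p k ^ 2 + decay 1 k) * (1 + ‖x k o‖ ^ 2)) μ := fun k =>
    ((hopi k).const_mul _).add ((hx1 k).const_mul _)
  have hqi : ∀ k, Integrable (q k) μ := fun k => (hq12 k).add (hDi k)
  have hqE : ∀ k, ∫ o, q k o ∂μ ≤ decay p k ^ 2 * (B' + 1 + B) + decay 1 k * (1 + B)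
      + ∫ o, Metric.infDist (x k o) P.feasible ^ 2 ∂μ := by
    intro k
    simp only [hq]
    rw [integral_add (hq12 k) (hDi k), integral_add ((hopi k).const_mul _) ((hx1 k).const_mul _),
      integral_const_mul, integral_const_mul, integral_add (integrable_const _) (hxi k)]
    simp only [integral_const, probReal_univ, one_smul]
    have h1 := mul_le_mul_of_nonneg_left (hopB k) (sq_nonneg (decay p k))
    have h2 := mul_le_mul_of_nonneg_left (hB k)
      (add_nonneg (sq_nonneg (decay p k)) (decay_pos 1 k).le)
    linarith
  -- All contributions that stay bounded in `N`; only the terms with weight 1/(k + 1) grow.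
  set C₁ := W₀ + R ^ 2 + B' + C * (S * (B' + 1 + B) + B₂) with hC₁
  have hC₁0 : 0 ≤ C₁ := by positivity
  refine ⟨C₁ + C * (1 + B), by positivity, fun N => ?_⟩
  set ψ : ℕ → Ω → ℝ := fun k o =>
    inner ℝ (P.op (s k o) (x k o) - P.mean μ v (x k o)) (x k o) with hψ
  have hψi : ∀ k, Integrable (ψ k) μ := fun k => (hwx k).1
  have hnoi : Integrable (fun o => ‖noise P μ v s x p N o‖ ^ 2) μ :=
    (hnoise N).1.integrable_norm_pow two_ne_zero
  have i1 : Integrable (fun o => ∑ k ∈ Finset.range N, decay p k * ψ k o) μ :=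
    integrable_finsetSum _ fun k _ => (hψi k).const_mul _
  have i2 : Integrable (fun o => ∑ k ∈ Finset.range N, q k o) μ :=
    integrable_finsetSum _ fun k _ => hqi k
  have i3 : Integrable (fun o => W₀ + R ^ 2 + ‖noise P μ v s x p N o‖ ^ 2) μ :=
    (integrable_const _).add hnoi
  have i4 : Integrable (fun o => W₀ + R ^ 2 + ‖noise P μ v s x p N o‖ ^ 2
    - 2 * ∑ k ∈ Finset.range N, decay p k * ψ k o) μ := i3.sub (i1.const_mul 2)
  have i5 : Integrable (fun o => W₀ + R ^ 2 + ‖noise P μ v s x p N o‖ ^ 2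
    - 2 * ∑ k ∈ Finset.range N, decay p k * ψ k o + C * ∑ k ∈ Finset.range N, q k o) μ :=
    i4.add (i2.const_mul C)
  refine ⟨fun o => 2⁻¹ * (W₀ + R ^ 2 + ‖noise P μ v s x p N o‖ ^ 2
    - 2 * ∑ k ∈ Finset.range N, decay p k * ψ k o + C * ∑ k ∈ Finset.range N, q k o),
    i5.const_mul _, ?_, fun o z hz => ?_⟩
  · rw [integral_const_mul, integral_add i4 (i2.const_mul C), integral_sub i3 (i1.const_mul 2),
      integral_add (integrable_const _) hnoi, integral_const_mul, integral_const_mul,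
      integral_finsetSum _ fun k _ => (hψi k).const_mul _, integral_finsetSum _ fun k _ => hqi k]
    have h0 : ∑ k ∈ Finset.range N, ∫ o, decay p k * ψ k o ∂μ = 0 :=
      Finset.sum_eq_zero fun k _ => by rw [integral_const_mul, (hwx k).2, mul_zero]
    rw [h0]
    simp only [integral_const, probReal_univ, one_smul]
    have h1 : ∑ k ∈ Finset.range N, ∫ o, q k o ∂μ
        ≤ S * (B' + 1 + B) + (∑ k ∈ Finset.range N, decay 1 k) * (1 + B) + B₂ := by
      calc _ ≤ ∑ k ∈ Finset.range N, (decay p k ^ 2 * (B' + 1 + B) + decay 1 k * (1 + B)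
            + ∫ o, Metric.infDist (x k o) P.feasible ^ 2 ∂μ) := Finset.sum_le_sum fun k _ => hqE k
        _ = (∑ k ∈ Finset.range N, decay p k ^ 2) * (B' + 1 + B)
            + (∑ k ∈ Finset.range N, decay 1 k) * (1 + B)
            + ∑ k ∈ Finset.range N, ∫ o, Metric.infDist (x k o) P.feasible ^ 2 ∂μ := by
            rw [Finset.sum_add_distrib, Finset.sum_add_distrib, Finset.sum_mul, Finset.sum_mul]
        _ ≤ _ := by
            have h2 := mul_le_mul_of_nonneg_right
              (hsq.sum_le_tsum (Finset.range N) fun k _ => sq_nonneg (decay p k))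
              (by positivity : 0 ≤ B' + 1 + B)
            linarith [hB₂ N]
    have h2 := mul_le_mul_of_nonneg_left h1 hC.le
    have h3 := (hnoise N).2
    have h4 : 0 ≤ ∑ k ∈ Finset.range N, decay 1 k :=
      Finset.sum_nonneg fun k _ => (decay_pos 1 k).le
    have h5 : 0 ≤ C₁ * ∑ k ∈ Finset.range N, decay 1 k := mul_nonneg hC₁0 h4
    have h6 : 0 ≤ C * (1 + B) * ∑ k ∈ Finset.range N, decay 1 k := mul_nonneg (by positivity) h4
    have h7 : 0 ≤ C * (1 + B) := by positivity
    linarith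
  · have h1 : ∑ k ∈ Finset.range N,
        2 * (decay p k * inner ℝ (P.mean μ v z) (proj P.feasible (x k o) - z))
        ≤ ∑ k ∈ Finset.range N, ((weightedSq a (x k o - z) - weightedSq a (x (k + 1) o - z))
          - 2 * (decay p k * ψ k o)
          + 2 * (decay p k * inner ℝ (P.op (s k o) (x k o) - P.mean μ v (x k o)) z)
          + C * q k o) := Finset.sum_le_sum fun k _ => hstep z hz k o
    have h2 : ∑ k ∈ Finset.range N,
        decay p k * inner ℝ (P.op (s k o) (x k o) - P.mean μ v (x k o)) z
        = inner ℝ (noise P μ v s x p N o) z := by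
      simp only [noise, sum_inner, real_inner_smul_left]
    simp only [Finset.sum_add_distrib, Finset.sum_sub_distrib, ← Finset.mul_sum] at h1
    rw [h2, ← Finset.sum_sub_distrib, Finset.sum_range_sub' (fun k => weightedSq a (x k o - z))] at h1
    have h3 : weightedSq a (x 0 o - z) ≤ W₀ := by
      refine (hW _).2.trans (mul_le_mul_of_nonneg_left ?_ hu.le)
      rw [hx.init]
      have h4 : ‖x0 - z‖ ≤ ‖x0‖ + R := (norm_sub_le _ _).trans (by linarith [hXR z hz])
      have h5 := pow_le_pow_left₀ (norm_nonneg _) h4 2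
      linarith [sq_nonneg (‖x0‖ - R)]
    have h4 := weightedSq_nonneg ha (x N o - z)
    -- This is where `z` disappears, so that one `Q` bounds the supremum over the feasible set.
    have h5 : 2 * inner ℝ (noise P μ v s x p N o) z ≤ R ^ 2 + ‖noise P μ v s x p N o‖ ^ 2 := by
      have h6 := real_inner_le_norm (noise P μ v s x p N o) z
      have h7 := mul_le_mul_of_nonneg_left (hXR z hz) (norm_nonneg (noise P μ v s x p N o))
      linarith [sq_nonneg (R - ‖noise P μ v s x p N o‖)]
    linarith

/-- Rate of the expected gap for a compact feasible set. -/
theorem exists_gap_rate (hm : 0 < m) (hP : P.ConstraintAssumption)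
    (hF : P.OperatorAssumption μ v) (hs : P.SamplingAssumption μ v c s)
    (he : ∀ j, 0 < e j) (hp0 : 1 / 2 < p) (hp1 : p < 1)
    (hM₀ : 0 < M₀) (hpar : ParameterBound p a e α ε M₀)
    (hb : ∀ j, b j ∈ Set.Ioo (0 : ℝ) 2) (hβ : ∀ k j, β k j = b j)
    (hx : P.IsRun α β ε x0 c s x y d) {C : Fin m → ℝ} (hC : ∀ j, 0 < C j) (ha : ∀ j, 0 < a j)
    (hα : ∀ k j, α k j = a j / ((k : ℝ) + C j) ^ p) (hcpt : IsCompact P.feasible) :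
    ∃ K, 0 < K ∧ ∀ k : ℕ,
      (∀ o, dualGap (P.mean μ v) P.feasible (P.feasibleErgodic α (fun i => x i o) k) ≠ ⊤) ∧
      Integrable (fun o => (dualGap (P.mean μ v) P.feasible
        (P.feasibleErgodic α (fun i => x i o) k)).toReal) μ ∧
      ∫ o, (dualGap (P.mean μ v) P.feasible
        (P.feasibleErgodic α (fun i => x i o) k)).toReal ∂μ
        ≤ K * ((1 + ∑ i ∈ Finset.range (k + 1), decay 1 i) / ((k : ℝ) + 1) ^ (1 - p)) := by
  have : Nonempty (Fin m) := ⟨⟨0, hm⟩⟩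
  obtain ⟨z₀, hz₀, -⟩ := hF.consistent
  have hne : P.feasible.Nonempty := ⟨z₀, hz₀⟩
  have hmx := measurable_iterate hP hF hne hx
  obtain ⟨K, hK, hlip⟩ := exists_lipschitz_mean hF
  have hTc := continuous_of_norm_sub_le hK.le hlip
  obtain ⟨R, hXR⟩ := hcpt.isBounded.exists_norm_le
  obtain ⟨G, hXG⟩ := (hcpt.image hTc).isBounded.exists_norm_le
  replace hXG : ∀ z ∈ P.feasible, ‖P.mean μ v z‖ ≤ G := fun z hz => hXG _ ⟨z, hz, rfl⟩
  have hR : 0 ≤ R := (norm_nonneg _).trans (hXR _ hz₀)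
  have hG : 0 ≤ G := (norm_nonneg _).trans (hXG _ hz₀)
  obtain ⟨A, M, hA, hM, hsup⟩ := exists_iSup_stepsize_bound ha hM₀ hpar
  obtain ⟨r, hr, hlow⟩ := exists_decay_le_iSup (by linarith) hC ha hα
  obtain ⟨Cq, hCq, hQ⟩ := exists_gap_path_bound hP hF hs ha he hp0 hp1 hM₀ hpar hb hβ hx hXR hXG
  have hsq : Summable fun k => decay p k ^ 2 := by
    simp_rw [decay_sq]; exact summable_decay (by linarith)
  set S := ∑' k, decay p k ^ 2 with hS
  have hS0 : 0 ≤ S := tsum_nonneg fun k => sq_nonneg _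
  have hgap : ∀ w ∈ P.feasible, ∀ z ∈ P.feasible,
      |inner ℝ (P.mean μ v z) (w - z)| ≤ G * (2 * R) := fun w hw z hz => by
    refine (abs_real_inner_le_norm _ _).trans (mul_le_mul (hXG z hz) ?_ (norm_nonneg _) hG)
    exact (norm_sub_le _ _).trans (by linarith [hXR w hw, hXR z hz])
  refine ⟨r⁻¹ * (A * Cq + M * S * (G * (2 * R))), by positivity, fun k => ?_⟩
  have hpm : ∀ w, proj P.feasible w ∈ P.feasible :=
    proj_mem hne (isClosed_feasible hP) (convex_feasible hP)
  set ᾱ : ℕ → ℝ := fun i => ⨆ j, α i j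
  have hᾱ : ∀ i, 0 < ᾱ i := fun i => (mul_pos hr (decay_pos p i)).trans_le (hlow i)
  set σ := ∑ i ∈ Finset.range (k + 1), ᾱ i with hσ
  have hσr : r * ((k : ℝ) + 1) ^ (1 - p) ≤ σ := by
    refine (mul_le_mul_of_nonneg_left (rpow_le_sum_decay (by linarith) k) hr.le).trans ?_
    rw [Finset.mul_sum]
    exact Finset.sum_le_sum fun i _ => hlow i
  have hk0 : 0 < ((k : ℝ) + 1) ^ (1 - p) := by positivity
  have hσ0 : 0 < σ := (mul_pos hr hk0).trans_le hσr
  have hErg : ∀ o, P.feasibleErgodic α (fun i => x i o) k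
      = ∑ i ∈ Finset.range (k + 1), (σ⁻¹ * ᾱ i) • proj P.feasible (x i o) := fun o => by
    simp only [feasibleErgodic, Finset.smul_sum, smul_smul]; rfl
  have hw1 : ∑ i ∈ Finset.range (k + 1), σ⁻¹ * ᾱ i = 1 := by
    rw [← Finset.mul_sum]; exact inv_mul_cancel₀ hσ0.ne'
  have hmem : ∀ o, P.feasibleErgodic α (fun i => x i o) k ∈ P.feasible := fun o => by
    rw [hErg]
    exact (convex_feasible hP).sum_mem (fun i _ => (mul_pos (inv_pos.2 hσ0) (hᾱ i)).le) hw1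
      fun i _ => hpm _
  have hmeas : Measurable fun o => P.feasibleErgodic α (fun i => x i o) k := by
    simp_rw [hErg]
    refine Finset.measurable_fun_sum _ fun i _ => Measurable.const_smul ?_ (σ⁻¹ * ᾱ i)
    exact (continuous_proj hne (isClosed_feasible hP) (convex_feasible hP)).measurable.comp
      ((hmx i).mono (history_le hs i) le_rfl)
  have hint : Integrable (fun o => (dualGap (P.mean μ v) P.feasible
      (P.feasibleErgodic α (fun i => x i o) k)).toReal) μ := by
    refine (integrable_const (G * (2 * R))).mono'
      (measurable_dualGap.comp hmeas).ereal_toReal.aestronglyMeasurable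
      (Eventually.of_forall fun o => ?_)
    rw [Real.norm_of_nonneg (EReal.toReal_nonneg (dualGap_nonneg (hmem o)))]
    exact dualGap_toReal_le (hmem o) fun z hz => (abs_le.1 (hgap _ (hmem o) z hz)).2
  refine ⟨fun o => ?_, hint, ?_⟩
  · exact ((dualGap_le (q := G * (2 * R)) fun z hz => (abs_le.1 (hgap _ (hmem o) z hz)).2).trans_lt
      (EReal.coe_lt_top _)).ne
  obtain ⟨Q, hQi, hQE, hQb⟩ := hQ (k + 1)
  have hpt : ∀ o, (dualGap (P.mean μ v) P.feasible
      (P.feasibleErgodic α (fun i => x i o) k)).toReal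
      ≤ σ⁻¹ * (A * Q o + M * S * (G * (2 * R))) := by
    intro o
    refine dualGap_toReal_le (hmem o) fun z hz => ?_
    set g : ℕ → ℝ := fun i => inner ℝ (P.mean μ v z) (proj P.feasible (x i o) - z) with hg
    have e1 : inner ℝ (P.mean μ v z) (P.feasibleErgodic α (fun i => x i o) k - z)
        = σ⁻¹ * ∑ i ∈ Finset.range (k + 1), ᾱ i * g i := by
      have e2 : P.feasibleErgodic α (fun i => x i o) k - z
          = ∑ i ∈ Finset.range (k + 1), (σ⁻¹ * ᾱ i) • (proj P.feasible (x i o) - z) := by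
        simp only [smul_sub, Finset.sum_sub_distrib]
        rw [← hErg, ← Finset.sum_smul, hw1, one_smul]
      rw [e2, inner_sum, Finset.mul_sum]
      refine Finset.sum_congr rfl fun i _ => ?_
      rw [real_inner_smul_right, mul_assoc]
    rw [e1]
    refine mul_le_mul_of_nonneg_left ?_ (inv_pos.2 hσ0).le
    -- The weights of the average are A θ_i up to a summable error, and the error is multiplied by
    -- `g`, which is bounded on a compact feasible set.
    calc _ = A * ∑ i ∈ Finset.range (k + 1), decay p i * g i
          + ∑ i ∈ Finset.range (k + 1), (ᾱ i - A * decay p i) * g i := by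
          rw [Finset.mul_sum, ← Finset.sum_add_distrib]
          exact Finset.sum_congr rfl fun i _ => by ring
      _ ≤ A * Q o + ∑ i ∈ Finset.range (k + 1), M * decay p i ^ 2 * (G * (2 * R)) := by
          refine add_le_add (mul_le_mul_of_nonneg_left (hQb o z hz) hA.le)
            (Finset.sum_le_sum fun i _ => ?_)
          refine (le_abs_self _).trans ?_
          rw [abs_mul]
          exact mul_le_mul (hsup i) (hgap _ (hpm _) z hz) (abs_nonneg _) (by positivity)
      _ ≤ _ := by
          rw [← Finset.sum_mul, ← Finset.mul_sum]
          have := hsq.sum_le_tsum (Finset.range (k + 1)) fun k _ => sq_nonneg (decay p k)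
          gcongr
  set L := 1 + ∑ i ∈ Finset.range (k + 1), decay 1 i with hL
  have hL1 : 1 ≤ L := by
    have : 0 ≤ ∑ i ∈ Finset.range (k + 1), decay 1 i :=
      Finset.sum_nonneg fun i _ => (decay_pos 1 i).le
    linarith
  calc _ ≤ ∫ o, σ⁻¹ * (A * Q o + M * S * (G * (2 * R))) ∂μ :=
        integral_mono hint (((hQi.const_mul A).add (integrable_const _)).const_mul _) hpt
    _ = σ⁻¹ * (A * ∫ o, Q o ∂μ + M * S * (G * (2 * R))) := by
        rw [integral_const_mul, integral_add (hQi.const_mul A) (integrable_const _),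
          integral_const_mul]
        simp
    _ ≤ (r * ((k : ℝ) + 1) ^ (1 - p))⁻¹ * ((A * Cq + M * S * (G * (2 * R))) * L) := by
        have h1 := mul_le_mul_of_nonneg_left hQE hA.le
        have h2 : M * S * (G * (2 * R)) ≤ M * S * (G * (2 * R)) * L :=
          le_mul_of_one_le_right (by positivity) hL1
        have h3 : A * ∫ o, Q o ∂μ + M * S * (G * (2 * R))
            ≤ (A * Cq + M * S * (G * (2 * R))) * L := by linarith
        have h4 : σ⁻¹ ≤ (r * ((k : ℝ) + 1) ^ (1 - p))⁻¹ := inv_anti₀ (by positivity) hσr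
        exact (mul_le_mul_of_nonneg_left h3 (inv_pos.2 hσ0).le).trans
          (mul_le_mul_of_nonneg_right h4 (by positivity))
    _ = _ := by
        rw [mul_inv]
        field_simp

end Problem

/-- The harmonic sum is at most 1 + log(k + 1), and k ≥ 2 gives k + 1 ≤ k² and 2 ≤ (2 / log 2) log
k, whence the constant. -/
theorem one_add_sum_decay_div_le {δ : ℝ} (hδ : δ < 1 / 2) {k : ℕ} (hk : 2 ≤ k) :
    (1 + ∑ i ∈ Finset.range (k + 1), decay 1 i) / ((k : ℝ) + 1) ^ (1 - (1 / 2 + δ))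
      ≤ (2 / Real.log 2 + 2) * ((k : ℝ) ^ δ * Real.log k / √(k : ℝ)) := by
  have hk2 : (2 : ℝ) ≤ k := by exact_mod_cast hk
  have hk0 : (0 : ℝ) < k := by linarith
  have hlog2 : 0 < Real.log 2 := Real.log_pos (by norm_num)
  have hlog : Real.log 2 ≤ Real.log k := Real.log_le_log (by norm_num) hk2
  have h1 : ∑ i ∈ Finset.range (k + 1), decay 1 i ≤ 1 + Real.log ((k : ℝ) + 1) := by
    have := harmonic_le_one_add_log (k + 1)
    rw [harmonic] at this
    push_cast at this
    simp_rw [decay_one]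
    exact this
  have h2 : Real.log ((k : ℝ) + 1) ≤ 2 * Real.log k := by
    have e1 : 2 * Real.log k = Real.log ((k : ℝ) ^ 2) := by rw [Real.log_pow]; norm_num
    rw [e1]
    exact Real.log_le_log (by linarith) (by nlinarith)
  have h3 : (2 : ℝ) ≤ 2 / Real.log 2 * Real.log k := by
    rw [div_mul_eq_mul_div, le_div_iff₀ hlog2]
    linarith
  have h4 : (k : ℝ) ^ (1 - (1 / 2 + δ)) ≤ ((k : ℝ) + 1) ^ (1 - (1 / 2 + δ)) :=
    Real.rpow_le_rpow hk0.le (by linarith) (by linarith)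
  have h5 : (k : ℝ) ^ δ / √(k : ℝ) = ((k : ℝ) ^ (1 - (1 / 2 + δ)))⁻¹ := by
    rw [Real.sqrt_eq_rpow, ← Real.rpow_sub hk0, ← Real.rpow_neg hk0.le]
    congr 1; ring
  have h6 : 0 < (k : ℝ) ^ (1 - (1 / 2 + δ)) := Real.rpow_pos_of_pos hk0 _
  calc _ ≤ ((2 / Real.log 2 + 2) * Real.log k) / (k : ℝ) ^ (1 - (1 / 2 + δ)) :=
        div_le_div₀ (by have := hlog2.trans_le hlog; positivity) (by linarith) h6 h4
    _ = (2 / Real.log 2 + 2) * Real.log k * ((k : ℝ) ^ δ / √(k : ℝ)) := by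
        rw [h5, div_eq_mul_inv]
    _ = _ := by ring

/-! ### Feasibility of the ergodic average. -/

namespace Problem

variable {m : ℕ} {n : Fin m → ℕ} {Ξ I : Fin m → Type*} {P : Problem m n Ξ I}
  [∀ j, MeasurableSpace (Ξ j)] [∀ j, MeasurableSpace (I j)]
  {Ω : Type*} [MeasurableSpace Ω] {μ : Measure Ω}

/-- With constant relaxation parameters the ergodic average is the arithmetic mean. -/
theorem ergodic_eq (hm : 0 < m) {β : ℕ → Fin m → ℝ} {b : Fin m → ℝ}
    (hb : ∀ j, b j ∈ Set.Ioo (0 : ℝ) 2) (hβ : ∀ k j, β k j = b j) (x : ℕ → Whole n) (k : ℕ) :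
    ergodic β x k = ∑ i ∈ Finset.range (k + 1), ((k : ℝ) + 1)⁻¹ • x i := by
  have : Nonempty (Fin m) := ⟨⟨0, hm⟩⟩
  have hβ' : ∀ k, β k = b := fun k => funext (hβ k)
  obtain ⟨i, hi⟩ := exists_eq_ciInf_of_finite (f := b)
  obtain ⟨j, hj⟩ := exists_eq_ciSup_of_finite (f := b)
  have hpos : 0 < (⨅ j, b j) * (2 - ⨆ j, b j) := by
    rw [← hi, ← hj]
    exact mul_pos (hb i).1 (by linarith [(hb j).2])
  simp only [ergodic, hβ', Finset.sum_const, Finset.card_range, nsmul_eq_mul, Finset.smul_sum,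
    smul_smul]
  refine Finset.sum_congr rfl fun _ _ => ?_
  congr 1
  push_cast
  field_simp
  exact div_self hpos.ne'

/-- Rate of the expected squared distance of the ergodic average to the feasible set. -/
theorem exists_feasibility_rate (hm : 0 < m) (hP : P.ConstraintAssumption)
    (hne : P.feasible.Nonempty) {β : ℕ → Fin m → ℝ} {b : Fin m → ℝ}
    (hb : ∀ j, b j ∈ Set.Ioo (0 : ℝ) 2) (hβ : ∀ k j, β k j = b j) {x : ℕ → Ω → Whole n}
    [IsProbabilityMeasure μ] (hL : ∀ k, MemLp (x k) 2 μ) {B : ℝ}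
    (hB : ∀ N, ∑ k ∈ Finset.range N, ∫ o, Metric.infDist (x k o) P.feasible ^ 2 ∂μ ≤ B) :
    ∃ K : ℝ, ∀ k : ℕ, 1 ≤ k →
      Integrable (fun o => Metric.infDist (ergodic β (fun i => x i o) k) P.feasible ^ 2) μ ∧
      ∫ o, Metric.infDist (ergodic β (fun i => x i o) k) P.feasible ^ 2 ∂μ
        ≤ K * (1 / (k : ℝ)) := by
  have hB0 : 0 ≤ B := by simpa using hB 0
  refine ⟨B, fun k hk => ?_⟩
  have hk0 : (0 : ℝ) < k := by exact_mod_cast hk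
  simp_rw [ergodic_eq hm hb hβ]
  have hmem : MemLp (fun o => ∑ i ∈ Finset.range (k + 1), ((k : ℝ) + 1)⁻¹ • x i o) 2 μ :=
    memLp_finsetSum _ fun i _ => (hL i).const_smul ((k : ℝ) + 1)⁻¹
  have hint := integrable_infDist_sq hne hmem
  have hi : ∀ i, Integrable (fun o => Metric.infDist (x i o) P.feasible ^ 2) μ := fun i =>
    integrable_infDist_sq hne (hL i)
  refine ⟨hint, ?_⟩
  calc _ ≤ ∫ o, ∑ i ∈ Finset.range (k + 1),
        ((k : ℝ) + 1)⁻¹ * Metric.infDist (x i o) P.feasible ^ 2 ∂μ := by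
        refine integral_mono hint (integrable_finsetSum _ fun i _ => (hi i).const_mul _) fun o => ?_
        refine infDist_sum_sq_le hne (isClosed_feasible hP) (convex_feasible hP) _
          (fun _ => ((k : ℝ) + 1)⁻¹) (fun _ _ => by positivity) ?_ _
        rw [Finset.sum_const, Finset.card_range, nsmul_eq_mul]
        push_cast
        exact mul_inv_cancel₀ (by positivity)
    _ = ((k : ℝ) + 1)⁻¹ * ∑ i ∈ Finset.range (k + 1),
        ∫ o, Metric.infDist (x i o) P.feasible ^ 2 ∂μ := by
        rw [integral_finsetSum _ fun i _ => (hi i).const_mul _, Finset.mul_sum]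
        simp_rw [integral_const_mul]
    _ ≤ ((k : ℝ))⁻¹ * B := by
        refine mul_le_mul (inv_anti₀ hk0 (by linarith)) (hB _)
          (Finset.sum_nonneg fun i _ => integral_nonneg fun o => sq_nonneg _) (by positivity)
    _ = _ := by rw [one_div, mul_comm]

end Problem

end IncrementalProjection

/-! ### Assembly of the four conclusions. -/

theorem mainTheorem11 {m : ℕ} (hm : 0 < m) {n : Fin m → ℕ} {Ξ I : Fin m → Type*}
    [∀ j, MeasurableSpace (Ξ j)] [∀ j, MeasurableSpace (I j)]
    {Ω : Type*} [MeasurableSpace Ω] (μ : Measure Ω) [IsProbabilityMeasure μ]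
    (P : IncrementalProjection.Problem m n Ξ I)
    (v : Ω → ∀ j, Ξ j) (c : ℕ → Ω → ∀ j, I j) (s : ℕ → Ω → ∀ j, Ξ j)
    (hP : P.ConstraintAssumption) (hF : P.OperatorAssumption μ v)
    (hs : P.SamplingAssumption μ v c s)
    (δ : ℝ) (hδ0 : 0 < δ) (hδ1 : δ < 1 / 2)
    (C D a e b : Fin m → ℝ) (hC : ∀ j, 0 < C j) (hD : ∀ j, 0 < D j)
    (ha : ∀ j, 0 < a j) (he : ∀ j, 0 < e j) (hb : ∀ j, b j ∈ Set.Ioo (0 : ℝ) 2)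
    (α β ε : ℕ → Fin m → ℝ)
    (hα : ∀ k j, α k j = a j / ((k : ℝ) + C j) ^ (1 / 2 + δ))
    (hε : ∀ k j, ε k j = e j / ((k : ℝ) + D j) ^ (1 / 2 - δ))
    (hβ : ∀ k j, β k j = b j)
    (x0 : IncrementalProjection.Whole n) (x y d : ℕ → Ω → IncrementalProjection.Whole n)
    (hx : P.IsRun α β ε x0 c s x y d) :
    -- almost surely the iterates are bounded and their cluster points are solutions
    (∀ᵐ o ∂μ, (∃ R : ℝ, ∀ k, ‖x k o‖ ≤ R) ∧
      ∀ z, MapClusterPt z atTop (fun k => x k o) →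
        z ∈ IncrementalProjection.solutionSet (P.mean μ v) P.feasible) ∧
    -- almost sure convergence to the least-norm solution
    (limsup (fun k => (((⨆ j, ε k j) / (⨅ j, ε k j) : ℝ) : EReal)) atTop ≤ 1 →
      ∃ p ∈ IncrementalProjection.solutionSet (P.mean μ v) P.feasible,
        (∀ q ∈ IncrementalProjection.solutionSet (P.mean μ v) P.feasible, ‖p‖ ≤ ‖q‖) ∧
        ∀ᵐ o ∂μ, Tendsto (fun k => x k o) atTop (𝓝 p)) ∧
    -- feasibility rate
    (∃ K : ℝ, ∀ k : ℕ, 1 ≤ k →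
      Integrable (fun o => Metric.infDist
        (IncrementalProjection.Problem.ergodic β (fun i => x i o) k) P.feasible ^ 2) μ ∧
      ∫ o, Metric.infDist
        (IncrementalProjection.Problem.ergodic β (fun i => x i o) k) P.feasible ^ 2 ∂μ
        ≤ K * (1 / (k : ℝ))) ∧
    -- solvability rate for a compact feasible set
    (IsCompact P.feasible → ∃ K : ℝ, ∀ k : ℕ, 2 ≤ k →
      (∀ o, IncrementalProjection.dualGap (P.mean μ v) P.feasible
        (P.feasibleErgodic α (fun i => x i o) k) ≠ ⊤) ∧
      Integrable (fun o => (IncrementalProjection.dualGap (P.mean μ v) P.feasible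
        (P.feasibleErgodic α (fun i => x i o) k)).toReal) μ ∧
      ∫ o, (IncrementalProjection.dualGap (P.mean μ v) P.feasible
        (P.feasibleErgodic α (fun i => x i o) k)).toReal ∂μ
        ≤ K * ((k : ℝ) ^ δ * Real.log k / √(k : ℝ))) := by
  have hp : 1 - (1 / 2 + δ) = 1 / 2 - δ := by ring
  obtain ⟨M₀, hM₀, hpar⟩ := IncrementalProjection.exists_parameter_bound (p := 1 / 2 + δ)
    (by linarith) (by linarith) hC hD ha he hα (by rw [hp]; exact hε)
  have hpar' : IncrementalProjection.ParameterBound (1 / 2 + δ) a e α ε M₀ := hpar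
  obtain ⟨⟨w, hw, hwmin, hlim⟩, -, B, hB⟩ := IncrementalProjection.Problem.exists_limit hP hF hs ha
    he (by linarith) (by linarith) hM₀ hpar' hb hβ hx
  have hne : P.feasible.Nonempty := ⟨w, hw.1⟩
  refine ⟨?_, fun hle => ⟨w, hw, fun q hq => ?_, hlim⟩,
    IncrementalProjection.Problem.exists_feasibility_rate hm hP hne hb hβ
      (IncrementalProjection.Problem.memLp_iterate hP hF hs ha hM₀ hpar' hb hβ hx) hB,
    fun hcpt => ?_⟩
  · filter_upwards [hlim] with o ho
    refine ⟨?_, fun z hz => ?_⟩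
    · obtain ⟨R, hR⟩ := (Metric.isBounded_range_of_tendsto _ ho).exists_norm_le
      exact ⟨R, fun k => hR _ ⟨k, rfl⟩⟩
    -- The whole sequence converges to `w`, so a cluster point cannot be separated from `w`.
    · have : (𝓝 z ⊓ 𝓝 w).NeBot := NeBot.mono hz (inf_le_inf_left _ ho)
      rwa [eq_of_nhds_neBot this]
  -- With equal coefficients the quadratic form of `scale e` is `e j₀` times the squared norm, so
  -- least weighted norm means least norm.
  · have hee := IncrementalProjection.coeff_eq_of_limsup_le (q := 1 / 2 - δ) (by linarith)
      (by linarith) hD he hε hle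
    set j₀ : Fin m := ⟨0, hm⟩
    have h1 := hwmin q hq
    have h2 := IncrementalProjection.le_inner_scale_self (γ := e) (fun j => hee j₀ j) w
    have h3 := IncrementalProjection.inner_scale_self_le (γ := e) (fun j => hee j j₀) q
    exact le_of_sq_le_sq (le_of_mul_le_mul_left (h2.trans (h1.trans h3)) (he j₀)) (norm_nonneg _)
  · obtain ⟨K, hK, h⟩ := IncrementalProjection.Problem.exists_gap_rate hm hP hF hs he
      (by linarith) (by linarith) hM₀ hpar' hb hβ hx hC ha hα hcpt
    refine ⟨K * (2 / Real.log 2 + 2), fun k hk => ?_⟩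
    obtain ⟨h1, h2, h3⟩ := h k
    refine ⟨h1, h2, h3.trans ?_⟩
    rw [mul_assoc]
    exact mul_le_mul_of_nonneg_left
      (IncrementalProjection.one_add_sum_decay_div_le hδ1 hk) hK.le
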